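/- Let $\Omega\subset\mathbb R^2$ be a bounded Lipschitz domain whose boundary is $\Gamma=\Gamma_{\rm in}\cup\Gamma_w\cup\Gamma_{\rm out}\cup\Gamma_1\cup\Gamma_2$ with measurable parts such that the closures of $\Gamma_1,\Gamma_2,\Gamma_{\rm out}$ are pairwise disjoint; let $n$ be the outward unit normal. Put $\Gamma_D=\Gamma_w\cup\Gamma_{\rm in}$, $$V^1=\{z\in H^1(\Omega;\mathbb R^2):\operatorname{div}z=0,\ z|_{\Gamma_D}=0\},\qquad V^0=\{z\in L^2(\Omega;\mathbb R^2):\operatorname{div}z=0,\ z\cdot n|_{\Gamma_D}=0\},$$ with the norms of $H^1$ and $L^2$, where $z\cdot n|_{\Gamma_D}=0$ is meant in the weak sense: $\int_\Omega z\cdot\nabla p\,dx=0$ for all $p\in H^1(\Omega)$ whose trace vanishes on $\Gamma\setminus\Gamma_D$. Let $\nu,\gamma>0$, $0<\varepsilon_0<\tfrac12$, $v_\infty\in H^{3/2+\varepsilon_0}(\Omega;\mathbb R^2)$ and $g_i\in H^{1/2}(\Gamma_i)$, $i=1,2$. Define $$a_\gamma(v,w)=\int_\Omega\nu(\nabla v+\nabla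 v^{\mathsf T}):(\nabla w+\nabla w^{\mathsf T})\,dx+\frac1\gamma\int_{\Gamma_1\cup\Gamma_2}v\cdot w\,ds,$$ $$b_\infty(v,w)=\int_\Omega((v_\infty\cdot\nabla)v)\cdot w+((v\cdot\nabla)v_\infty)\cdot w\,dx .$$ The Oseen operator $A$ in $V^0$ is given by: $v\in D(A)$ and $Av=f\in V^0$ if and only if $v\in V^1$ and $(-f,w)_{L^2}=a_\gamma(v,w)+b_\infty(v,w)$ for all $w\in V^1$. The input operator $B$ is given by $$(Bu,w)_{L^2}=-\frac1\gamma\sum_{i=1,2}u_i\int_{\Gamma_i}g_i\,n\cdot w\,ds,\qquad u\in\mathbb R^2,\ w\in V^0,$$ where for $w\in V^0$ the integral $\int_{\Gamma_i}g_i\,n\cdot w\,ds$ is the pairing of the normal trace of $w$ with $g_i$, that is $\int_\Omega w\cdot\nabla p_i\,dx$ for any $p_i\in H^1(\Omega)$ with trace $g_i$ on $\Gamma_i$ and $0$ on $\Gamma\setminus(\Gamma_D\cup\Gamma_i)$. Then there is exactly one such $B\in\mathcal L(\mathbb R^2,V^0)$, and the following holds. Let $k\in\mathbb N$, $C\in\mathcal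 L(V^0,\mathbb R^k)$ and $L\in\mathcal L(\mathbb R^k,V^0)$ be such that $A+LC$ is exponentially stable, i.e. $A+LC$ (with domain $D(A)$) generates a $C_0$-semigroup $S$ on $V^0$ with $\|S(t)\|\le Me^{-\omega t}$, $t\ge0$, for some $M,\omega>0$. Then there is a constant $c_\infty>0$ such that for every $u\in L^2(0,\infty;\mathbb R^2)$ the (mild) solution $v(t)=\int_0^tS(t-s)Bu(s)\,ds$ of $$\dot v=(A+LC)v+Bu,\qquad v(0)=0,$$ belongs to $L^2(0,\infty;V^1)$ and satisfies $$\|v\|_{L^2(0,\infty;V^1)}\le c_\infty\|u\|_{L^2(0,\infty;\mathbb R^2)} .$$ -/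

import Mathlib

open MeasureTheory Filter Topology Set
open scoped ContDiff ENNReal

noncomputable section

namespace Oseen

/-- The plane with its Euclidean norm. -/
abbrev Plane := EuclideanSpace ℝ (Fin 2)

/-- The coordinate directions of the plane. -/
def e (j : Fin 2) : Plane := EuclideanSpace.single j 1

/-! ### Lipschitz domains and their boundary -/

/-- Bounded Lipschitz domain: near each boundary point, and in suitable Cartesian coordinates, the
set is the region strictly above the graph of a Lipschitz function. -/
structure IsLipschitzDomain (Ω : Set Plane) : Prop where
  isOpen : IsOpen Ω
  isConnected : IsConnected Ω
  isBounded : Bornology.IsBounded Ω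
  graph : ∀ x ∈ frontier Ω, ∃ (R : Plane ≃ₗᵢ[ℝ] Plane) (K : NNReal) (f : ℝ → ℝ) (r : ℝ),
    0 < r ∧ LipschitzWith K f ∧ ∀ y ∈ Metric.ball x r, (y ∈ Ω ↔ f (R y 0) < R y 1)

/-- Arc length on the boundary of `Ω`. -/
abbrev bdry (Ω : Set Plane) : Measure Plane := (μH[1] : Measure Plane).restrict (frontier Ω)

/-- Decomposition of the boundary into inflow `Γin`, walls `Γw`, outflow `Γout` and the two control
boundaries `Γc 0`, `Γc 1`. The control boundaries touch neither each other nor the outflow. -/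
structure IsBoundaryDecomposition (Ω Γin Γw Γout : Set Plane) (Γc : Fin 2 → Set Plane) : Prop where
  cover : frontier Ω = Γin ∪ Γw ∪ Γout ∪ Γc 0 ∪ Γc 1
  meas_in : MeasurableSet Γin
  meas_w : MeasurableSet Γw
  meas_out : MeasurableSet Γout
  meas_c : ∀ i, MeasurableSet (Γc i)
  sep_c : Disjoint (closure (Γc 0)) (closure (Γc 1))
  sep_out : ∀ i, Disjoint (closure (Γc i)) (closure Γout)

/-! ### Sobolev spaces -/

section Sobolev

set_option linter.unusedSectionVars false

variable {F : Type*} [NormedAddCommGroup F] [InnerProductSpace ℝ F]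

/-- `L²(Ω; F)`. -/
abbrev L2 (Ω : Set Plane) (F : Type*) [NormedAddCommGroup F] [InnerProductSpace ℝ F] : Type _ :=
  Lp F 2 ((volume : Measure Plane).restrict Ω)

/-- Candidates `z = (z, (∂₀z, ∂₁z))` for elements of `H¹(Ω; F)`, with the Hilbert norm
`(‖z‖² + ‖∂₀z‖² + ‖∂₁z‖²)^{1/2}`. -/
abbrev Jet (Ω : Set Plane) (F : Type*) [NormedAddCommGroup F] [InnerProductSpace ℝ F] : Type _ :=
  WithLp 2 (L2 Ω F × PiLp 2 (fun _ : Fin 2 => L2 Ω F))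

/-- `g` is the weak partial derivative of `f` in direction `e j` on `Ω`. -/
def HasWeakPartial (Ω : Set Plane) (j : Fin 2) (f g : Plane → F) : Prop :=
  ∀ φ : Plane → ℝ, ContDiff ℝ ∞ φ → HasCompactSupport φ → tsupport φ ⊆ Ω →
    ∫ x in Ω, (fderiv ℝ φ x (e j)) • f x = - ∫ x in Ω, φ x • g x

lemma integrable_test_smul {Ω : Set Plane} {φ : Plane → ℝ} (hφ : Continuous φ)
    (hc : HasCompactSupport φ) (f : L2 Ω F) :
    Integrable (fun x => φ x • f x) ((volume : Measure Plane).restrict Ω) :=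
  ((Lp.memLp f).locallyIntegrable (by norm_num)).integrable_smul_left_of_hasCompactSupport hφ hc

lemma continuous_fderiv_test {φ : Plane → ℝ} (hφ : ContDiff ℝ ∞ φ) (v : Plane) :
    Continuous (fun x => fderiv ℝ φ x v) :=
  (hφ.continuous_fderiv (by simp)).clm_apply continuous_const

lemma integral_test_add {Ω : Set Plane} {φ : Plane → ℝ} (hφ : Continuous φ)
    (hc : HasCompactSupport φ) (f g : L2 Ω F) :
    ∫ x in Ω, φ x • (f + g : L2 Ω F) x = (∫ x in Ω, φ x • f x) + ∫ x in Ω, φ x • g x := by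
  rw [← integral_add (integrable_test_smul hφ hc f) (integrable_test_smul hφ hc g)]
  refine integral_congr_ae ?_
  filter_upwards [Lp.coeFn_add f g] with x hx
  rw [hx, Pi.add_apply, smul_add]

lemma integral_test_smul {Ω : Set Plane} (φ : Plane → ℝ) (c : ℝ) (f : L2 Ω F) :
    ∫ x in Ω, φ x • (c • f : L2 Ω F) x = c • ∫ x in Ω, φ x • f x := by
  rw [← integral_smul]
  refine integral_congr_ae ?_
  filter_upwards [Lp.coeFn_smul c f] with x hx
  simp [hx, smul_comm c]

lemma integral_test_zero {Ω : Set Plane} (φ : Plane → ℝ) :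
    ∫ x in Ω, φ x • (0 : L2 Ω F) x = 0 := by
  rw [integral_eq_zero_of_ae]
  filter_upwards [Lp.coeFn_zero F 2 ((volume : Measure Plane).restrict Ω)] with x hx
  rw [hx, Pi.zero_apply, smul_zero]

/-- `H¹(Ω; F)`. -/
def H1 (Ω : Set Plane) (F : Type*) [NormedAddCommGroup F] [InnerProductSpace ℝ F] :
    Submodule ℝ (Jet Ω F) where
  carrier := {z | ∀ j, HasWeakPartial Ω j z.fst (z.snd j)}
  zero_mem' := by
    intro j φ _ _ _
    simp only [WithLp.zero_fst, WithLp.zero_snd, PiLp.zero_apply]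
    rw [integral_test_zero (fun x => fderiv ℝ φ x (e j)), integral_test_zero, neg_zero]
  add_mem' := by
    intro y z hy hz j φ h1 h2 h3
    simp only [WithLp.add_fst, WithLp.add_snd, PiLp.add_apply]
    rw [integral_test_add (continuous_fderiv_test h1 (e j)) (h2.fderiv_apply ℝ (e j)),
      integral_test_add h1.continuous h2, hy j φ h1 h2 h3, hz j φ h1 h2 h3, neg_add]
  smul_mem' := by
    intro c z hz j φ h1 h2 h3
    simp only [WithLp.smul_fst, WithLp.smul_snd, PiLp.smul_apply]
    rw [integral_test_smul (fun x => fderiv ℝ φ x (e j)), integral_test_smul, hz j φ h1 h2 h3,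
      smul_neg]

/-- `z ∈ H^{1+s}(Ω; F)` for `0 < s < 1`: `z ∈ H¹(Ω; F)` and its first derivatives have finite
Sobolev–Slobodeckij seminorm of order `s` (the exponent is `d + 2s` with `d = 2`). -/
def MemHOneAdd (Ω : Set Plane) (s : ℝ) (z : Jet Ω F) : Prop :=
  z ∈ H1 Ω F ∧ ∀ j, ∫⁻ x in Ω, ∫⁻ y in Ω,
    ENNReal.ofReal (‖z.snd j x - z.snd j y‖ ^ 2 / ‖x - y‖ ^ (2 + 2 * s)) < ⊤

/-! ### Traces -/

/-- Convergence in `L²(μ)` of a sequence of functions to an element of `L²(μ)`. -/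
def TendstoL2 {μ : Measure Plane} (f : ℕ → Plane → F) (g : Lp F 2 μ) : Prop :=
  Tendsto (fun m => eLpNorm (fun x => f m x - g x) 2 μ) atTop (𝓝 0)

lemma TendstoL2.add {μ : Measure Plane} {f f' : ℕ → Plane → F} {g g' : Lp F 2 μ}
    (hf : ∀ m, AEStronglyMeasurable (f m) μ) (hf' : ∀ m, AEStronglyMeasurable (f' m) μ)
    (h : TendstoL2 f g) (h' : TendstoL2 f' g') :
    TendstoL2 (fun m x => f m x + f' m x) (g + g') := by
  have hs := Tendsto.add h h'
  rw [add_zero] at hs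
  refine tendsto_of_tendsto_of_tendsto_of_le_of_le tendsto_const_nhds hs (fun _ => zero_le) ?_
  intro m
  have hb := eLpNorm_add_le (p := 2) ((hf m).sub (Lp.aestronglyMeasurable g))
    ((hf' m).sub (Lp.aestronglyMeasurable g')) (by norm_num)
  refine le_trans (le_of_eq ?_) hb
  refine eLpNorm_congr_ae ?_
  filter_upwards [Lp.coeFn_add g g'] with x hx
  simp only [hx, Pi.add_apply, Pi.sub_apply]
  abel

lemma TendstoL2.const_smul {μ : Measure Plane} {f : ℕ → Plane → F} {g : Lp F 2 μ} (c : ℝ)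
    (h : TendstoL2 f g) : TendstoL2 (fun m x => c • f m x) (c • g) := by
  have hs := ENNReal.Tendsto.const_mul (a := ‖c‖ₑ) h (Or.inr (by simp))
  rw [mul_zero] at hs
  refine hs.congr ?_
  intro m
  rw [← eLpNorm_const_smul]
  refine eLpNorm_congr_ae ?_
  filter_upwards [Lp.coeFn_smul c g] with x hx
  simp only [hx, Pi.smul_apply, smul_sub]

lemma tendstoL2_zero {μ : Measure Plane} : TendstoL2 (fun _ _ => (0 : F)) (0 : Lp F 2 μ) := by
  refine tendsto_const_nhds.congr ?_
  intro m
  symm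
  rw [← eLpNorm_zero (ε := F) (p := 2) (μ := μ)]
  refine eLpNorm_congr_ae ?_
  filter_upwards [Lp.coeFn_zero F 2 μ] with x hx
  rw [hx, Pi.zero_apply, sub_zero]

/-- `τ ∈ L²(∂Ω; F)` is the boundary trace of `z ∈ H¹(Ω; F)`: there are functions, smooth up to the
boundary, that converge to `z` in `H¹(Ω; F)` and whose restrictions converge to `τ` in
`L²(∂Ω; F)`. On a bounded Lipschitz domain each `z` has exactly one trace. -/
def HasTrace (Ω : Set Plane) (z : Jet Ω F) (τ : Lp F 2 (bdry Ω)) : Prop :=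
  ∃ φ : ℕ → Plane → F, (∀ m, ContDiff ℝ ∞ (φ m)) ∧ TendstoL2 φ z.fst ∧
    (∀ j, TendstoL2 (fun m x => fderiv ℝ (φ m) x (e j)) (z.snd j)) ∧ TendstoL2 φ τ

open Classical in
/-- The boundary trace `z|_{∂Ω}`. -/
def trace (Ω : Set Plane) (z : Jet Ω F) : Lp F 2 (bdry Ω) :=
  if h : ∃ τ, HasTrace Ω z τ then h.choose else 0

lemma smooth_fderiv_meas {μ : Measure Plane} {φ : Plane → F} (h : ContDiff ℝ ∞ φ) (v : Plane) :
    AEStronglyMeasurable (fun x => fderiv ℝ φ x v) μ :=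
  ((h.continuous_fderiv (by simp)).clm_apply continuous_const).aestronglyMeasurable

lemma HasTrace.zero (Ω : Set Plane) : HasTrace Ω (0 : Jet Ω F) 0 := by
  refine ⟨fun _ _ => 0, fun _ => contDiff_const, tendstoL2_zero, fun j => ?_, tendstoL2_zero⟩
  simpa using tendstoL2_zero

lemma HasTrace.add {Ω : Set Plane} {y z : Jet Ω F} {σ τ : Lp F 2 (bdry Ω)}
    (hy : HasTrace Ω y σ) (hz : HasTrace Ω z τ) : HasTrace Ω (y + z) (σ + τ) := by
  obtain ⟨φ, a1, a2, a3, a4⟩ := hy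
  obtain ⟨ψ, b1, b2, b3, b4⟩ := hz
  refine ⟨fun m x => φ m x + ψ m x, fun m => (a1 m).add (b1 m), ?_, fun j => ?_, ?_⟩
  · exact TendstoL2.add (fun m => (a1 m).continuous.aestronglyMeasurable)
      (fun m => (b1 m).continuous.aestronglyMeasurable) a2 b2
  · have h := TendstoL2.add (fun m => smooth_fderiv_meas (a1 m) (e j))
      (fun m => smooth_fderiv_meas (b1 m) (e j)) (a3 j) (b3 j)
    have heq : (fun (m : ℕ) (x : Plane) => fderiv ℝ (fun x => φ m x + ψ m x) x (e j))
        = fun m x => fderiv ℝ (φ m) x (e j) + fderiv ℝ (ψ m) x (e j) := by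
      funext m x
      rw [fderiv_fun_add ((a1 m).differentiable (by simp) x)
        ((b1 m).differentiable (by simp) x)]
      rfl
    rw [heq]
    exact h
  · exact TendstoL2.add (fun m => (a1 m).continuous.aestronglyMeasurable)
      (fun m => (b1 m).continuous.aestronglyMeasurable) a4 b4

lemma HasTrace.smul {Ω : Set Plane} {z : Jet Ω F} {τ : Lp F 2 (bdry Ω)} (c : ℝ)
    (hz : HasTrace Ω z τ) : HasTrace Ω (c • z) (c • τ) := by
  obtain ⟨φ, a1, a2, a3, a4⟩ := hz
  refine ⟨fun m x => c • φ m x, fun m => (a1 m).const_smul c, a2.const_smul c, fun j => ?_,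
    a4.const_smul c⟩
  have heq : (fun (m : ℕ) (x : Plane) => fderiv ℝ (fun x => c • φ m x) x (e j))
      = fun m x => c • fderiv ℝ (φ m) x (e j) := by
    funext m x
    rw [fderiv_fun_const_smul ((a1 m).differentiable (by simp) x)]
    rfl
  rw [heq]
  exact (a3 j).const_smul c

/-- `g ∈ H^{1/2}(Γ)` for a boundary part `Γ`: `g` is on `Γ` the trace of a function in `H¹(Ω)`. -/
def MemHHalf (Ω Γ : Set Plane) (g : Plane → ℝ) : Prop :=
  ∃ p ∈ H1 Ω ℝ, ∃ τ, HasTrace Ω p τ ∧ ∀ᵐ x ∂(bdry Ω).restrict Γ, τ x = g x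

end Sobolev

/-! ### Solenoidal spaces -/

/-- `V¹`: the fields in `H¹(Ω; ℝ²)` that are divergence free and vanish on `ΓD` (the union of the
Dirichlet boundaries), with the norm of `H¹(Ω; ℝ²)`. -/
def V1 (Ω ΓD : Set Plane) : Submodule ℝ (Jet Ω Plane) where
  carrier := {z | z ∈ H1 Ω Plane ∧
    (∀ᵐ x ∂(volume : Measure Plane).restrict Ω, ∑ j, (z.snd j x) j = 0) ∧
    ∃ τ, HasTrace Ω z τ ∧ ∀ᵐ x ∂(bdry Ω).restrict ΓD, τ x = 0}
  zero_mem' := by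
    refine ⟨Submodule.zero_mem _, ?_, 0, HasTrace.zero Ω, ?_⟩
    · filter_upwards [Lp.coeFn_zero Plane 2 ((volume : Measure Plane).restrict Ω)] with x hx
      simp only [WithLp.zero_snd, PiLp.zero_apply]
      rw [hx]
      simp
    · filter_upwards [ae_restrict_of_ae (Lp.coeFn_zero Plane 2 (bdry Ω))] with x hx
      rw [hx, Pi.zero_apply]
  add_mem' := by
    rintro y z ⟨a1, a2, σ, a3, a4⟩ ⟨b1, b2, τ, b3, b4⟩
    refine ⟨Submodule.add_mem _ a1 b1, ?_, σ + τ, a3.add b3, ?_⟩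
    · filter_upwards [a2, b2, Lp.coeFn_add (y.snd 0) (z.snd 0), Lp.coeFn_add (y.snd 1) (z.snd 1)]
        with x h1 h2 h3 h4
      simp only [Fin.sum_univ_two, WithLp.add_snd, PiLp.add_apply, h3, h4, Pi.add_apply] at *
      linarith
    · filter_upwards [a4, b4, ae_restrict_of_ae (Lp.coeFn_add σ τ)] with x h1 h2 h3
      rw [h3, Pi.add_apply, h1, h2, add_zero]
  smul_mem' := by
    rintro c z ⟨b1, b2, τ, b3, b4⟩
    refine ⟨Submodule.smul_mem _ c b1, ?_, c • τ, b3.smul c, ?_⟩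
    · filter_upwards [b2, Lp.coeFn_smul c (z.snd 0), Lp.coeFn_smul c (z.snd 1)] with x h2 h3 h4
      simp only [Fin.sum_univ_two, WithLp.smul_snd, PiLp.smul_apply, h3, h4, Pi.smul_apply,
        smul_eq_mul] at *
      rw [← mul_add, h2, mul_zero]
    · filter_upwards [b4, ae_restrict_of_ae (Lp.coeFn_smul c τ)] with x h2 h3
      simp [h3, h2]

/-- `∫_Ω w · ∇p dx`. For `div w = 0` this is the pairing `⟨w · n, p⟩` on `∂Ω` of the normal trace of
`w`, an element of `H^{-1/2}(∂Ω)`, with the boundary values of `p ∈ H¹(Ω)`; it equals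
`∫_{∂Ω} p (w · n) ds` as soon as `w` has a trace. -/
def normalPairing {Ω : Set Plane} (w : L2 Ω Plane) (p : Jet Ω ℝ) : ℝ :=
  ∑ j, ∫ x in Ω, p.snd j x * w x j

lemma integrable_pairing {Ω : Set Plane} (w : L2 Ω Plane) (q : L2 Ω ℝ) (j : Fin 2) :
    Integrable (fun x => q x * w x j) ((volume : Measure Plane).restrict Ω) := by
  have h : MemLp (fun x => w x j) 2 ((volume : Measure Plane).restrict Ω) :=
    (EuclideanSpace.proj j : Plane →L[ℝ] ℝ).comp_memLp' (Lp.memLp w)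
  exact (Lp.memLp q).integrable_mul h

lemma normalPairing_add {Ω : Set Plane} (v w : L2 Ω Plane) (p : Jet Ω ℝ) :
    normalPairing (v + w) p = normalPairing v p + normalPairing w p := by
  unfold normalPairing
  rw [← Finset.sum_add_distrib]
  refine Finset.sum_congr rfl fun j _ => ?_
  rw [← integral_add (integrable_pairing v _ j) (integrable_pairing w _ j)]
  refine integral_congr_ae ?_
  filter_upwards [Lp.coeFn_add v w] with x hx
  rw [hx, Pi.add_apply, PiLp.add_apply, mul_add]

lemma normalPairing_smul {Ω : Set Plane} (c : ℝ) (w : L2 Ω Plane) (p : Jet Ω ℝ) :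
    normalPairing (c • w) p = c * normalPairing w p := by
  unfold normalPairing
  rw [Finset.mul_sum]
  refine Finset.sum_congr rfl fun j _ => ?_
  rw [← integral_const_mul]
  refine integral_congr_ae ?_
  filter_upwards [Lp.coeFn_smul c w] with x hx
  simp only [hx, Pi.smul_apply, PiLp.smul_apply, smul_eq_mul]
  ring

/-- `V⁰`: the fields `z ∈ L²(Ω; ℝ²)` with `div z = 0` (in the sense of distributions) and
`z · n = 0` on `ΓD` (the normal trace annihilates the boundary values that live on `ΓD`). -/
def V0 (Ω ΓD : Set Plane) : Submodule ℝ (L2 Ω Plane) where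
  carrier := {z |
    (∀ φ : Plane → ℝ, ContDiff ℝ ∞ φ → HasCompactSupport φ → tsupport φ ⊆ Ω →
      ∫ x in Ω, fderiv ℝ φ x (z x) = 0) ∧
    ∀ p ∈ H1 Ω ℝ, ∀ τ, HasTrace Ω p τ → (∀ᵐ x ∂(bdry Ω).restrict ΓDᶜ, τ x = 0) →
      normalPairing z p = 0}
  zero_mem' := by
    refine ⟨fun φ _ _ _ => ?_, fun p _ τ _ _ => ?_⟩
    · rw [integral_eq_zero_of_ae]
      filter_upwards [Lp.coeFn_zero Plane 2 ((volume : Measure Plane).restrict Ω)] with x hx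
      rw [hx, Pi.zero_apply, map_zero, Pi.zero_apply]
    · simpa using normalPairing_smul 0 (0 : L2 Ω Plane) p
  add_mem' := by
    rintro y z ⟨a1, a2⟩ ⟨b1, b2⟩
    refine ⟨fun φ h1 h2 h3 => ?_, fun p hp τ hτ h0 => ?_⟩
    · have key : ∀ f : L2 Ω Plane, Integrable (fun x => fderiv ℝ φ x (f x))
          ((volume : Measure Plane).restrict Ω) := by
        intro f
        obtain ⟨M, hM⟩ := (h2.fderiv ℝ).exists_bound_of_continuous
          (h1.continuous_fderiv (by simp))
        have hK : IsCompact (tsupport φ) := h2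
        have hfi : IntegrableOn f (tsupport φ) ((volume : Measure Plane).restrict Ω) :=
          ((Lp.memLp f).locallyIntegrable (by norm_num)).integrableOn_isCompact hK
        have hmeas : AEStronglyMeasurable (fun x => fderiv ℝ φ x (f x))
            ((volume : Measure Plane).restrict Ω) :=
          (ContinuousLinearMap.apply ℝ ℝ).aestronglyMeasurable_comp₂
            (Lp.aestronglyMeasurable f)
            (h1.continuous_fderiv (by simp)).aestronglyMeasurable
        have hg : Integrable ((tsupport φ).indicator (fun x => M * ‖f x‖))
            ((volume : Measure Plane).restrict Ω) :=
          (integrable_indicator_iff (isClosed_tsupport φ).measurableSet).2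
            (hfi.norm.const_mul M)
        refine hg.mono' hmeas (Eventually.of_forall fun x => ?_)
        by_cases hx : x ∈ tsupport φ
        · rw [indicator_of_mem hx]
          exact (ContinuousLinearMap.le_opNorm _ _).trans
            (mul_le_mul_of_nonneg_right (hM x) (norm_nonneg _))
        · rw [indicator_of_notMem hx, fderiv_of_notMem_tsupport ℝ hx]
          simp
      have e1 : ∫ x in Ω, fderiv ℝ φ x ((y + z : L2 Ω Plane) x)
          = (∫ x in Ω, fderiv ℝ φ x (y x)) + ∫ x in Ω, fderiv ℝ φ x (z x) := by
        rw [← integral_add (key y) (key z)]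
        refine integral_congr_ae ?_
        filter_upwards [Lp.coeFn_add y z] with x hx
        rw [hx, Pi.add_apply, map_add]
      rw [e1, a1 φ h1 h2 h3, b1 φ h1 h2 h3, add_zero]
    · rw [normalPairing_add, a2 p hp τ hτ h0, b2 p hp τ hτ h0, add_zero]
  smul_mem' := by
    rintro c z ⟨b1, b2⟩
    refine ⟨fun φ h1 h2 h3 => ?_, fun p hp τ hτ h0 => ?_⟩
    · have e1 : ∫ x in Ω, fderiv ℝ φ x ((c • z : L2 Ω Plane) x)
          = c * ∫ x in Ω, fderiv ℝ φ x (z x) := by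
        rw [← integral_const_mul]
        refine integral_congr_ae ?_
        filter_upwards [Lp.coeFn_smul c z] with x hx
        simp [hx]
      rw [e1, b1 φ h1 h2 h3, mul_zero]
    · rw [normalPairing_smul, b2 p hp τ hτ h0, mul_zero]

/-! ### The Oseen operator and the input operator -/

/-- `a_γ(v, w) = ∫_Ω ν (∇v + ∇vᵀ) : (∇w + ∇wᵀ) dx + γ⁻¹ ∫_{Γ₁ ∪ Γ₂} v · w ds`. -/
def formA (Ω : Set Plane) (Γc : Fin 2 → Set Plane) (ν γ : ℝ) (v w : Jet Ω Plane) : ℝ :=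
  (∫ x in Ω, ν * ∑ i, ∑ j,
      ((v.snd j x) i + (v.snd i x) j) * ((w.snd j x) i + (w.snd i x) j)) +
    1 / γ * ∫ x in Γc 0 ∪ Γc 1, inner ℝ (trace Ω v x) (trace Ω w x) ∂(bdry Ω)

/-- `b_∞(v, w) = ∫_Ω ((v_∞ · ∇)v) · w + ((v · ∇)v_∞) · w dx`. -/
def formB (Ω : Set Plane) (vInf v w : Jet Ω Plane) : ℝ :=
  ∫ x in Ω, (inner ℝ (∑ j, (vInf.fst x) j • v.snd j x) (w.fst x) +
    inner ℝ (∑ j, (v.fst x) j • vInf.snd j x) (w.fst x))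

/-- The graph of the Oseen operator `A` in `V⁰`: `v ∈ D(A)` and `A v = f`, that is `v ∈ V¹` and
`(-f, w) = a_γ(v, w) + b_∞(v, w)` for all `w ∈ V¹`. -/
def OseenGraph (Ω ΓD : Set Plane) (Γc : Fin 2 → Set Plane) (ν γ : ℝ) (vInf : Jet Ω Plane)
    (v f : V0 Ω ΓD) : Prop :=
  ∃ z ∈ V1 Ω ΓD, z.fst = (v : L2 Ω Plane) ∧
    ∀ w ∈ V1 Ω ΓD, inner ℝ (-(f : L2 Ω Plane)) w.fst
      = formA Ω Γc ν γ z w + formB Ω vInf z w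

/-- `B = Π B̃ : ℝ² → V⁰` with `B̃ u (w) = -γ⁻¹ ∑ᵢ uᵢ ∫_{Γᵢ} gᵢ n · w ds`. For `w ∈ V⁰` the integral is
the pairing of the normal trace of `w` with `gᵢ`, i.e. with any `p ∈ H¹(Ω)` that equals `gᵢ` on `Γᵢ`
and vanishes on the rest of `∂Ω ∖ ΓD` (on `ΓD` the normal trace of `w` is zero). -/
def IsInputOperator (Ω ΓD : Set Plane) (Γc : Fin 2 → Set Plane) (γ : ℝ) (g : Fin 2 → Plane → ℝ)
    (B : EuclideanSpace ℝ (Fin 2) →L[ℝ] V0 Ω ΓD) : Prop :=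
  ∀ p : Fin 2 → Jet Ω ℝ,
    (∀ i, p i ∈ H1 Ω ℝ ∧ ∃ τ, HasTrace Ω (p i) τ ∧
      (∀ᵐ x ∂(bdry Ω).restrict (Γc i), τ x = g i x) ∧
      ∀ᵐ x ∂(bdry Ω).restrict (ΓD ∪ Γc i)ᶜ, τ x = 0) →
    ∀ (u : EuclideanSpace ℝ (Fin 2)) (w : V0 Ω ΓD),
      inner ℝ (B u) w = -(1 / γ) * ∑ i, normalPairing (w : L2 Ω Plane) (p i) * u i

/-! ### Semigroups and solutions -/

section Semigroup

variable {X : Type*} [NormedAddCommGroup X] [NormedSpace ℝ X]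

/-- `S(t)`, `t ≥ 0`, is a strongly continuous semigroup. -/
structure IsC0Semigroup (S : ℝ → X →L[ℝ] X) : Prop where
  zero : S 0 = ContinuousLinearMap.id ℝ X
  add : ∀ s t, 0 ≤ s → 0 ≤ t → S (s + t) = (S s).comp (S t)
  cont : ∀ x, Tendsto (fun t => S t x) (𝓝[>] 0) (𝓝 x)

/-- The operator with graph `G` (`G x y` means `x` is in the domain and is sent to `y`) is the
infinitesimal generator of `S`. -/
def IsGenerator (G : X → X → Prop) (S : ℝ → X →L[ℝ] X) : Prop :=
  ∀ x y, G x y ↔ Tendsto (fun t : ℝ => t⁻¹ • (S t x - x)) (𝓝[>] 0) (𝓝 y)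

/-- `‖S(t)‖ ≤ M e^{-αt}` for all `t ≥ 0` with some `M, α > 0`. -/
def IsExpStable (S : ℝ → X →L[ℝ] X) : Prop :=
  ∃ M α : ℝ, 0 < M ∧ 0 < α ∧ ∀ t, 0 ≤ t → ‖S t‖ ≤ M * Real.exp (-α * t)

/-- `v` is the (mild) solution on `[0, ∞)` of `v̇ = 𝒜 v + B u`, `v(0) = 0`, where `𝒜` generates
`S`. -/
def IsMildSolution {U : Type*} [NormedAddCommGroup U] [NormedSpace ℝ U] (S : ℝ → X →L[ℝ] X)
    (B : U →L[ℝ] X) (u : ℝ → U) (v : ℝ → X) : Prop :=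
  ∀ t, 0 ≤ t → v t = ∫ s in (0 : ℝ)..t, S (t - s) (B (u s))

end Semigroup

end Oseen

end

open scoped Convolution

namespace Oseen

/-! ### Young's inequality -/

lemma sq_lintegral_mul_le {α : Type*} [MeasurableSpace α] {μ : Measure α} {k g : α → ℝ≥0∞}
    (hk : AEMeasurable k μ) (hg : AEMeasurable g μ) :
    (∫⁻ a, k a * g a ∂μ) ^ 2 ≤ (∫⁻ a, k a ∂μ) * ∫⁻ a, k a * g a ^ 2 ∂μ := by
  have h := ENNReal.lintegral_mul_le_Lp_mul_Lq μ Real.HolderConjugate.two_two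
    (f := fun a => k a ^ (1 / 2 : ℝ)) (g := fun a => k a ^ (1 / 2 : ℝ) * g a)
    (hk.pow_const _) ((hk.pow_const _).mul hg)
  have hs : ∀ x : ℝ≥0∞, x ^ (1 / 2 : ℝ) * x ^ (1 / 2 : ℝ) = x := fun x => by
    rw [← ENNReal.rpow_add_of_nonneg _ _ (by norm_num) (by norm_num)]; norm_num
  have hs2 : ∀ x : ℝ≥0∞, (x ^ (1 / 2 : ℝ)) ^ 2 = x := fun x => by rw [sq, hs]
  have e1 : ∀ a, ((fun a => k a ^ (1 / 2 : ℝ)) * fun a => k a ^ (1 / 2 : ℝ) * g a) a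
      = k a * g a := fun a => by
    simp only [Pi.mul_apply]; rw [← mul_assoc, hs]
  have e2 : ∀ a, (k a ^ (1 / 2 : ℝ)) ^ (2 : ℝ) = k a := fun a => by
    rw [ENNReal.rpow_two, hs2]
  have e3 : ∀ a, (k a ^ (1 / 2 : ℝ) * g a) ^ (2 : ℝ) = k a * g a ^ 2 := fun a => by
    rw [ENNReal.rpow_two, mul_pow, hs2]
  simp only [e1, e2, e3] at h
  calc _ ≤ ((∫⁻ a, k a ∂μ) ^ (1 / 2 : ℝ) * (∫⁻ a, k a * g a ^ 2 ∂μ) ^ (1 / 2 : ℝ)) ^ 2 := by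
        gcongr
    _ = _ := by rw [mul_pow, hs2, hs2]

lemma enn_sq_le_sq {a b : ℝ≥0∞} (h : a ^ 2 ≤ b ^ 2) : a ≤ b :=
  (ENNReal.pow_le_pow_left_iff two_ne_zero).1 h

lemma eLpNorm_two_sq {α E : Type*} [MeasurableSpace α] [NormedAddCommGroup E] (f : α → E)
    (μ : Measure α) : eLpNorm f 2 μ ^ 2 = ∫⁻ t, ‖f t‖ₑ ^ 2 ∂μ := by
  rw [eLpNorm_eq_lintegral_rpow_enorm_toReal (by norm_num) (by norm_num)]
  rw [← ENNReal.rpow_natCast, ← ENNReal.rpow_mul]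
  simp

/-- Young's inequality for the convolution of `L¹` and `L²` functions. -/
lemma lintegral_sq_convolution_le {G : Type*} [AddCommGroup G] [MeasurableSpace G]
    [MeasurableAdd₂ G] [MeasurableNeg G] {μ : Measure G} [SFinite μ] [μ.IsAddLeftInvariant]
    [μ.IsNegInvariant] {κ g : G → ℝ≥0∞} (hκ : Measurable κ) (hg : AEMeasurable g μ) :
    ∫⁻ t, (∫⁻ s, κ (t - s) * g s ∂μ) ^ 2 ∂μ ≤ (∫⁻ t, κ t ∂μ) ^ 2 * ∫⁻ s, g s ^ 2 ∂μ := by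
  have hsub : ∀ t : G, Measurable fun s : G => t - s := fun t => measurable_const_sub t
  calc ∫⁻ t, (∫⁻ s, κ (t - s) * g s ∂μ) ^ 2 ∂μ
      ≤ ∫⁻ t, (∫⁻ s, κ s ∂μ) * ∫⁻ s, κ (t - s) * g s ^ 2 ∂μ ∂μ := by
        refine lintegral_mono fun t => ?_
        have h := sq_lintegral_mul_le (μ := μ) (hκ.comp (hsub t)).aemeasurable hg
        rwa [show (∫⁻ a, (κ ∘ fun s => t - s) a ∂μ) = ∫⁻ s, κ s ∂μ from
          lintegral_sub_left_eq_self κ t] at h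
    _ = (∫⁻ s, κ s ∂μ) * ∫⁻ s, ∫⁻ t, κ (t - s) * g s ^ 2 ∂μ ∂μ := by
        have hm : AEMeasurable (Function.uncurry fun t s => κ (t - s) * g s ^ 2) (μ.prod μ) :=
          (hκ.comp measurable_sub).aemeasurable.mul
            ((hg.pow_const 2).comp_quasiMeasurePreserving Measure.quasiMeasurePreserving_snd)
        rw [← lintegral_lintegral_swap hm]
        exact lintegral_const_mul'' _ hm.lintegral_prod_right'
    _ = _ := by
        have : ∀ s, ∫⁻ t, κ (t - s) * g s ^ 2 ∂μ = (∫⁻ t, κ t ∂μ) * g s ^ 2 := fun s => by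
          have h := lintegral_mul_const (μ := μ) (g s ^ 2) (hκ.comp (measurable_sub_const s))
          simp only [Function.comp_apply] at h
          rw [h, lintegral_sub_right_eq_self κ s]
        simp_rw [this]
        rw [lintegral_const_mul'' _ (hg.pow_const 2), sq, mul_assoc]

/-! ### Orbits of exponentially stable semigroups -/

section Semigroup

variable {X Y H : Type*} [NormedAddCommGroup X] [InnerProductSpace ℝ X]
  [NormedAddCommGroup Y] [NormedSpace ℝ Y] [CompleteSpace Y]
  [NormedAddCommGroup H] [NormedSpace ℝ H] [CompleteSpace H]
  {S : ℝ → X →L[ℝ] X} {M α : ℝ}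

lemma IsC0Semigroup.continuousOn (hS : IsC0Semigroup S) (hM : ∀ t, 0 ≤ t → ‖S t‖ ≤ M) (x : X) :
    ContinuousOn (fun t => S t x) (Ici 0) := by
  have key : ∀ s t, 0 ≤ s → s ≤ t → ‖S t x - S s x‖ ≤ M * ‖S (t - s) x - x‖ := by
    intro s t hs hst
    have : S t x = S s (S (t - s) x) := by
      have h := hS.add s (t - s) hs (sub_nonneg.2 hst)
      rw [add_sub_cancel] at h
      rw [h]; rfl
    rw [this, ← map_sub]
    exact ((S s).le_opNorm _).trans (mul_le_mul_of_nonneg_right (hM s hs) (norm_nonneg _))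
  have key' : ∀ s t, 0 ≤ s → 0 ≤ t → ‖S t x - S s x‖ ≤ M * ‖S |t - s| x - x‖ := by
    intro s t hs ht
    rcases le_total s t with h | h
    · rw [abs_of_nonneg (sub_nonneg.2 h)]; exact key s t hs h
    · rw [abs_sub_comm, abs_of_nonneg (sub_nonneg.2 h), norm_sub_rev]; exact key t s ht h
  have h0 : Tendsto (fun t => S t x) (𝓝[≥] 0) (𝓝 x) := by
    have : 𝓝[≥] (0 : ℝ) = 𝓝[>] 0 ⊔ 𝓝[{0}] 0 := by
      rw [← nhdsWithin_union, Ioi_union_left]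
    rw [this, nhdsWithin_singleton]
    refine (hS.cont x).sup ?_
    rw [tendsto_pure_left]
    intro s hs
    rw [hS.zero]
    exact mem_of_mem_nhds hs
  intro t ht
  rw [ContinuousWithinAt, tendsto_iff_norm_sub_tendsto_zero]
  have h1 : Tendsto (fun s => |s - t|) (𝓝[≥] t ⊔ 𝓝[Ici 0] t) (𝓝[≥] 0) := by
    rw [tendsto_nhdsWithin_iff]
    refine ⟨?_, Eventually.of_forall fun s => mem_Ici.2 (abs_nonneg _)⟩
    have : Tendsto (fun s => |s - t|) (𝓝 t) (𝓝 |t - t|) :=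
      ((continuous_id.sub continuous_const).abs).tendsto t
    rw [sub_self, abs_zero] at this
    exact this.mono_left (sup_le nhdsWithin_le_nhds nhdsWithin_le_nhds)
  have h2 := ((h0.comp (h1.mono_left le_sup_right)).sub_const x).norm.const_mul M
  rw [sub_self, norm_zero, mul_zero] at h2
  refine squeeze_zero' (Eventually.of_forall fun _ => norm_nonneg _) ?_ h2
  filter_upwards [self_mem_nhdsWithin] with s hs
  exact key' t s ht hs

/-- The graph of the generator. -/
def GenGraph (S : ℝ → X →L[ℝ] X) (x y : X) : Prop :=
  Tendsto (fun t : ℝ => t⁻¹ • (S t x - x)) (𝓝[>] 0) (𝓝 y)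

lemma GenGraph.sub {x y x' y' : X} (h : GenGraph S x y) (h' : GenGraph S x' y') :
    GenGraph S (x - x') (y - y') := by
  refine (Tendsto.sub h h').congr fun t => ?_
  rw [map_sub, ← smul_sub]; congr 1; abel

lemma GenGraph.orbit (hS : IsC0Semigroup S) {x y : X} (h : GenGraph S x y) {t : ℝ} (ht : 0 ≤ t) :
    GenGraph S (S t x) (S t y) := by
  have h1 := ((S t).continuous.tendsto y).comp h
  refine h1.congr' ?_
  filter_upwards [self_mem_nhdsWithin] with s hs
  have e1 : S s (S t x) = S t (S s x) := by
    have a := hS.add s t (le_of_lt hs) ht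
    have b := hS.add t s ht (le_of_lt hs)
    rw [add_comm, b] at a
    exact (DFunLike.congr_fun a x).symm
  simp only [Function.comp_apply, map_smul, map_sub, e1]

lemma GenGraph.hasDerivWithinAt (hS : IsC0Semigroup S) {x y : X} (h : GenGraph S x y) {t : ℝ}
    (ht : 0 ≤ t) : HasDerivWithinAt (fun t => S t x) (S t y) (Ioi t) t := by
  rw [hasDerivWithinAt_iff_tendsto_slope' self_notMem_Ioi]
  have h1 := ((S t).continuous.tendsto y).comp h
  have h2 : Tendsto (fun s => s - t) (𝓝[>] t) (𝓝[>] 0) := by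
    rw [tendsto_nhdsWithin_iff]
    refine ⟨?_, ?_⟩
    · have : Tendsto (fun s => s - t) (𝓝 t) (𝓝 (t - t)) :=
        (continuous_id.sub continuous_const).tendsto t
      rw [sub_self] at this
      exact this.mono_left nhdsWithin_le_nhds
    · filter_upwards [self_mem_nhdsWithin] with s hs
      exact mem_Ioi.2 (sub_pos.2 (mem_Ioi.1 hs))
  refine (h1.comp h2).congr' ?_
  filter_upwards [self_mem_nhdsWithin] with s hs
  have a := hS.add t (s - t) ht (sub_nonneg.2 (le_of_lt hs))
  rw [add_sub_cancel] at a
  simp [slope_def_module, a]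

/-- The domain of the generator is dense. -/
lemma exists_genGraph_tendsto [CompleteSpace X] (hS : IsC0Semigroup S) (hM : ∀ t, 0 ≤ t → ‖S t‖ ≤ M) (b : X) :
    ∃ x y : ℕ → X, (∀ n, GenGraph S (x n) (y n)) ∧ Tendsto x atTop (𝓝 b) := by
  have hc := hS.continuousOn hM b
  have hint : ∀ r s, 0 ≤ r → 0 ≤ s → IntervalIntegrable (fun t => S t b) volume r s :=
    fun r s hr hs => (hc.mono fun t ht => (le_min hr hs).trans ht.1).intervalIntegrable
  have hder : ∀ r s, 0 ≤ r → 0 ≤ s →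
      HasDerivWithinAt (fun t => ∫ τ in r..t, S τ b) (S s b) (Ici s) s := fun r s hr hs =>
    intervalIntegral.integral_hasDerivWithinAt_right (hint r s hr hs)
      (ContinuousOn.stronglyMeasurableAtFilter_nhdsWithin (s := Ici 0) (hc) measurableSet_Ici s |>.filter_mono
        (nhdsWithin_mono _ (Ioi_subset_Ici_self.trans (Ici_subset_Ici.2 hs))))
      ((hc s hs).mono (Ioi_subset_Ici_self.trans (Ici_subset_Ici.2 hs)))
  have slope0 : ∀ s, 0 ≤ s → Tendsto (fun t : ℝ => t⁻¹ • ∫ τ in s..s + t, S τ b)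
      (𝓝[>] 0) (𝓝 (S s b)) := by
    intro s hs
    have h := ((hder s s hs hs).mono Ioi_subset_Ici_self)
    rw [hasDerivWithinAt_iff_tendsto_slope' self_notMem_Ioi] at h
    have h2 : Tendsto (fun t => s + t) (𝓝[>] 0) (𝓝[>] s) := by
      rw [tendsto_nhdsWithin_iff]
      refine ⟨?_, ?_⟩
      · have : Tendsto (fun t => s + t) (𝓝 0) (𝓝 (s + 0)) :=
          (continuous_const.add continuous_id).tendsto 0
        rw [add_zero] at this
        exact this.mono_left nhdsWithin_le_nhds
      · filter_upwards [self_mem_nhdsWithin] with t ht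
        exact lt_add_of_pos_right s ht
    refine (h.comp h2).congr fun t => ?_
    simp [slope_def_module]
  have gen : ∀ h : ℝ, 0 < h → GenGraph S (h⁻¹ • ∫ τ in (0 : ℝ)..h, S τ b) (h⁻¹ • (S h b - b)) := by
    intro h hh
    have l1 := (slope0 h hh.le).sub (slope0 0 le_rfl)
    have l2 := l1.const_smul h⁻¹
    rw [hS.zero] at l2
    refine l2.congr' ?_
    filter_upwards [self_mem_nhdsWithin] with t ht
    have ht' : 0 ≤ t := le_of_lt ht
    have e1 : S t (∫ τ in (0 : ℝ)..h, S τ b) = ∫ τ in t..h + t, S τ b := by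
      rw [← (S t).intervalIntegral_comp_comm (hint 0 h le_rfl hh.le)]
      have : ∫ τ in (0 : ℝ)..h, S t (S τ b) = ∫ τ in (0 : ℝ)..h, S (τ + t) b := by
        refine intervalIntegral.integral_congr fun τ hτ => ?_
        rw [uIcc_of_le hh.le] at hτ
        rw [add_comm, hS.add t τ ht' hτ.1]; rfl
      rw [this, intervalIntegral.integral_comp_add_right (fun τ => S τ b), zero_add]
    have e2 := intervalIntegral.integral_add_adjacent_intervals (hint 0 t le_rfl ht')
      (hint t (h + t) ht' (by positivity))
    have e3 := intervalIntegral.integral_add_adjacent_intervals (hint 0 h le_rfl hh.le)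
      (hint h (h + t) hh.le (by positivity))
    rw [map_smul, e1, zero_add, ← smul_sub, ← smul_sub, smul_comm]
    congr 2
    rw [sub_eq_sub_iff_add_eq_add, add_comm, e3, ← e2, add_comm]
  refine ⟨fun n => ((n : ℝ) + 1)⁻¹⁻¹ • ∫ τ in (0 : ℝ)..((n : ℝ) + 1)⁻¹, S τ b, _, fun n => gen _ (by positivity), ?_⟩
  have h1 := slope0 0 le_rfl
  simp only [zero_add, hS.zero] at h1
  refine h1.comp ?_
  rw [tendsto_nhdsWithin_iff]
  refine ⟨?_, Eventually.of_forall fun n => by simp only [mem_Ioi]; positivity⟩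
  simpa using tendsto_one_div_add_atTop_nhds_zero_nat (𝕜 := ℝ)

end Semigroup

section Semigroup

variable {X Y H : Type*} [NormedAddCommGroup X] [InnerProductSpace ℝ X]
  [NormedAddCommGroup Y] [NormedSpace ℝ Y]
  [NormedAddCommGroup H] [NormedSpace ℝ H]
  {S : ℝ → X →L[ℝ] X} {M α c Λ : ℝ} {j : Y →L[ℝ] H} {ι : X →ₗᵢ[ℝ] H}

/-- The generator is coercive with respect to the norm of `Y`, up to multiples of the norm
of `X`. -/
def IsCoerciveGenerator (S : ℝ → X →L[ℝ] X) (j : Y →L[ℝ] H) (ι : X →ₗᵢ[ℝ] H) (c Λ : ℝ) : Prop :=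
  ∀ x y, GenGraph S x y → ∃ z : Y, j z = ι x ∧ c * ‖z‖ ^ 2 ≤ -inner ℝ y x + Λ * ‖x‖ ^ 2

lemma IsCoerciveGenerator.sq_norm_le (hen : IsCoerciveGenerator S j ι c Λ)
    (hj : Function.Injective j) {x y : X} (h : GenGraph S x y) {z : Y} (hz : j z = ι x) :
    c * ‖z‖ ^ 2 ≤ -inner ℝ y x + Λ * ‖x‖ ^ 2 := by
  obtain ⟨z', h1, h2⟩ := hen x y h
  rwa [hj (hz.trans h1.symm)]

lemma IsCoerciveGenerator.continuousOn (hS : IsC0Semigroup S) (hM : ∀ t, 0 ≤ t → ‖S t‖ ≤ M)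
    (hc : 0 < c) (hj : Function.Injective j) (hen : IsCoerciveGenerator S j ι c Λ) {x y : X}
    (h : GenGraph S x y) {z : ℝ → Y} (hz : ∀ t, 0 ≤ t → j (z t) = ι (S t x)) :
    ContinuousOn z (Ici 0) := by
  intro t ht
  have cx := hS.continuousOn hM x t ht
  have cy := hS.continuousOn hM y t ht
  rw [ContinuousWithinAt] at cx cy ⊢
  rw [tendsto_iff_norm_sub_tendsto_zero]
  have l1 : Tendsto (fun s => √((-inner ℝ (S s y - S t y) (S s x - S t x)
      + Λ * ‖S s x - S t x‖ ^ 2) / c)) (𝓝[Ici 0] t) (𝓝 0) := by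
    have hx := cx.sub_const (S t x)
    have hy := cy.sub_const (S t y)
    have := (((hy.inner hx (𝕜 := ℝ)).neg.add ((hx.norm.pow 2).const_mul Λ)).div_const c).sqrt
    simpa using this
  refine squeeze_zero' (Eventually.of_forall fun _ => norm_nonneg _) ?_ l1
  filter_upwards [self_mem_nhdsWithin] with s hs
  refine Real.le_sqrt_of_sq_le ?_
  rw [le_div_iff₀ hc, mul_comm]
  refine hen.sq_norm_le hj ((h.orbit hS hs).sub (h.orbit hS ht)) ?_
  rw [map_sub, map_sub, hz s hs, hz t ht]

lemma IsCoerciveGenerator.integral_exp_mul_sq_norm_le (hS : IsC0Semigroup S)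
    (hst : ∀ t, 0 ≤ t → ‖S t‖ ≤ M * Real.exp (-α * t)) (hα : 0 < α) (hΛ : 0 ≤ Λ)
    (hc : 0 < c) (hj : Function.Injective j) (hen : IsCoerciveGenerator S j ι c Λ) {x y : X}
    (h : GenGraph S x y) {z : ℝ → Y} (hz : ∀ t, 0 ≤ t → j (z t) = ι (S t x)) {T : ℝ} (hT : 0 ≤ T) :
    ∫ t in (0 : ℝ)..T, Real.exp (α * t) * ‖z t‖ ^ 2 ≤
      (1 / 2 + (α / 2 + Λ) * (M ^ 2 / α)) / c * ‖x‖ ^ 2 := by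
  have hM0 : 0 ≤ M := by simpa using (norm_nonneg _).trans (hst 0 le_rfl)
  have hM : ∀ t, 0 ≤ t → ‖S t‖ ≤ M := fun t ht => (hst t ht).trans
    (mul_le_of_le_one_right hM0 (Real.exp_le_one_iff.2 (by nlinarith)))
  have hsub : Icc 0 T ⊆ Ici 0 := fun t ht => ht.1
  have cx := (hS.continuousOn hM x).mono hsub
  have cy := (hS.continuousOn hM y).mono hsub
  have cz := (hen.continuousOn hS hM hc hj h hz).mono hsub
  have ce : ∀ a : ℝ, ContinuousOn (fun t : ℝ => Real.exp (a * t)) (Icc 0 T) := fun a => by fun_prop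
  set f' : ℝ → ℝ := fun t => α * Real.exp (α * t) * ‖S t x‖ ^ 2
    + Real.exp (α * t) * (2 * inner ℝ (S t x) (S t y)) with hf'
  have ftc : ∫ t in (0 : ℝ)..T, f' t = Real.exp (α * T) * ‖S T x‖ ^ 2 - ‖x‖ ^ 2 := by
    rw [intervalIntegral.integral_eq_sub_of_hasDeriv_right_of_le
      (f := fun t => Real.exp (α * t) * ‖S t x‖ ^ 2) hT]
    · simp [hS.zero]
    · exact (ce α).mul (cx.norm.pow 2)
    · intro t ht
      have d1 : HasDerivAt (fun t => Real.exp (α * t)) (α * Real.exp (α * t)) t := by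
        have := ((hasDerivAt_id t).const_mul α).exp
        simpa [mul_comm] using this
      exact d1.hasDerivWithinAt.mul (h.hasDerivWithinAt hS ht.1.le).norm_sq
    · refine ContinuousOn.intervalIntegrable ?_
      rw [uIcc_of_le hT]
      exact (((ce α).const_smul α).mul (cx.norm.pow 2)).add
        ((ce α).mul ((cx.inner (𝕜 := ℝ) cy).const_smul (2 : ℝ)))
  have hf'i : IntervalIntegrable f' volume 0 T := by
    refine ContinuousOn.intervalIntegrable ?_
    rw [uIcc_of_le hT]
    exact (((ce α).const_smul α).mul (cx.norm.pow 2)).add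
      ((ce α).mul ((cx.inner (𝕜 := ℝ) cy).const_smul (2 : ℝ)))
  have hei : IntervalIntegrable (fun t => Real.exp (-α * t)) volume 0 T := by
    refine ContinuousOn.intervalIntegrable ?_
    rw [uIcc_of_le hT]; exact ce _
  have hexp : ∫ t in (0 : ℝ)..T, Real.exp (-α * t) ≤ 1 / α := by
    have : ∫ t in (0 : ℝ)..T, Real.exp (-α * t) = (1 - Real.exp (-α * T)) / α := by
      rw [intervalIntegral.integral_comp_mul_left (fun t => Real.exp t) (neg_ne_zero.2 hα.ne'),
        integral_exp, mul_zero, Real.exp_zero, smul_eq_mul]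
      field_simp
      ring
    rw [this]
    gcongr
    linarith [Real.exp_pos (-α * T)]
  have main : ∫ t in (0 : ℝ)..T, c * (Real.exp (α * t) * ‖z t‖ ^ 2) ≤
      ∫ t in (0 : ℝ)..T, (-(1 / 2) * f' t
        + (α / 2 + Λ) * M ^ 2 * ‖x‖ ^ 2 * Real.exp (-α * t)) := by
    refine intervalIntegral.integral_mono_on hT ?_ ((hf'i.const_mul _).add (hei.const_mul _)) ?_
    · refine ContinuousOn.intervalIntegrable ?_
      rw [uIcc_of_le hT]
      exact ((ce α).mul (cz.norm.pow 2)).const_smul c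
    · intro t ht
      have h1 := hen.sq_norm_le hj (h.orbit hS ht.1) (hz t ht.1)
      have h2 : ‖S t x‖ ≤ M * Real.exp (-α * t) * ‖x‖ :=
        ((S t).le_opNorm x).trans (mul_le_mul_of_nonneg_right (hst t ht.1) (norm_nonneg _))
      have h3 : Real.exp (α * t) * ‖S t x‖ ^ 2 ≤ M ^ 2 * ‖x‖ ^ 2 * Real.exp (-α * t) := by
        calc Real.exp (α * t) * ‖S t x‖ ^ 2
            ≤ Real.exp (α * t) * (M * Real.exp (-α * t) * ‖x‖) ^ 2 := by gcongr
          _ = (Real.exp (α * t) * Real.exp (-α * t)) * (M ^ 2 * ‖x‖ ^ 2 * Real.exp (-α * t)) := by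
            ring
          _ = _ := by rw [← Real.exp_add]; simp
      have h4 := mul_le_mul_of_nonneg_left h1 (Real.exp_pos (α * t)).le
      have h5 := mul_le_mul_of_nonneg_left h3 (by positivity : 0 ≤ α / 2 + Λ)
      have h6 := real_inner_comm (S t x) (S t y)
      simp only [hf']
      rw [← h6]
      linarith
  rw [intervalIntegral.integral_const_mul, intervalIntegral.integral_add (hf'i.const_mul _)
    (hei.const_mul _), intervalIntegral.integral_const_mul, intervalIntegral.integral_const_mul,
    ftc] at main
  have h7 : (α / 2 + Λ) * M ^ 2 * ‖x‖ ^ 2 * ∫ t in (0 : ℝ)..T, Real.exp (-α * t)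
      ≤ (α / 2 + Λ) * M ^ 2 * ‖x‖ ^ 2 * (1 / α) := by gcongr
  have h8 : 0 ≤ Real.exp (α * T) * ‖S T x‖ ^ 2 := by positivity
  rw [div_mul_eq_mul_div, le_div_iff₀ hc]
  calc _ ≤ 1 / 2 * ‖x‖ ^ 2 + (α / 2 + Λ) * M ^ 2 * ‖x‖ ^ 2 * (1 / α) := by linarith
    _ = _ := by ring

lemma IsCoerciveGenerator.lintegral_norm_le (hS : IsC0Semigroup S)
    (hst : ∀ t, 0 ≤ t → ‖S t‖ ≤ M * Real.exp (-α * t)) (hα : 0 < α) (hΛ : 0 ≤ Λ)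
    (hc : 0 < c) (hj : Function.Injective j) (hen : IsCoerciveGenerator S j ι c Λ) :
    ∃ D : ℝ, ∀ x y, GenGraph S x y → ∀ z : ℝ → Y, (∀ t, 0 ≤ t → j (z t) = ι (S t x)) →
      ∫⁻ t in Ioi (0 : ℝ), ‖z t‖ₑ ≤ ENNReal.ofReal (D * ‖x‖) := by
  have hM0 : 0 ≤ M := by simpa using (norm_nonneg _).trans (hst 0 le_rfl)
  have hM : ∀ t, 0 ≤ t → ‖S t‖ ≤ M := fun t ht => (hst t ht).trans
    (mul_le_of_le_one_right hM0 (Real.exp_le_one_iff.2 (by nlinarith)))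
  set D1 := (1 / 2 + (α / 2 + Λ) * (M ^ 2 / α)) / c with hD1
  have hD1' : 0 ≤ D1 := by positivity
  refine ⟨√(1 / α * D1), fun x y h z hz => ?_⟩
  have cz := (hen.continuousOn hS hM hc hj h hz).mono Ioi_subset_Ici_self
  have mz : AEMeasurable (fun t => ‖z t‖ₑ) (volume.restrict (Ioi (0 : ℝ))) :=
    (cz.aestronglyMeasurable measurableSet_Ioi).enorm
  have e1 : ∫⁻ t in Ioi (0 : ℝ), ENNReal.ofReal (Real.exp (-α * t)) = ENNReal.ofReal (1 / α) := by
    rw [← ofReal_integral_eq_lintegral_ofReal (integrableOn_exp_mul_Ioi (by linarith) 0)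
      (Eventually.of_forall fun t => (Real.exp_pos _).le), integral_exp_mul_Ioi (by linarith)]
    simp
  have e2 : ∫⁻ t in Ioi (0 : ℝ), ENNReal.ofReal (Real.exp (α * t) * ‖z t‖ ^ 2)
      ≤ ENNReal.ofReal (D1 * ‖x‖ ^ 2) := by
    have hb : ∀ T : ℝ, 0 ≤ T → _ := fun T hT =>
      hen.integral_exp_mul_sq_norm_le hS hst hα hΛ hc hj h hz hT
    have ci : ContinuousOn (fun t => Real.exp (α * t) * ‖z t‖ ^ 2) (Ici 0) :=
      (by fun_prop : ContinuousOn (fun t => Real.exp (α * t)) (Ici 0)).mul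
        ((hen.continuousOn hS hM hc hj h hz).norm.pow 2)
    have hi : IntegrableOn (fun t => Real.exp (α * t) * ‖z t‖ ^ 2) (Ioi 0) := by
      refine integrableOn_Ioi_of_intervalIntegral_norm_bounded (D1 * ‖x‖ ^ 2) 0
        (b := fun n : ℕ => (n : ℝ)) (l := atTop) (fun n => ?_) tendsto_natCast_atTop_atTop
        (Eventually.of_forall fun n => ?_)
      · exact (ci.mono fun t ht => ht.1).integrableOn_Icc.mono_set Ioc_subset_Icc_self
      · refine le_trans (le_of_eq ?_) (hb n n.cast_nonneg)
        refine intervalIntegral.integral_congr fun t _ => ?_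
        exact Real.norm_of_nonneg (by positivity)
    rw [← ofReal_integral_eq_lintegral_ofReal hi (Eventually.of_forall fun t => by positivity)]
    refine ENNReal.ofReal_le_ofReal ?_
    refine le_of_tendsto (intervalIntegral_tendsto_integral_Ioi 0 hi tendsto_natCast_atTop_atTop)
      (Eventually.of_forall fun n : ℕ => hb n n.cast_nonneg)
  have key := sq_lintegral_mul_le (μ := volume.restrict (Ioi (0 : ℝ)))
    (k := fun t => ENNReal.ofReal (Real.exp (-α * t)))
    (g := fun t => ENNReal.ofReal (Real.exp (α * t)) * ‖z t‖ₑ) (by fun_prop)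
    (AEMeasurable.mul (by fun_prop) mz)
  have hee : ∀ t, ENNReal.ofReal (Real.exp (-α * t)) * ENNReal.ofReal (Real.exp (α * t)) = 1 := by
    intro t
    rw [← ENNReal.ofReal_mul (Real.exp_pos _).le, ← Real.exp_add]
    simp
  have p1 : ∀ t, ENNReal.ofReal (Real.exp (-α * t)) * (ENNReal.ofReal (Real.exp (α * t)) * ‖z t‖ₑ)
      = ‖z t‖ₑ := fun t => by rw [← mul_assoc, hee, one_mul]
  have p2 : ∀ t, ENNReal.ofReal (Real.exp (-α * t)) *
      (ENNReal.ofReal (Real.exp (α * t)) * ‖z t‖ₑ) ^ 2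
      = ENNReal.ofReal (Real.exp (α * t) * ‖z t‖ ^ 2) := fun t => by
    rw [sq, ← mul_assoc, p1, ENNReal.ofReal_mul (Real.exp_pos _).le,
      ENNReal.ofReal_pow (norm_nonneg _), ofReal_norm]
    ring
  simp only [p1, p2, e1] at key
  have key2 : (∫⁻ t in Ioi (0 : ℝ), ‖z t‖ₑ) ^ 2 ≤ ENNReal.ofReal (√(1 / α * D1) * ‖x‖) ^ 2 := by
    refine key.trans ((mul_le_mul_right e2 _).trans (le_of_eq ?_))
    rw [← ENNReal.ofReal_mul (by positivity), ← ENNReal.ofReal_pow (by positivity), mul_pow,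
      Real.sq_sqrt (by positivity), mul_assoc]
  exact enn_sq_le_sq key2

/-- The orbit of each point of `X` has an integrable lift to `Y`. -/
lemma IsCoerciveGenerator.exists_lift [CompleteSpace X] [CompleteSpace Y] (hS : IsC0Semigroup S)
    (hst : ∀ t, 0 ≤ t → ‖S t‖ ≤ M * Real.exp (-α * t)) (hα : 0 < α) (hΛ : 0 ≤ Λ)
    (hc : 0 < c) (hj : Function.Injective j) (hen : IsCoerciveGenerator S j ι c Λ) (b : X) :
    ∃ k : ℝ → Y, StronglyMeasurable k ∧ Integrable k ∧ (∀ t, t ≤ 0 → k t = 0) ∧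
      ∀ᵐ t ∂volume.restrict (Ioi (0 : ℝ)), j (k t) = ι (S t b) := by
  have hM0 : 0 ≤ M := by simpa using (norm_nonneg _).trans (hst 0 le_rfl)
  have hM : ∀ t, 0 ≤ t → ‖S t‖ ≤ M := fun t ht => (hst t ht).trans
    (mul_le_of_le_one_right hM0 (Real.exp_le_one_iff.2 (by nlinarith)))
  obtain ⟨D, hD⟩ := hen.lintegral_norm_le hS hst hα hΛ hc hj
  obtain ⟨x, y, hxy, hx⟩ := exists_genGraph_tendsto hS hM b
  have hex : ∀ n t, ∃ z : Y, 0 ≤ t → j z = ι (S t (x n)) := by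
    intro n t
    by_cases ht : 0 ≤ t
    · obtain ⟨z, hz, -⟩ := hen _ _ ((hxy n).orbit hS ht)
      exact ⟨z, fun _ => hz⟩
    · exact ⟨0, fun h => absurd h ht⟩
  choose z hz using hex
  have hmeas : ∀ n, AEStronglyMeasurable (z n) (volume.restrict (Ioi (0 : ℝ))) := fun n =>
    ((hen.continuousOn hS hM hc hj (hxy n) (hz n)).mono
      Ioi_subset_Ici_self).aestronglyMeasurable measurableSet_Ioi
  have hmem : ∀ n, MemLp (z n) 1 (volume.restrict (Ioi (0 : ℝ))) := fun n => by
    refine ⟨hmeas n, ?_⟩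
    rw [eLpNorm_one_eq_lintegral_enorm]
    exact (hD _ _ (hxy n) _ (hz n)).trans_lt ENNReal.ofReal_lt_top
  have hdist : ∀ n m, eLpNorm (z n - z m) 1 (volume.restrict (Ioi (0 : ℝ)))
      ≤ ENNReal.ofReal (D * ‖x n - x m‖) := fun n m => by
    rw [eLpNorm_one_eq_lintegral_enorm]
    refine hD _ _ ((hxy n).sub (hxy m)) _ fun t ht => ?_
    rw [Pi.sub_apply, map_sub, map_sub, map_sub, hz n t ht, hz m t ht]
  have hcau : CauchySeq fun n => (hmem n).toLp (z n) := by
    have hxc := hx.cauchySeq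
    rw [Metric.cauchySeq_iff] at hxc ⊢
    intro ε hε
    obtain ⟨N, hN⟩ := hxc (ε / (|D| + 1)) (by positivity)
    refine ⟨N, fun m hm n hn => ?_⟩
    have h1 := hN m hm n hn
    rw [dist_eq_norm] at h1
    rw [dist_eq_norm, ← MemLp.toLp_sub, Lp.norm_toLp]
    have h2 : (eLpNorm (z m - z n) 1 (volume.restrict (Ioi (0 : ℝ)))).toReal
        ≤ |D| * ‖x m - x n‖ := by
      refine ENNReal.toReal_le_of_le_ofReal (by positivity) ((hdist m n).trans ?_)
      exact ENNReal.ofReal_le_ofReal (mul_le_mul_of_nonneg_right (le_abs_self D) (norm_nonneg _))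
    rw [lt_div_iff₀ (by positivity)] at h1
    nlinarith [norm_nonneg (x m - x n)]
  obtain ⟨K, hK⟩ := cauchySeq_tendsto_of_complete hcau
  have hKm := tendstoInMeasure_of_tendsto_Lp hK
  obtain ⟨ns, hns, hae⟩ := hKm.exists_seq_tendsto_ae
  have hKi : Integrable K (volume.restrict (Ioi (0 : ℝ))) := L1.integrable_coeFn K
  have hsm := (Lp.stronglyMeasurable K)
  refine ⟨(Ioi (0 : ℝ)).indicator K, hsm.indicator measurableSet_Ioi,
    (integrable_indicator_iff measurableSet_Ioi).2 hKi, fun t ht => ?_, ?_⟩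
  · exact indicator_of_notMem (by simpa using ht) _
  · have hall : ∀ᵐ t ∂volume.restrict (Ioi (0 : ℝ)), ∀ n, (hmem n).toLp (z n) t = z n t :=
      ae_all_iff.2 fun n => (hmem n).coeFn_toLp
    filter_upwards [hae, hall, ae_restrict_mem measurableSet_Ioi] with t h1 h2 ht
    rw [indicator_of_mem ht]
    have l1 := (j.continuous.tendsto _).comp h1
    have l2 : Tendsto (fun n => ι (S t (x (ns n)))) atTop (𝓝 (ι (S t b))) :=
      (ι.continuous.tendsto _).comp (((S t).continuous.tendsto b).comp
        (hx.comp hns.tendsto_atTop))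
    refine tendsto_nhds_unique (l1.congr fun n => ?_) l2
    simp only [Function.comp_apply]
    rw [h2, hz _ t (le_of_lt ht)]

end Semigroup

section Semigroup

variable {X Y H : Type*} [NormedAddCommGroup X] [InnerProductSpace ℝ X] [CompleteSpace X]
  [NormedAddCommGroup Y] [NormedSpace ℝ Y] [CompleteSpace Y]
  [NormedAddCommGroup H] [NormedSpace ℝ H] [CompleteSpace H]
  {S : ℝ → X →L[ℝ] X} {M α c Λ : ℝ} {j : Y →L[ℝ] H} {ι : X →ₗᵢ[ℝ] H}

/-- Mild solutions with finite dimensional input are square integrable with values in `Y`. -/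
theorem IsCoerciveGenerator.mildSolution_memLp {d : ℕ} (hS : IsC0Semigroup S)
    (hst : ∀ t, 0 ≤ t → ‖S t‖ ≤ M * Real.exp (-α * t)) (hα : 0 < α) (hΛ : 0 ≤ Λ)
    (hc : 0 < c) (hj : Function.Injective j) (hen : IsCoerciveGenerator S j ι c Λ)
    (B : EuclideanSpace ℝ (Fin d) →L[ℝ] X) :
    ∃ D : ℝ, 0 < D ∧ ∀ u : ℝ → EuclideanSpace ℝ (Fin d), MemLp u 2 (volume.restrict (Ioi 0)) →
      ∀ v : ℝ → X, IsMildSolution S B u v → ∃ z : ℝ → Y,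
        (∀ᵐ t ∂volume.restrict (Ioi (0 : ℝ)), j (z t) = ι (v t)) ∧
        MemLp z 2 (volume.restrict (Ioi 0)) ∧
        eLpNorm z 2 (volume.restrict (Ioi 0)) ≤
          ENNReal.ofReal D * eLpNorm u 2 (volume.restrict (Ioi 0)) := by
  have hlift := fun i : Fin d =>
    hen.exists_lift hS hst hα hΛ hc hj (B (EuclideanSpace.single i 1))
  choose k hkm hki hk0 hkS using hlift
  set κ : ℝ → ℝ≥0∞ := fun t => ∑ i, ‖k i t‖ₑ with hκ
  have hκm : Measurable κ := Finset.measurable_fun_sum _ fun i _ => (hkm i).enorm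
  have hκi : ∫⁻ t, κ t ≠ ⊤ := by
    rw [hκ, lintegral_finsetSum _ fun i _ => (hkm i).enorm]
    exact ENNReal.sum_ne_top.2 fun i _ => (hki i).2.ne
  refine ⟨(∫⁻ t, κ t).toReal + 1, by positivity, fun u hu v hv => ?_⟩
  set w : ℝ → EuclideanSpace ℝ (Fin d) := (Ioi (0 : ℝ)).indicator u with hw
  have hwm : AEStronglyMeasurable w volume :=
    (aestronglyMeasurable_indicator_iff measurableSet_Ioi).2 hu.1
  have hwn : eLpNorm w 2 volume = eLpNorm u 2 (volume.restrict (Ioi 0)) :=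
    eLpNorm_indicator_eq_eLpNorm_restrict measurableSet_Ioi
  set Φ : ℝ → ℝ → Y := fun t s => ∑ i, w s i • k i (t - s) with hΦ
  have hΦm : AEStronglyMeasurable (Function.uncurry Φ) (volume.prod volume) := by
    simp only [hΦ, Function.uncurry_def]
    refine Finset.aestronglyMeasurable_fun_sum _ fun i _ => ?_
    refine AEStronglyMeasurable.smul ?_ ?_
    · have h1 : AEStronglyMeasurable (fun s => w s i) volume :=
        (EuclideanSpace.proj i : EuclideanSpace ℝ (Fin d) →L[ℝ] ℝ).continuous.comp_aestronglyMeasurable hwm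
      exact h1.comp_quasiMeasurePreserving Measure.quasiMeasurePreserving_snd
    · exact ((hkm i).comp_measurable (measurable_fst.sub measurable_snd)).aestronglyMeasurable
  have hΦb : ∀ t s, ‖Φ t s‖ₑ ≤ κ (t - s) * ‖w s‖ₑ := by
    intro t s
    simp only [hΦ, hκ]
    refine (enorm_sum_le _ _).trans ?_
    rw [Finset.sum_mul]
    refine Finset.sum_le_sum fun i _ => ?_
    rw [enorm_smul, mul_comm]
    gcongr
    rw [enorm_le_iff_norm_le]
    exact PiLp.norm_apply_le (w s) i
  set z : ℝ → Y := fun t => ∫ s, Φ t s with hz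
  have hzm : AEStronglyMeasurable z volume := hΦm.integral_prod_right'
  have hzb : ∀ t, ‖z t‖ₑ ≤ ∫⁻ s, κ (t - s) * ‖w s‖ₑ := fun t =>
    (enorm_integral_le_lintegral_enorm _).trans (lintegral_mono (hΦb t))
  have hyoung := lintegral_sq_convolution_le (μ := (volume : Measure ℝ)) hκm hwm.enorm
  have hwfin : eLpNorm w 2 volume ≠ ⊤ := by rw [hwn]; exact hu.2.ne
  have hwsq : ∫⁻ s, ‖w s‖ₑ ^ 2 ≠ ⊤ := by
    rw [← eLpNorm_two_sq]; exact ENNReal.pow_ne_top hwfin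
  have hbound : eLpNorm z 2 (volume.restrict (Ioi 0)) ≤
      ENNReal.ofReal ((∫⁻ t, κ t).toReal + 1) * eLpNorm u 2 (volume.restrict (Ioi 0)) := by
    have h1 : eLpNorm z 2 volume ≤ (∫⁻ t, κ t) * eLpNorm w 2 volume := by
      refine enn_sq_le_sq ?_
      rw [mul_pow, eLpNorm_two_sq, eLpNorm_two_sq]
      refine le_trans (lintegral_mono fun t => ?_) hyoung
      gcongr
      exact hzb t
    refine (eLpNorm_restrict_le _ _ _ _).trans (h1.trans ?_)
    rw [hwn]
    gcongr
    rw [ENNReal.ofReal_add ENNReal.toReal_nonneg (by norm_num), ENNReal.ofReal_toReal hκi]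
    exact le_self_add
  refine ⟨z, ?_, ⟨hzm.restrict, hbound.trans_lt (ENNReal.mul_lt_top ENNReal.ofReal_lt_top hu.2)⟩,
    hbound⟩
  have hfin : ∀ᵐ t, (∫⁻ s, κ (t - s) * ‖w s‖ₑ) ^ 2 < ⊤ := by
    refine ae_lt_top' ?_ ?_
    · have hm : AEMeasurable (Function.uncurry fun t s => κ (t - s) * ‖w s‖ₑ)
          (volume.prod volume) :=
        (hκm.comp measurable_sub).aemeasurable.mul
          (hwm.enorm.comp_quasiMeasurePreserving Measure.quasiMeasurePreserving_snd)
      exact hm.lintegral_prod_right'.pow_const 2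
    · exact (hyoung.trans_lt (ENNReal.mul_lt_top (ENNReal.pow_lt_top hκi.lt_top)
        hwsq.lt_top)).ne
  filter_upwards [ae_restrict_of_ae hfin, ae_restrict_of_ae hΦm.prodMk_left,
    ae_restrict_mem measurableSet_Ioi] with t h1 h2 ht
  have hti : Integrable (Φ t) := by
    refine ⟨h2, (lintegral_mono (hΦb t)).trans_lt ?_⟩
    by_contra hcon
    rw [not_lt, top_le_iff] at hcon
    rw [hcon] at h1
    simp at h1
  rw [hv t (le_of_lt ht), hz, ← j.integral_comp_comm hti,
    intervalIntegral.integral_of_le (le_of_lt ht), integral_Ioc_eq_integral_Ioo,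
    ← ι.integral_comp_comm, ← integral_indicator measurableSet_Ioo]
  refine integral_congr_ae ?_
  have hkS' : ∀ᵐ τ, ∀ i, 0 < τ → j (k i τ) = ι (S τ (B (EuclideanSpace.single i 1))) :=
    ae_all_iff.2 fun i => (ae_restrict_iff' measurableSet_Ioi).1 (hkS i)
  have hq : Measure.QuasiMeasurePreserving (fun s : ℝ => t - s) volume volume :=
    quasiMeasurePreserving_sub_left volume t
  filter_upwards [hq.ae hkS'] with s hs
  by_cases hs0 : s ∈ Ioo 0 t
  · rw [indicator_of_mem hs0]
    have hu' : w s = u s := indicator_of_mem (mem_Ioi.2 hs0.1) u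
    have hB : B (u s) = ∑ i, u s i • B (EuclideanSpace.single i 1) := by
      conv_lhs => rw [← (EuclideanSpace.basisFun (Fin d) ℝ).sum_repr (u s)]
      simp
    simp only [hΦ, map_sum, map_smul, hB, hu']
    refine Finset.sum_congr rfl fun i _ => ?_
    rw [hs i (sub_pos.2 hs0.2)]
  · rw [indicator_of_notMem hs0]
    have : Φ t s = 0 := by
      refine Finset.sum_eq_zero fun i _ => ?_
      by_cases h0 : 0 < s
      · rw [hk0 i (t - s) (by
          rw [sub_nonpos]; by_contra hcon; exact hs0 ⟨h0, not_le.1 hcon⟩), smul_zero]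
      · have : w s = 0 := indicator_of_notMem (by simpa using h0) u
        rw [this]; simp
    rw [this, map_zero]

end Semigroup

/-! ### Functionals on `L²` and closedness of `H¹` and `V⁰` -/

section Basic

variable {Ω : Set Plane}

/-- The `i`-th component of a field. -/
noncomputable def comp (Ω : Set Plane) (i : Fin 2) : L2 Ω Plane →L[ℝ] L2 Ω ℝ :=
  (EuclideanSpace.proj i : Plane →L[ℝ] ℝ).compLpL 2 ((volume : Measure Plane).restrict Ω)

lemma coeFn_comp (i : Fin 2) (w : L2 Ω Plane) :
    comp Ω i w =ᵐ[(volume : Measure Plane).restrict Ω] fun x => w x i :=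
  (EuclideanSpace.proj i : Plane →L[ℝ] ℝ).coeFn_compLpL w

lemma inner_L2_eq (f g : L2 Ω ℝ) : inner ℝ f g = ∫ x in Ω, f x * g x := by
  rw [L2.inner_def]
  refine integral_congr_ae (Eventually.of_forall fun x => ?_)
  simp [mul_comm]

lemma normalPairing_eq_inner (w : L2 Ω Plane) (p : Jet Ω ℝ) :
    normalPairing w p = ∑ j, inner ℝ (p.snd j) (comp Ω j w) := by
  unfold normalPairing
  refine Finset.sum_congr rfl fun j _ => ?_
  rw [inner_L2_eq]
  refine integral_congr_ae ?_
  filter_upwards [coeFn_comp j w] with x hx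
  rw [hx]

lemma continuous_normalPairing (p : Jet Ω ℝ) :
    Continuous fun w : L2 Ω Plane => normalPairing w p := by
  simp_rw [normalPairing_eq_inner]
  fun_prop

lemma plane_eq_sum (v : Plane) : v = ∑ j, v j • e j := by
  ext i
  simp only [e, Fin.sum_univ_two]
  fin_cases i <;> simp

lemma memLp_test {F : Type*} [NormedAddCommGroup F] {φ : Plane → F} (hφ : Continuous φ)
    (hc : HasCompactSupport φ) (p : ℝ≥0∞) :
    MemLp φ p ((volume : Measure Plane).restrict Ω) :=
  (hφ.memLp_of_hasCompactSupport hc).restrict Ω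

lemma continuous_integral_test {F : Type*} [NormedAddCommGroup F] [InnerProductSpace ℝ F]
    {φ : Plane → ℝ} (hφ : Continuous φ) (hc : HasCompactSupport φ) :
    Continuous fun f : L2 Ω F => ∫ x in Ω, φ x • f x := by
  let l : L2 Ω F →ₗ[ℝ] F :=
    { toFun := fun f => ∫ x in Ω, φ x • f x
      map_add' := integral_test_add hφ hc
      map_smul' := integral_test_smul φ }
  refine (l.mkContinuous (eLpNorm φ 2 ((volume : Measure Plane).restrict Ω)).toReal
    fun f => ?_).continuous
  change ‖∫ x in Ω, φ x • f x‖ ≤ _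
  have hm := (memLp_test (Ω := Ω) hφ hc 2)
  have h1 : eLpNorm (fun x => φ x • f x) 1 ((volume : Measure Plane).restrict Ω) ≤
      eLpNorm φ 2 ((volume : Measure Plane).restrict Ω) *
        eLpNorm f 2 ((volume : Measure Plane).restrict Ω) :=
    eLpNorm_smul_le_mul_eLpNorm (p := 2) (q := 2) (r := 1) (Lp.aestronglyMeasurable f) hm.1
  rw [Lp.norm_def, ← ENNReal.toReal_mul, ← toReal_enorm]
  refine ENNReal.toReal_mono (ENNReal.mul_ne_top hm.2.ne (Lp.eLpNorm_ne_top f)) ?_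
  refine (enorm_integral_le_lintegral_enorm _).trans ?_
  rwa [← eLpNorm_one_eq_lintegral_enorm]

lemma fderiv_apply_plane (φ : Plane → ℝ) (x v : Plane) :
    fderiv ℝ φ x v = ∑ j, fderiv ℝ φ x (e j) * v j := by
  conv_lhs => rw [plane_eq_sum v]
  simp [mul_comm]

lemma integral_fderiv_apply {φ : Plane → ℝ} (h1 : ContDiff ℝ ∞ φ) (h2 : HasCompactSupport φ)
    (z : L2 Ω Plane) :
    ∫ x in Ω, fderiv ℝ φ x (z x) = ∑ j, ∫ x in Ω, fderiv ℝ φ x (e j) • comp Ω j z x := by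
  rw [← integral_finsetSum _ fun j _ =>
    integrable_test_smul (continuous_fderiv_test h1 (e j)) (h2.fderiv_apply ℝ (e j)) (comp Ω j z)]
  refine integral_congr_ae ?_
  filter_upwards [coeFn_comp 0 z, coeFn_comp 1 z] with x hx0 hx1
  rw [fderiv_apply_plane]
  simp [Fin.sum_univ_two, hx0, hx1]

lemma isClosed_V0 (Ω ΓD : Set Plane) : IsClosed (V0 Ω ΓD : Set (L2 Ω Plane)) := by
  have : (V0 Ω ΓD : Set (L2 Ω Plane)) = {z |
    (∀ φ : Plane → ℝ, ContDiff ℝ ∞ φ → HasCompactSupport φ → tsupport φ ⊆ Ω →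
      ∫ x in Ω, fderiv ℝ φ x (z x) = 0) ∧
    ∀ p ∈ H1 Ω ℝ, ∀ τ, HasTrace Ω p τ → (∀ᵐ x ∂(bdry Ω).restrict ΓDᶜ, τ x = 0) →
      normalPairing z p = 0} := rfl
  rw [this]
  rw [Set.ofPred_and]
  refine IsClosed.inter ?_ ?_
  · simp only [Set.ofPred_forall]
    refine isClosed_iInter fun φ => isClosed_iInter fun h1 => isClosed_iInter fun h2 =>
      isClosed_iInter fun _ => ?_
    simp_rw [integral_fderiv_apply h1 h2]
    refine isClosed_eq ?_ continuous_const
    refine continuous_finsetSum _ fun j _ => ?_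
    exact (continuous_integral_test (continuous_fderiv_test h1 (e j))
      (h2.fderiv_apply ℝ (e j))).comp (comp Ω j).continuous
  · simp only [Set.ofPred_forall]
    refine isClosed_iInter fun p => isClosed_iInter fun _ => isClosed_iInter fun τ =>
      isClosed_iInter fun _ => isClosed_iInter fun _ => ?_
    exact isClosed_eq (continuous_normalPairing p) continuous_const

instance instCompleteSpaceV0 (Ω ΓD : Set Plane) : CompleteSpace (V0 Ω ΓD) :=
  (isClosed_V0 Ω ΓD).completeSpace_coe

lemma isClosed_H1 (Ω : Set Plane) (F : Type*) [NormedAddCommGroup F] [InnerProductSpace ℝ F] :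
    IsClosed (H1 Ω F : Set (Jet Ω F)) := by
  have : (H1 Ω F : Set (Jet Ω F)) = {z | ∀ j, ∀ φ : Plane → ℝ, ContDiff ℝ ∞ φ →
      HasCompactSupport φ → tsupport φ ⊆ Ω →
      ∫ x in Ω, (fderiv ℝ φ x (e j)) • z.fst x = - ∫ x in Ω, φ x • z.snd j x} := rfl
  rw [this]
  simp only [Set.ofPred_forall]
  refine isClosed_iInter fun j => isClosed_iInter fun φ => isClosed_iInter fun h1 =>
    isClosed_iInter fun h2 => isClosed_iInter fun _ => ?_
  refine isClosed_eq ?_ ?_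
  · exact (continuous_integral_test (continuous_fderiv_test h1 (e j))
      (h2.fderiv_apply ℝ (e j))).comp (WithLp.fstL 2 ℝ (L2 Ω F) _).continuous
  · refine ((continuous_integral_test h1.continuous h2).comp ?_).neg
    exact (PiLp.proj 2 (fun _ : Fin 2 => L2 Ω F) j (𝕜 := ℝ)).continuous.comp
      (WithLp.sndL 2 ℝ (L2 Ω F) _).continuous

lemma H1.eq_zero_of_fst_eq_zero {F : Type*} [NormedAddCommGroup F] [InnerProductSpace ℝ F]
    [CompleteSpace F] (hΩ : IsOpen Ω) {z : Jet Ω F} (hz : z ∈ H1 Ω F) (h0 : z.fst = 0) :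
    z = 0 := by
  have hj : ∀ j, z.snd j = 0 := by
    intro j
    rw [Lp.eq_zero_iff_ae_eq_zero]
    have h := hΩ.ae_eq_zero_of_integral_contDiff_smul_eq_zero
      (μ := (volume : Measure Plane).restrict Ω) (f := z.snd j)
      (((Lp.memLp (z.snd j)).locallyIntegrable (by norm_num)).locallyIntegrableOn _) ?_
    · filter_upwards [h, ae_restrict_mem hΩ.measurableSet] with x hx hxΩ using hx hxΩ
    · intro φ h1 h2 h3
      have := hz j φ h1 h2 h3
      rw [h0, integral_test_zero (fun x => fderiv ℝ φ x (e j))] at this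
      exact neg_eq_zero.1 this.symm
  refine (WithLp.equiv 2 _).injective (Prod.ext h0 ?_)
  ext1 j
  exact hj j

lemma memLp_of_continuous {F : Type*} [NormedAddCommGroup F] (hΩ : Bornology.IsBounded Ω)
    {φ : Plane → F} (hφ : Continuous φ) (p : ℝ≥0∞) :
    MemLp φ p ((volume : Measure Plane).restrict Ω) := by
  have hcpt : IsCompact (closure Ω) := hΩ.isCompact_closure
  obtain ⟨C, hC⟩ := hcpt.exists_bound_of_continuousOn hφ.continuousOn
  have : IsFiniteMeasure ((volume : Measure Plane).restrict (closure Ω)) :=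
    ⟨by rw [Measure.restrict_apply_univ]; exact hcpt.measure_lt_top⟩
  have h : MemLp φ p ((volume : Measure Plane).restrict (closure Ω)) :=
    MemLp.of_bound hφ.aestronglyMeasurable C
      ((ae_restrict_iff' isClosed_closure.measurableSet).2 (Eventually.of_forall hC))
  exact h.mono_measure (Measure.restrict_mono subset_closure le_rfl)

lemma isCompact_frontier (hΩ : Bornology.IsBounded Ω) : IsCompact (frontier Ω) :=
  hΩ.isCompact_closure.of_isClosed_subset isClosed_frontier frontier_subset_closure

/-- Smooth cutoff between disjoint closed sets. -/
lemma exists_smooth_cutoff {s t : Set Plane} (hs : IsClosed s) (ht : IsClosed t)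
    (hd : Disjoint s t) : ∃ χ : Plane → ℝ, ContDiff ℝ ∞ χ ∧ (∀ x ∈ s, χ x = 0) ∧
      (∀ x ∈ t, χ x = 1) ∧ ∀ x, χ x ∈ Icc (0 : ℝ) 1 := by
  obtain ⟨f, h0, h1, h2⟩ := exists_contMDiffMap_zero_one_of_isClosed (n := ⊤)
    (modelWithCornersSelf ℝ Plane) hs ht hd
  exact ⟨f, f.contMDiff.contDiff, h0, h1, h2⟩

lemma exists_smooth_cutoff_of_isCompact {K U : Set Plane} (hK : IsCompact K) (hU : IsOpen U)
    (hKU : K ⊆ U) : ∃ χ : Plane → ℝ, ContDiff ℝ ∞ χ ∧ HasCompactSupport χ ∧ tsupport χ ⊆ U ∧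
      (∀ x ∈ K, χ x = 1) ∧ ∀ x, χ x ∈ Icc (0 : ℝ) 1 := by
  obtain ⟨V, hV, hKV, hVU, hVc⟩ := exists_open_between_and_isCompact_closure hK hU hKU
  obtain ⟨χ, h1, h2, h3, h4⟩ := exists_smooth_cutoff hV.isClosed_compl hK.isClosed
    (disjoint_compl_left_iff_subset.2 hKV)
  have hsub : tsupport χ ⊆ closure V := closure_mono fun x hx => by
    by_contra hxV
    exact hx (h2 x hxV)
  exact ⟨χ, h1, hVc.of_isClosed_subset (isClosed_tsupport χ) hsub, hsub.trans hVU, h3, h4⟩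

end Basic

/-! ### Multiplication by smooth functions and the input operator -/

section Mul

variable {Ω : Set Plane}

lemma memLp_mul_of_continuous (hΩ : Bornology.IsBounded Ω) {χ : Plane → ℝ} (hχ : Continuous χ)
    {f : Plane → ℝ} (hf : MemLp f 2 ((volume : Measure Plane).restrict Ω)) :
    MemLp (fun x => χ x * f x) 2 ((volume : Measure Plane).restrict Ω) :=
  hf.mul (memLp_of_continuous hΩ hχ ⊤)

lemma TendstoL2.mul {μ : Measure Plane} {χ : Plane → ℝ} {C : ℝ} (hC : ∀ᵐ x ∂μ, ‖χ x‖ ≤ C)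
    {f : ℕ → Plane → ℝ} {g h : Lp ℝ 2 μ} (hf : TendstoL2 f g) (hh : h =ᵐ[μ] fun x => χ x * g x) :
    TendstoL2 (fun m x => χ x * f m x) h := by
  have hs := ENNReal.Tendsto.const_mul (a := ENNReal.ofReal C) hf (Or.inr (by simp))
  rw [mul_zero] at hs
  refine tendsto_of_tendsto_of_tendsto_of_le_of_le tendsto_const_nhds hs (fun _ => zero_le) ?_
  intro m
  refine eLpNorm_le_mul_eLpNorm_of_ae_le_mul ?_ 2
  filter_upwards [hC, hh] with x hx hx2
  rw [hx2, ← mul_sub, norm_mul]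
  exact mul_le_mul_of_nonneg_right hx (norm_nonneg _)

lemma exists_bound_of_isBounded {F : Type*} [NormedAddCommGroup F] (hΩ : Bornology.IsBounded Ω)
    {χ : Plane → F} (hχ : Continuous χ) : ∃ C : ℝ, ∀ x ∈ closure Ω, ‖χ x‖ ≤ C :=
  hΩ.isCompact_closure.exists_bound_of_continuousOn hχ.continuousOn

/-- The product of an `H¹` function that has a trace with a smooth function. -/
lemma exists_mul_hasTrace (ho : IsOpen Ω) (hΩ : Bornology.IsBounded Ω) {χ : Plane → ℝ}
    (hχ : ContDiff ℝ ∞ χ) {p : Jet Ω ℝ} (hp : p ∈ H1 Ω ℝ) {τ : Lp ℝ 2 (bdry Ω)}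
    (hτ : HasTrace Ω p τ) :
    ∃ q ∈ H1 Ω ℝ, ∃ σ, HasTrace Ω q σ ∧ ∀ᵐ x ∂bdry Ω, σ x = χ x * τ x := by
  have hd : ∀ j, Continuous fun x => fderiv ℝ χ x (e j) := fun j => continuous_fderiv_test hχ (e j)
  have m0 := memLp_mul_of_continuous hΩ hχ.continuous (Lp.memLp p.fst)
  have m1 := fun j => memLp_mul_of_continuous hΩ hχ.continuous (Lp.memLp (p.snd j))
  have m2 := fun j => memLp_mul_of_continuous hΩ (hd j) (Lp.memLp p.fst)
  obtain ⟨C, hC⟩ := exists_bound_of_isBounded hΩ hχ.continuous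
  have hCΩ : ∀ᵐ x ∂(volume : Measure Plane).restrict Ω, ‖χ x‖ ≤ C :=
    (ae_restrict_iff' ho.measurableSet).2 (Eventually.of_forall fun x hx => hC x (subset_closure hx))
  have hCb : ∀ᵐ x ∂bdry Ω, ‖χ x‖ ≤ C :=
    (ae_restrict_iff' isClosed_frontier.measurableSet).2
      (Eventually.of_forall fun x hx => hC x (frontier_subset_closure hx))
  have m3 : MemLp (fun x => χ x * τ x) 2 (bdry Ω) :=
    (Lp.memLp τ).mul (memLp_top_of_bound hχ.continuous.aestronglyMeasurable C hCb)
  let q : Jet Ω ℝ := WithLp.toLp 2 (m0.toLp _, WithLp.toLp 2 fun j => (m1 j).toLp _ + (m2 j).toLp _)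
  have q1 : q.fst =ᵐ[(volume : Measure Plane).restrict Ω] fun x => χ x * p.fst x := m0.coeFn_toLp
  have q2 : ∀ j, q.snd j =ᵐ[(volume : Measure Plane).restrict Ω]
      fun x => χ x * p.snd j x + fderiv ℝ χ x (e j) * p.fst x := fun j => by
    filter_upwards [Lp.coeFn_add ((m1 j).toLp _) ((m2 j).toLp _), (m1 j).coeFn_toLp,
      (m2 j).coeFn_toLp] with x h1 h2 h3
    change ((m1 j).toLp _ + (m2 j).toLp _ : L2 Ω ℝ) x = _
    rw [h1, Pi.add_apply, h2, h3]
  refine ⟨q, fun j φ h1 h2 h3 => ?_, m3.toLp _, ?_, m3.coeFn_toLp⟩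
  · have hw := hp j (fun x => φ x * χ x) (h1.mul hχ) h2.mul_right
      ((tsupport_mul_subset_left).trans h3)
    have hder : ∀ x, fderiv ℝ (fun x => φ x * χ x) x (e j)
        = fderiv ℝ φ x (e j) * χ x + φ x * fderiv ℝ χ x (e j) := fun x => by
      rw [fderiv_fun_mul (h1.differentiable (by simp) x) (hχ.differentiable (by simp) x)]
      simp; ring
    simp only [hder, smul_eq_mul] at hw ⊢
    have i1 : Integrable (fun x => fderiv ℝ φ x (e j) * χ x * p.fst x)
        ((volume : Measure Plane).restrict Ω) :=
      integrable_test_smul ((continuous_fderiv_test h1 (e j)).mul hχ.continuous)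
        (h2.fderiv_apply ℝ (e j)).mul_right p.fst
    have i2 : Integrable (fun x => φ x * fderiv ℝ χ x (e j) * p.fst x)
        ((volume : Measure Plane).restrict Ω) :=
      integrable_test_smul (h1.continuous.mul (hd j)) h2.mul_right p.fst
    have i3 : Integrable (fun x => φ x * χ x * p.snd j x)
        ((volume : Measure Plane).restrict Ω) :=
      integrable_test_smul (h1.continuous.mul hχ.continuous) h2.mul_right (p.snd j)
    have e1 : ∫ x in Ω, fderiv ℝ φ x (e j) * q.fst x
        = ∫ x in Ω, fderiv ℝ φ x (e j) * χ x * p.fst x := by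
      refine integral_congr_ae ?_
      filter_upwards [q1] with x hx
      rw [hx]; ring
    have e2 : ∫ x in Ω, φ x * q.snd j x = (∫ x in Ω, φ x * χ x * p.snd j x)
        + ∫ x in Ω, φ x * fderiv ℝ χ x (e j) * p.fst x := by
      rw [← integral_add i3 i2]
      refine integral_congr_ae ?_
      filter_upwards [q2 j] with x hx
      rw [hx]; ring
    simp only [add_mul] at hw
    rw [integral_add i1 i2] at hw
    rw [e1, e2]
    linarith
  · obtain ⟨φ, a1, a2, a3, a4⟩ := hτ
    refine ⟨fun m x => χ x * φ m x, fun m => hχ.mul (a1 m), a2.mul hCΩ q1, fun j => ?_,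
      a4.mul hCb m3.coeFn_toLp⟩
    obtain ⟨C', hC'⟩ := exists_bound_of_isBounded hΩ (hd j)
    have hC'Ω : ∀ᵐ x ∂(volume : Measure Plane).restrict Ω, ‖fderiv ℝ χ x (e j)‖ ≤ C' :=
      (ae_restrict_iff' ho.measurableSet).2
        (Eventually.of_forall fun x hx => hC' x (subset_closure hx))
    have b1 := (a3 j).mul hCΩ (m1 j).coeFn_toLp
    have b2 := a2.mul hC'Ω (m2 j).coeFn_toLp
    have heq : (fun (m : ℕ) (x : Plane) => fderiv ℝ (fun x => χ x * φ m x) x (e j))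
        = fun m x => χ x * fderiv ℝ (φ m) x (e j) + fderiv ℝ χ x (e j) * φ m x := by
      funext m x
      rw [fderiv_fun_mul (hχ.differentiable (by simp) x) ((a1 m).differentiable (by simp) x)]
      simp; ring
    rw [heq]
    exact b1.add (fun m => hχ.continuous.aestronglyMeasurable.mul (smooth_fderiv_meas (a1 m) _))
      (fun m => (hd j).aestronglyMeasurable.mul (a1 m).continuous.aestronglyMeasurable) b2

end Mul

section Input

variable {Ω Γin Γw Γout : Set Plane} {Γc : Fin 2 → Set Plane}

/-- The boundary data `g` on `Γc i`, extended by zero to the remaining open boundaries, have an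
`H¹` lift. -/
lemma exists_input_lift (hΩ : IsLipschitzDomain Ω)
    (hΓ : IsBoundaryDecomposition Ω Γin Γw Γout Γc) {g : Plane → ℝ} (i : Fin 2)
    (hg : MemHHalf Ω (Γc i) g) :
    ∃ p ∈ H1 Ω ℝ, ∃ τ, HasTrace Ω p τ ∧ (∀ᵐ x ∂(bdry Ω).restrict (Γc i), τ x = g x) ∧
      ∀ᵐ x ∂(bdry Ω).restrict (Γw ∪ Γin ∪ Γc i)ᶜ, τ x = 0 := by
  obtain ⟨p, hp, τ, hτ, hτg⟩ := hg
  have hex : ∃ i' : Fin 2, Disjoint (closure (Γc i)) (closure (Γc i')) ∧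
      frontier Ω = Γin ∪ Γw ∪ Γout ∪ Γc i ∪ Γc i' := by
    fin_cases i
    · exact ⟨1, hΓ.sep_c, hΓ.cover⟩
    · refine ⟨0, hΓ.sep_c.symm, ?_⟩
      rw [hΓ.cover, union_assoc, union_assoc _ (Γc _) (Γc 0), union_comm (Γc 0)]
      rfl
  obtain ⟨i', hdis, hcov⟩ := hex
  obtain ⟨χ, h1, h2, h3, -⟩ := exists_smooth_cutoff (s := closure Γout ∪ closure (Γc i'))
    (t := closure (Γc i)) (isClosed_closure.union isClosed_closure) isClosed_closure
    (disjoint_union_left.2 ⟨(hΓ.sep_out i).symm, hdis.symm⟩)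
  obtain ⟨q, hq, σ, hσ, hσχ⟩ := exists_mul_hasTrace hΩ.isOpen hΩ.isBounded h1 hp hτ
  refine ⟨q, hq, σ, hσ, ?_, ?_⟩
  · filter_upwards [hτg, ae_restrict_of_ae hσχ, ae_restrict_mem (hΓ.meas_c i)] with x hx hx2 hx3
    rw [hx2, hx, h3 x (subset_closure hx3), one_mul]
  · have hmeas : MeasurableSet (Γw ∪ Γin ∪ Γc i)ᶜ :=
      ((hΓ.meas_w.union hΓ.meas_in).union (hΓ.meas_c i)).compl
    filter_upwards [ae_restrict_of_ae hσχ, ae_restrict_mem hmeas,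
      ae_restrict_of_ae (ae_restrict_mem isClosed_frontier.measurableSet)] with x hx hx2 hx3
    rw [hcov] at hx3
    have : x ∈ closure Γout ∪ closure (Γc i') := by
      simp only [mem_compl_iff, mem_union, not_or] at hx2 hx3 ⊢
      rcases hx3 with (((h | h) | h) | h) | h
      · exact absurd h hx2.1.2
      · exact absurd h hx2.1.1
      · exact Or.inl (subset_closure h)
      · exact absurd h hx2.2
      · exact Or.inr (subset_closure h)
    rw [hx, h2 x this, zero_mul]

lemma normalPairing_congr {ΓD Γ : Set Plane} {g : Plane → ℝ} (hD : MeasurableSet ΓD)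
    (hΓ : MeasurableSet Γ) {p q : Jet Ω ℝ} (hp : p ∈ H1 Ω ℝ) (hq : q ∈ H1 Ω ℝ)
    {σ τ : Lp ℝ 2 (bdry Ω)} (hσ : HasTrace Ω p σ) (hτ : HasTrace Ω q τ)
    (hσg : ∀ᵐ x ∂(bdry Ω).restrict Γ, σ x = g x) (hτg : ∀ᵐ x ∂(bdry Ω).restrict Γ, τ x = g x)
    (hσ0 : ∀ᵐ x ∂(bdry Ω).restrict (ΓD ∪ Γ)ᶜ, σ x = 0)
    (hτ0 : ∀ᵐ x ∂(bdry Ω).restrict (ΓD ∪ Γ)ᶜ, τ x = 0) (w : V0 Ω ΓD) :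
    normalPairing (w : L2 Ω Plane) p = normalPairing (w : L2 Ω Plane) q := by
  have h := w.2.2 (p + (-1 : ℝ) • q) (Submodule.add_mem _ hp (Submodule.smul_mem _ _ hq))
    (σ + (-1 : ℝ) • τ) (hσ.add (hτ.smul _)) ?_
  · rw [normalPairing_eq_inner] at h ⊢
    rw [normalPairing_eq_inner]
    simp only [WithLp.add_snd, PiLp.add_apply, WithLp.smul_snd, PiLp.smul_apply, inner_add_left,
      inner_smul_left, Finset.sum_add_distrib, ← Finset.mul_sum] at h
    simp only [map_neg, map_one] at h
    linarith
  · rw [ae_restrict_iff' hD.compl]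
    rw [ae_restrict_iff' hΓ] at hσg hτg
    rw [ae_restrict_iff' (hD.union hΓ).compl] at hσ0 hτ0
    filter_upwards [hσg, hτg, hσ0, hτ0, Lp.coeFn_add σ ((-1 : ℝ) • τ),
      Lp.coeFn_smul (-1 : ℝ) τ] with x a1 a2 a3 a4 a5 a6 hx
    rw [a5, Pi.add_apply, a6, Pi.smul_apply]
    by_cases hxΓ : x ∈ Γ
    · rw [a1 hxΓ, a2 hxΓ]; simp
    · have : x ∈ (ΓD ∪ Γ)ᶜ := by
        rintro (h | h)
        · exact hx h
        · exact hxΓ h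
      rw [a3 this, a4 this]; simp

lemma exists_clm_inner_eq {X : Type*} [NormedAddCommGroup X] [InnerProductSpace ℝ X]
    [CompleteSpace X] {d : ℕ} (l : Fin d → X →L[ℝ] ℝ) (c : ℝ) :
    ∃ B : EuclideanSpace ℝ (Fin d) →L[ℝ] X, ∀ u w, inner ℝ (B u) w = c * ∑ i, l i w * u i := by
  let b : Fin d → X := fun i => (InnerProductSpace.toDual ℝ X).symm (l i)
  refine ⟨c • ∑ i, (EuclideanSpace.proj i : EuclideanSpace ℝ (Fin d) →L[ℝ] ℝ).smulRight (b i),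
    fun u w => ?_⟩
  simp [b, inner_smul_left, sum_inner, mul_comm]

theorem existsUnique_inputOperator (hΩ : IsLipschitzDomain Ω)
    (hΓ : IsBoundaryDecomposition Ω Γin Γw Γout Γc) (γ : ℝ) (g : Fin 2 → Plane → ℝ)
    (hg : ∀ i, MemHHalf Ω (Γc i) (g i)) :
    ∃! B : EuclideanSpace ℝ (Fin 2) →L[ℝ] V0 Ω (Γw ∪ Γin),
      IsInputOperator Ω (Γw ∪ Γin) Γc γ g B := by
  have hex := fun i => exists_input_lift hΩ hΓ i (hg i)
  choose p hp τ hτ hτg hτ0 using hex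
  let l : Fin 2 → (V0 Ω (Γw ∪ Γin) →L[ℝ] ℝ) := fun i =>
    { toFun := fun w => normalPairing (w : L2 Ω Plane) (p i)
      map_add' := fun v w => normalPairing_add _ _ _
      map_smul' := fun c w => normalPairing_smul _ _ _
      cont := (continuous_normalPairing (p i)).comp continuous_subtype_val }
  obtain ⟨B, hB⟩ := exists_clm_inner_eq l (-(1 / γ))
  refine ⟨B, fun q hq u w => ?_, fun B' hB' => ?_⟩
  · refine (hB u w).trans ?_
    congr 1
    refine Finset.sum_congr rfl fun i _ => ?_
    obtain ⟨hq1, σ, hσ, hσg, hσ0⟩ := hq i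
    change normalPairing (w : L2 Ω Plane) (p i) * u i = _
    rw [normalPairing_congr (hΓ.meas_w.union hΓ.meas_in) (hΓ.meas_c i) (hp i) hq1 (hτ i) hσ
      (hτg i) hσg (hτ0 i) hσ0 w]
  · ext1 u
    refine ext_inner_right ℝ fun w => ?_
    rw [hB' p (fun i => ⟨hp i, τ i, hτ i, hτg i, hτ0 i⟩) u w]
    exact (hB u w).symm

end Input

/-! ### Mollification -/

section Mollify

/-- Radius of the `n`-th mollifier. -/
noncomputable def mollRad (n : ℕ) : ℝ := 1 / ((n : ℝ) + 1)

lemma mollRad_pos (n : ℕ) : 0 < mollRad n := by unfold mollRad; positivity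

lemma tendsto_mollRad : Tendsto mollRad atTop (𝓝 0) := tendsto_one_div_add_atTop_nhds_zero_nat

/-- Bump function defining the `n`-th mollifier. -/
noncomputable def mollBump (n : ℕ) : ContDiffBump (0 : Plane) where
  rIn := mollRad n / 2
  rOut := mollRad n
  rIn_pos := half_pos (mollRad_pos n)
  rIn_lt_rOut := half_lt_self (mollRad_pos n)

/-- The `n`-th mollifier. -/
noncomputable def mollKer (n : ℕ) : Plane → ℝ := (mollBump n).normed volume

/-- Mollification of a scalar function. -/
noncomputable def moll (n : ℕ) (f : Plane → ℝ) : Plane → ℝ :=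
  f ⋆[ContinuousLinearMap.lsmul ℝ ℝ, volume] mollKer n

lemma contDiff_mollKer (n : ℕ) : ContDiff ℝ ∞ (mollKer n) := (mollBump n).contDiff_normed

lemma hasCompactSupport_mollKer (n : ℕ) : HasCompactSupport (mollKer n) :=
  (mollBump n).hasCompactSupport_normed

lemma mollKer_nonneg (n : ℕ) (x : Plane) : 0 ≤ mollKer n x := (mollBump n).nonneg_normed x

lemma moll_apply (n : ℕ) (f : Plane → ℝ) (x : Plane) :
    moll n f x = ∫ y, f y * mollKer n (x - y) := rfl

lemma lintegral_mollKer (n : ℕ) : ∫⁻ x, ENNReal.ofReal (mollKer n x) = 1 := by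
  rw [← ofReal_integral_eq_lintegral_ofReal
    ((contDiff_mollKer n).continuous.integrable_of_hasCompactSupport (hasCompactSupport_mollKer n))
    (Eventually.of_forall (mollKer_nonneg n))]
  simp [mollKer, (mollBump n).integral_normed]

variable {f : Plane → ℝ}

lemma contDiff_moll (n : ℕ) (hf : LocallyIntegrable f) : ContDiff ℝ ∞ (moll n f) :=
  (hasCompactSupport_mollKer n).contDiff_convolution_right _ hf (contDiff_mollKer n)

lemma lintegral_sq_moll_le (n : ℕ) (hf : AEStronglyMeasurable f) :
    ∫⁻ x, ‖moll n f x‖ₑ ^ 2 ≤ ∫⁻ x, ‖f x‖ₑ ^ 2 := by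
  have h := lintegral_sq_convolution_le (μ := (volume : Measure Plane))
    (κ := fun x => ENNReal.ofReal (mollKer n x))
    (contDiff_mollKer n).continuous.measurable.ennreal_ofReal hf.enorm
  rw [lintegral_mollKer, one_pow, one_mul] at h
  refine le_trans (lintegral_mono fun x => ?_) h
  gcongr
  rw [moll_apply]
  refine (enorm_integral_le_lintegral_enorm _).trans (le_of_eq ?_)
  refine lintegral_congr fun y => ?_
  rw [enorm_mul, mul_comm, Real.enorm_of_nonneg (mollKer_nonneg n _)]

lemma ae_tendsto_moll (hf : LocallyIntegrable f) :
    ∀ᵐ x, Tendsto (fun n => moll n f x) atTop (𝓝 (f x)) := by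
  have h := ContDiffBump.ae_convolution_tendsto_right_of_locallyIntegrable (φ := mollBump)
    (l := atTop) (K := 2) (g := f) (μ := (volume : Measure Plane)) tendsto_mollRad
    (Eventually.of_forall fun n => by simp only [mollBump]; linarith [mollRad_pos n]) hf
  filter_upwards [h] with x hx
  refine hx.congr fun n => ?_
  rw [convolution_eq_swap, moll_apply]
  refine integral_congr_ae (Eventually.of_forall fun y => ?_)
  simp [mollKer, mul_comm]

/-- Pointwise convergence together with convergence of the norms gives convergence in `L²`. -/
lemma tendsto_lintegral_sq_sub {α : Type*} [MeasurableSpace α] {μ : Measure α} {f : α → ℝ}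
    {g : ℕ → α → ℝ} (hf : AEMeasurable f μ) (hg : ∀ n, AEMeasurable (g n) μ)
    (hfin : ∫⁻ x, ‖f x‖ₑ ^ 2 ∂μ ≠ ⊤) (hle : ∀ n, ∫⁻ x, ‖g n x‖ₑ ^ 2 ∂μ ≤ ∫⁻ x, ‖f x‖ₑ ^ 2 ∂μ)
    (hlim : ∀ᵐ x ∂μ, Tendsto (fun n => g n x) atTop (𝓝 (f x))) :
    Tendsto (fun n => ∫⁻ x, ‖g n x - f x‖ₑ ^ 2 ∂μ) atTop (𝓝 0) := by
  set I := ∫⁻ x, ‖f x‖ₑ ^ 2 ∂μ with hI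
  have sqe : ∀ a : ℝ, ‖a‖ₑ ^ 2 = ENNReal.ofReal (a ^ 2) := fun a => by
    rw [← ofReal_norm, ← ENNReal.ofReal_pow (norm_nonneg _), Real.norm_eq_abs, sq_abs]
  have hpar : ∀ n, ∫⁻ x, ‖g n x - f x‖ₑ ^ 2 ∂μ + ∫⁻ x, ‖g n x + f x‖ₑ ^ 2 ∂μ ≤ 4 * I := by
    intro n
    have hm : AEMeasurable (fun x => ‖g n x - f x‖ₑ ^ 2) μ := ((hg n).sub hf).enorm.pow_const 2
    rw [← lintegral_add_left' hm]
    calc _ = ∫⁻ x, (2 * ‖g n x‖ₑ ^ 2 + 2 * ‖f x‖ₑ ^ 2) ∂μ := by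
          refine lintegral_congr fun x => ?_
          simp only [sqe]
          rw [← ENNReal.ofReal_add (by positivity) (by positivity),
            show (2 : ℝ≥0∞) = ENNReal.ofReal 2 by simp, ← ENNReal.ofReal_mul (by norm_num),
            ← ENNReal.ofReal_mul (by norm_num), ← ENNReal.ofReal_add (by positivity) (by positivity)]
          congr 1; ring
      _ = 2 * ∫⁻ x, ‖g n x‖ₑ ^ 2 ∂μ + 2 * I := by
          rw [lintegral_add_left' (((hg n).enorm.pow_const 2).const_mul 2),
            lintegral_const_mul' _ _ (by simp), lintegral_const_mul' _ _ (by simp)]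
      _ ≤ 2 * I + 2 * I := by gcongr; exact hle n
      _ = 4 * I := by rw [← add_mul]; norm_num
  have hfatou : 4 * I ≤ liminf (fun n => ∫⁻ x, ‖g n x + f x‖ₑ ^ 2 ∂μ) atTop := by
    refine le_trans (le_of_eq ?_) (lintegral_liminf_le' fun n =>
      ((hg n).add hf).enorm.pow_const 2)
    rw [hI, ← lintegral_const_mul' _ _ (by simp)]
    refine lintegral_congr_ae ?_
    filter_upwards [hlim] with x hx
    have h1 : Tendsto (fun n => ‖g n x + f x‖ₑ ^ 2) atTop (𝓝 (‖f x + f x‖ₑ ^ 2)) :=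
      ((ENNReal.continuous_pow 2).tendsto _).comp
        ((continuous_enorm.tendsto _).comp (hx.add_const _))
    rw [h1.liminf_eq, ← two_mul, enorm_mul, mul_pow]
    congr 1
    rw [Real.enorm_of_nonneg (by norm_num)]
    norm_num
  rw [ENNReal.tendsto_nhds_zero]
  intro ε hε
  have h4 : 4 * I ≠ ⊤ := ENNReal.mul_ne_top (by simp) hfin
  rcases le_or_gt (4 * I) ε with hcase | hcase
  · exact Eventually.of_forall fun n => (le_self_add.trans (hpar n)).trans hcase
  · have hlt : 4 * I - ε < 4 * I := ENNReal.sub_lt_self h4 (hε.trans hcase).ne' hε.ne'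
    filter_upwards [eventually_lt_of_lt_liminf (hlt.trans_le hfatou)] with n hn
    have hB : ∫⁻ x, ‖g n x + f x‖ₑ ^ 2 ∂μ ≠ ⊤ := ne_top_of_le_ne_top h4 (le_add_self.trans (hpar n))
    have h5 : 4 * I ≤ ε + ∫⁻ x, ‖g n x + f x‖ₑ ^ 2 ∂μ := by
      rw [add_comm]; exact tsub_le_iff_right.1 hn.le
    exact (ENNReal.add_le_add_iff_right hB).1 ((hpar n).trans h5)

lemma tendsto_moll_L2 (hf : MemLp f 2) :
    Tendsto (fun n => eLpNorm (moll n f - f) 2 volume) atTop (𝓝 0) := by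
  have hl := hf.locallyIntegrable (by norm_num)
  have h := tendsto_lintegral_sq_sub (g := fun n => moll n f) hf.1.aemeasurable
    (fun n => (contDiff_moll n hl).continuous.aemeasurable)
    (by rw [← eLpNorm_two_sq]; exact ENNReal.pow_ne_top hf.2.ne)
    (fun n => lintegral_sq_moll_le n hf.1) (ae_tendsto_moll hl)
  have h2 := (ENNReal.continuous_rpow_const (y := 1 / 2)).tendsto 0 |>.comp h
  rw [ENNReal.zero_rpow_of_pos (by norm_num)] at h2
  refine h2.congr fun n => ?_
  simp only [Function.comp_apply]
  rw [eLpNorm_eq_lintegral_rpow_enorm_toReal (by norm_num) (by norm_num)]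
  simp

/-- The test function `y ↦ ρₙ (x - y)`. -/
noncomputable def mollTest (n : ℕ) (x : Plane) : Plane → ℝ := fun y => mollKer n (x - y)

lemma contDiff_mollTest (n : ℕ) (x : Plane) : ContDiff ℝ ∞ (mollTest n x) :=
  (contDiff_mollKer n).comp (contDiff_const.sub contDiff_id)

lemma tsupport_mollTest (n : ℕ) (x : Plane) :
    tsupport (mollTest n x) ⊆ Metric.closedBall x (mollRad n) := by
  refine closure_minimal (fun y hy => ?_) Metric.isClosed_closedBall
  have : x - y ∈ Function.support ((mollBump n).normed volume) := hy
  rw [ContDiffBump.support_normed_eq] at this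
  rw [Metric.mem_closedBall, dist_comm, dist_eq_norm]
  simpa [mollBump] using (mem_ball_zero_iff.1 this).le

lemma hasCompactSupport_mollTest (n : ℕ) (x : Plane) : HasCompactSupport (mollTest n x) :=
  (isCompact_closedBall x (mollRad n)).of_isClosed_subset (isClosed_tsupport _)
    (tsupport_mollTest n x)

lemma fderiv_mollTest (n : ℕ) (x y v : Plane) :
    fderiv ℝ (mollTest n x) y v = -fderiv ℝ (mollKer n) (x - y) v := by
  have h1 : HasFDerivAt (mollKer n) (fderiv ℝ (mollKer n) (x - y)) (x - y) :=
    ((contDiff_mollKer n).differentiable (by simp) _).hasFDerivAt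
  have h2 : HasFDerivAt (fun y => x - y) (-ContinuousLinearMap.id ℝ Plane) y :=
    (hasFDerivAt_id y).const_sub x
  have h3 := h1.comp y h2
  rw [show mollTest n x = mollKer n ∘ fun y => x - y from rfl, h3.fderiv]
  simp

variable {Ω : Set Plane}

lemma moll_indicator (hΩ : MeasurableSet Ω) (n : ℕ) (f : Plane → ℝ) (x : Plane) :
    moll n (Ω.indicator f) x = ∫ y in Ω, mollTest n x y * f y := by
  rw [moll_apply, ← integral_indicator hΩ]
  refine integral_congr_ae (Eventually.of_forall fun y => ?_)
  by_cases hy : y ∈ Ω <;> simp [hy, mollTest, mul_comm]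

lemma fderiv_moll_indicator (hΩ : MeasurableSet Ω) (n : ℕ)
    (hf : LocallyIntegrable (Ω.indicator f)) (x v : Plane) :
    fderiv ℝ (moll n (Ω.indicator f)) x v = -∫ y in Ω, fderiv ℝ (mollTest n x) y v * f y := by
  have h := (hasCompactSupport_mollKer n).hasFDerivAt_convolution_right
    (ContinuousLinearMap.lsmul ℝ ℝ) hf ((contDiff_mollKer n).of_le (by simp)) x
  rw [show moll n (Ω.indicator f) = Ω.indicator f ⋆[ContinuousLinearMap.lsmul ℝ ℝ, volume]
    mollKer n from rfl, h.fderiv, convolution_precompR_apply _ hf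
    ((hasCompactSupport_mollKer n).fderiv ℝ) ((contDiff_mollKer n).continuous_fderiv (by simp)),
    convolution_def, ← integral_neg, ← integral_indicator hΩ]
  refine integral_congr_ae (Eventually.of_forall fun y => ?_)
  by_cases hy : y ∈ Ω <;> simp [hy, fderiv_mollTest, mul_comm]

lemma memLp_indicator (hΩ : MeasurableSet Ω) (hf : MemLp f 2 ((volume : Measure Plane).restrict Ω)) :
    MemLp (Ω.indicator f) 2 := (memLp_indicator_iff_restrict hΩ).2 hf

/-- Mollification commutes with weak derivatives inside `Ω`. -/
lemma fderiv_moll_of_hasWeakPartial (hΩ : MeasurableSet Ω) {g : Plane → ℝ} {j : Fin 2}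
    (hf : MemLp f 2 ((volume : Measure Plane).restrict Ω)) (hfg : HasWeakPartial Ω j f g) {n : ℕ}
    {x : Plane} (hx : Metric.closedBall x (mollRad n) ⊆ Ω) :
    fderiv ℝ (moll n (Ω.indicator f)) x (e j) = moll n (Ω.indicator g) x := by
  have h := hfg (mollTest n x) (contDiff_mollTest n x) (hasCompactSupport_mollTest n x)
    ((tsupport_mollTest n x).trans hx)
  simp only [smul_eq_mul] at h
  rw [fderiv_moll_indicator hΩ n ((memLp_indicator hΩ hf).locallyIntegrable (by norm_num)),
    moll_indicator hΩ, h, neg_neg]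

end Mollify

/-! ### Divergence and curl free fields -/

section Rellich

variable {Ω : Set Plane}

lemma tendsto_integral_mul {α : Type*} [MeasurableSpace α] {μ : Measure α} {f g : α → ℝ}
    {F G : ℕ → α → ℝ} (hf : MemLp f 2 μ) (hg : MemLp g 2 μ) (hF : ∀ n, MemLp (F n) 2 μ)
    (hG : ∀ n, MemLp (G n) 2 μ) (hFf : Tendsto (fun n => eLpNorm (F n - f) 2 μ) atTop (𝓝 0))
    (hGg : Tendsto (fun n => eLpNorm (G n - g) 2 μ) atTop (𝓝 0)) :
    Tendsto (fun n => ∫ x, F n x * G n x ∂μ) atTop (𝓝 (∫ x, f x * g x ∂μ)) := by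
  have key : ∀ {a b : α → ℝ} (ha : MemLp a 2 μ) (hb : MemLp b 2 μ),
      inner ℝ (ha.toLp a) (hb.toLp b) = ∫ x, a x * b x ∂μ := by
    intro a b ha hb
    rw [L2.inner_def]
    refine integral_congr_ae ?_
    filter_upwards [ha.coeFn_toLp, hb.coeFn_toLp] with x h1 h2
    rw [h1, h2]
    simp [mul_comm]
  have l1 : Tendsto (fun n => (hF n).toLp (F n)) atTop (𝓝 (hf.toLp f)) :=
    (Lp.tendsto_Lp_iff_tendsto_eLpNorm'' F hF f hf).2 hFf
  have l2 : Tendsto (fun n => (hG n).toLp (G n)) atTop (𝓝 (hg.toLp g)) :=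
    (Lp.tendsto_Lp_iff_tendsto_eLpNorm'' G hG g hg).2 hGg
  have := l1.inner l2 (𝕜 := ℝ)
  simpa only [key] using this

lemma tendsto_integral_bdd_mul_mul {α : Type*} [MeasurableSpace α] {μ : Measure α} {f g a : α → ℝ}
    {F G : ℕ → α → ℝ} {C : ℝ} (ha : AEStronglyMeasurable a μ) (hC : ∀ x, ‖a x‖ ≤ C)
    (hf : MemLp f 2 μ) (hg : MemLp g 2 μ) (hF : ∀ n, MemLp (F n) 2 μ)
    (hG : ∀ n, MemLp (G n) 2 μ) (hFf : Tendsto (fun n => eLpNorm (F n - f) 2 μ) atTop (𝓝 0))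
    (hGg : Tendsto (fun n => eLpNorm (G n - g) 2 μ) atTop (𝓝 0)) :
    Tendsto (fun n => ∫ x, a x * (F n x * G n x) ∂μ) atTop (𝓝 (∫ x, a x * (f x * g x) ∂μ)) := by
  have hat : MemLp a ⊤ μ := memLp_top_of_bound ha C (Eventually.of_forall hC)
  have h := tendsto_integral_mul (hf.mul hat) hg (fun n => (hF n).mul hat) hG (F := fun n => a * F n)
    (f := a * f) ?_ hGg
  · simpa only [Pi.mul_apply, mul_assoc] using h
  · have hs := ENNReal.Tendsto.const_mul (a := ENNReal.ofReal C) hFf (Or.inr (by simp))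
    rw [mul_zero] at hs
    refine tendsto_of_tendsto_of_tendsto_of_le_of_le tendsto_const_nhds hs (fun _ => zero_le) ?_
    intro n
    refine eLpNorm_le_mul_eLpNorm_of_ae_le_mul (Eventually.of_forall fun x => ?_) 2
    simp only [Pi.sub_apply, Pi.mul_apply]
    rw [← mul_sub, norm_mul]
    exact mul_le_mul_of_nonneg_right (hC x) (norm_nonneg _)

/-- The field `(u, q)` is square integrable and, in the sense of distributions, divergence free and
curl free. -/
structure IsDivCurlFree (Ω : Set Plane) (u q : Plane → ℝ) : Prop where
  memLp_fst : MemLp u 2 ((volume : Measure Plane).restrict Ω)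
  memLp_snd : MemLp q 2 ((volume : Measure Plane).restrict Ω)
  div : ∀ φ : Plane → ℝ, ContDiff ℝ ∞ φ → HasCompactSupport φ → tsupport φ ⊆ Ω →
    (∫ x in Ω, fderiv ℝ φ x (e 0) * u x) + ∫ x in Ω, fderiv ℝ φ x (e 1) * q x = 0
  curl : ∀ φ : Plane → ℝ, ContDiff ℝ ∞ φ → HasCompactSupport φ → tsupport φ ⊆ Ω →
    (∫ x in Ω, fderiv ℝ φ x (e 0) * q x) - ∫ x in Ω, fderiv ℝ φ x (e 1) * u x = 0

lemma IsDivCurlFree.rotate {u q : Plane → ℝ} (h : IsDivCurlFree Ω u q) :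
    IsDivCurlFree Ω q (fun x => -u x) where
  memLp_fst := h.memLp_snd
  memLp_snd := h.memLp_fst.neg
  div φ h1 h2 h3 := by
    simp only [mul_neg, integral_neg]
    exact h.curl φ h1 h2 h3
  curl φ h1 h2 h3 := by
    simp only [mul_neg, integral_neg]
    linarith [h.div φ h1 h2 h3]

/-- Integration by parts of a Lipschitz function against a smooth function. -/
lemma integral_lineDeriv_mul_smooth {θ A : Plane → ℝ} {C : NNReal} (hθ : LipschitzWith C θ)
    (hθc : HasCompactSupport θ) (hA : ContDiff ℝ ∞ A) (hAc : HasCompactSupport A) (v : Plane) :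
    ∫ x, lineDeriv ℝ θ x v * A x = -∫ x, fderiv ℝ A x v * θ x := by
  obtain ⟨D, hD⟩ := ContDiff.lipschitzWith_of_hasCompactSupport hAc hA (by simp)
  have h := hD.integral_lineDeriv_mul_eq (μ := (volume : Measure Plane)) hθ hθc (-v)
  rw [neg_neg] at h
  rw [← h, ← integral_neg]
  refine integral_congr_ae (Eventually.of_forall fun x => ?_)
  simp only
  rw [(hA.differentiable (by simp) x).lineDeriv_eq_fderiv, map_neg]
  ring

lemma hasCompactSupport_moll (hΩ : Bornology.IsBounded Ω) (n : ℕ) (f : Plane → ℝ) :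
    HasCompactSupport (moll n (Ω.indicator f)) := by
  have h : HasCompactSupport (Ω.indicator f) :=
    HasCompactSupport.intro hΩ.isCompact_closure fun x hx =>
      indicator_of_notMem (fun h => hx (subset_closure h)) f
  exact HasCompactSupport.convolution _ h (hasCompactSupport_mollKer n)

variable {u q : Plane → ℝ}

/-- The vector `d` rotated by a right angle. -/
noncomputable def rot (d : Plane) : Plane := (-d 1) • e 0 + d 0 • e 1

/-- Rellich identity: `div ((u² - q²) d + 2uq d^⊥) = 0` for every constant vector `d`, tested
against Lipschitz functions. -/
lemma IsDivCurlFree.rellich (ho : IsOpen Ω) (hb : Bornology.IsBounded Ω)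
    (h : IsDivCurlFree Ω u q) {θ : Plane → ℝ} {C : NNReal} (hθ : LipschitzWith C θ)
    (hθc : HasCompactSupport θ) (hθΩ : tsupport θ ⊆ Ω) (d : Plane) :
    (∫ x in Ω, lineDeriv ℝ θ x d * (u x * u x)) - (∫ x in Ω, lineDeriv ℝ θ x d * (q x * q x))
      + 2 * (∫ x in Ω, lineDeriv ℝ θ x (rot d) * (u x * q x)) = 0 := by
  have hm := ho.measurableSet
  have mu := memLp_indicator hm h.memLp_fst
  have mq := memLp_indicator hm h.memLp_snd
  have lu := mu.locallyIntegrable (μ := (volume : Measure Plane)) (by norm_num)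
  have lq := mq.locallyIntegrable (μ := (volume : Measure Plane)) (by norm_num)
  set U : ℕ → Plane → ℝ := fun n => moll n (Ω.indicator u) with hU
  set Q : ℕ → Plane → ℝ := fun n => moll n (Ω.indicator q) with hQ
  have sU : ∀ n, ContDiff ℝ ∞ (U n) := fun n => contDiff_moll n lu
  have sQ : ∀ n, ContDiff ℝ ∞ (Q n) := fun n => contDiff_moll n lq
  have cU : ∀ n, HasCompactSupport (U n) := fun n => hasCompactSupport_moll hb n u
  have cQ : ∀ n, HasCompactSupport (Q n) := fun n => hasCompactSupport_moll hb n q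
  have memU : ∀ n, MemLp (U n) 2 := fun n => (sU n).continuous.memLp_of_hasCompactSupport (cU n)
  have memQ : ∀ n, MemLp (Q n) 2 := fun n => (sQ n).continuous.memLp_of_hasCompactSupport (cQ n)
  have mD : ∀ v, AEStronglyMeasurable (fun x => lineDeriv ℝ θ x v) :=
    fun v => (measurable_lineDeriv hθ.continuous).aestronglyMeasurable
  have bD : ∀ v x, ‖lineDeriv ℝ θ x v‖ ≤ C * ‖v‖ :=
    fun v x => norm_lineDeriv_le_of_lipschitz ℝ hθ
  have l1 := tendsto_integral_bdd_mul_mul (mD d) (bD d) mu mu memU memU (tendsto_moll_L2 mu)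
    (tendsto_moll_L2 mu)
  have l2 := tendsto_integral_bdd_mul_mul (mD d) (bD d) mq mq memQ memQ (tendsto_moll_L2 mq)
    (tendsto_moll_L2 mq)
  have l3 := tendsto_integral_bdd_mul_mul (mD (rot d)) (bD (rot d)) mu mq memU memQ (tendsto_moll_L2 mu)
    (tendsto_moll_L2 mq)
  have lim := (l1.sub l2).add (l3.const_mul 2)
  have ind : ∀ (a f g : Plane → ℝ), ∫ x, a x * (Ω.indicator f x * Ω.indicator g x)
      = ∫ x in Ω, a x * (f x * g x) := fun a f g => by
    rw [← integral_indicator hm]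
    refine integral_congr_ae (Eventually.of_forall fun x => ?_)
    by_cases hx : x ∈ Ω <;> simp [hx]
  rw [ind, ind, ind] at lim
  refine tendsto_nhds_unique lim (tendsto_const_nhds.congr' ?_)
  obtain ⟨δ, hδ, hδΩ⟩ := IsCompact.exists_cthickening_subset_open hθc ho hθΩ
  filter_upwards [(tendsto_mollRad.eventually_lt_const hδ)] with n hn
  have cr : ∀ x ∈ tsupport θ, fderiv ℝ (U n) x (e 0) + fderiv ℝ (Q n) x (e 1) = 0 ∧
      fderiv ℝ (Q n) x (e 0) - fderiv ℝ (U n) x (e 1) = 0 := by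
    intro x hx
    have hball : Metric.closedBall x (mollRad n) ⊆ Ω :=
      ((Metric.closedBall_subset_closedBall hn.le).trans
        (Metric.closedBall_subset_cthickening hx δ)).trans hδΩ
    have hts := (tsupport_mollTest n x).trans hball
    simp only [hU, hQ, fderiv_moll_indicator hm n lu, fderiv_moll_indicator hm n lq]
    have a1 := h.div _ (contDiff_mollTest n x) (hasCompactSupport_mollTest n x) hts
    have a2 := h.curl _ (contDiff_mollTest n x) (hasCompactSupport_mollTest n x) hts
    constructor <;> linarith
  have i1 := integral_lineDeriv_mul_smooth hθ hθc ((sU n).mul (sU n)) (cU n).mul_right d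
  have i2 := integral_lineDeriv_mul_smooth hθ hθc ((sQ n).mul (sQ n)) (cQ n).mul_right d
  have i3 := integral_lineDeriv_mul_smooth hθ hθc ((sU n).mul (sQ n)) (cU n).mul_right (rot d)
  rw [i1, i2, i3]
  have dmul : ∀ {f g : Plane → ℝ}, ContDiff ℝ ∞ f → ContDiff ℝ ∞ g → ∀ x v,
      fderiv ℝ (fun x => f x * g x) x v = f x * fderiv ℝ g x v + g x * fderiv ℝ f x v := by
    intro f g hf hg x v
    rw [fderiv_fun_mul (hf.differentiable (by simp) x) (hg.differentiable (by simp) x)]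
    simp
  have int : ∀ {f g : Plane → ℝ}, ContDiff ℝ ∞ f → ContDiff ℝ ∞ g → ∀ v,
      Integrable fun x => fderiv ℝ (fun x => f x * g x) x v * θ x := fun hf hg v =>
    ((continuous_fderiv_test (hf.mul hg) v).mul hθ.continuous).integrable_of_hasCompactSupport
      hθc.mul_left
  have tot : (∫ x, fderiv ℝ (fun x => U n x * U n x) x d * θ x)
      - (∫ x, fderiv ℝ (fun x => Q n x * Q n x) x d * θ x)
      + 2 * (∫ x, fderiv ℝ (fun x => U n x * Q n x) x (rot d) * θ x) = 0 := by
    have i1 := int (sU n) (sU n) d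
    have i2 := int (sQ n) (sQ n) d
    have i3 := (int (sU n) (sQ n) (rot d)).const_mul 2
    rw [← integral_sub i1 i2, ← integral_const_mul]
    refine (integral_add (i1.sub i2) i3).symm.trans ?_
    refine integral_eq_zero_of_ae (Eventually.of_forall fun x => ?_)
    have dd : ∀ f : Plane → ℝ, fderiv ℝ f x d
        = d 0 * fderiv ℝ f x (e 0) + d 1 * fderiv ℝ f x (e 1) := fun f => by
      rw [fderiv_apply_plane, Fin.sum_univ_two]; ring
    have dr : ∀ f : Plane → ℝ, fderiv ℝ f x (rot d)
        = -d 1 * fderiv ℝ f x (e 0) + d 0 * fderiv ℝ f x (e 1) := fun f => by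
      simp [rot]
    simp only [Pi.zero_apply, Pi.sub_apply, dmul (sU n) (sU n), dmul (sQ n) (sQ n),
      dmul (sU n) (sQ n), dd, dr]
    by_cases hx : x ∈ tsupport θ
    · obtain ⟨c1, c2⟩ := cr x hx
      have e1 : fderiv ℝ (Q n) x (e 1) = -fderiv ℝ (U n) x (e 0) := by linarith
      have e2 : fderiv ℝ (U n) x (e 1) = fderiv ℝ (Q n) x (e 0) := by linarith
      rw [e1, e2]; ring
    · rw [image_eq_zero_of_notMem_tsupport hx]; ring
  linarith

end Rellich

/-! ### Graph coordinates near the boundary -/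

section Geometry

lemma abs_coord_le (v : Plane) (i : Fin 2) : |v i| ≤ ‖v‖ := PiLp.norm_apply_le v i

lemma plane_norm_le (v : Plane) : ‖v‖ ≤ |v 0| + |v 1| := by
  have he : ∀ j : Fin 2, ‖e j‖ = 1 := fun j => by simp [e]
  conv_lhs => rw [plane_eq_sum v]
  refine (norm_sum_le _ _).trans (le_of_eq ?_)
  simp [Fin.sum_univ_two, norm_smul, he]

/-- In the Cartesian coordinates given by `R`, the set `Ω` is near `x₀` the region above the graph
of `f`. -/
structure GraphBox (Ω : Set Plane) (x₀ : Plane) (R : Plane ≃ₗᵢ[ℝ] Plane) (K : NNReal) (f : ℝ → ℝ)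
    (b : ℝ) : Prop where
  pos : 0 < b
  lip : LipschitzWith K f
  base : f (R x₀ 0) = R x₀ 1
  mem : ∀ y, |R y 0 - R x₀ 0| ≤ b → |R y 1 - f (R y 0)| ≤ 3 * b → (y ∈ Ω ↔ f (R y 0) < R y 1)

lemma continuous_coord (R : Plane ≃ₗᵢ[ℝ] Plane) (i : Fin 2) : Continuous fun y => R y i :=
  (EuclideanSpace.proj i : Plane →L[ℝ] ℝ).continuous.comp R.continuous

lemma IsLipschitzDomain.exists_graphBox {Ω : Set Plane} (hΩ : IsLipschitzDomain Ω) {x₀ : Plane}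
    (hx : x₀ ∈ frontier Ω) : ∃ R K f b, GraphBox Ω x₀ R K f b := by
  obtain ⟨R, K, f, r, hr, hf, hmem⟩ := hΩ.graph x₀ hx
  have hx0 : x₀ ∉ Ω := fun h => by
    rw [hΩ.isOpen.frontier_eq] at hx
    exact hx.2 h
  have c0 := continuous_coord R 0
  have c1 := continuous_coord R 1
  have hbase : f (R x₀ 0) = R x₀ 1 := by
    refine le_antisymm ?_ ?_
    · have hcl : x₀ ∈ closure (Ω ∩ Metric.ball x₀ r) := by
        exact Metric.isOpen_ball.closure_inter ⟨frontier_subset_closure hx, Metric.mem_ball_self hr⟩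
      have hsub : closure (Ω ∩ Metric.ball x₀ r) ⊆ {y | f (R y 0) ≤ R y 1} :=
        closure_minimal (fun y hy => ((hmem y hy.2).1 hy.1).le)
          (isClosed_le (hf.continuous.comp c0) c1)
      exact hsub hcl
    · by_contra hcon
      exact hx0 ((hmem x₀ (Metric.mem_ball_self hr)).2 (not_le.1 hcon))
  refine ⟨R, K, f, r / (2 * (4 + K)), by positivity, hf, hbase, fun y h1 h2 => ?_⟩
  refine hmem y ?_
  set b := r / (2 * (4 + K)) with hb
  have hbr : b * (4 + K) = r / 2 := by rw [hb]; field_simp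
  rw [Metric.mem_ball, dist_eq_norm, ← R.norm_map, map_sub]
  refine (plane_norm_le _).trans_lt ?_
  simp only [PiLp.sub_apply]
  have h3 : |f (R y 0) - f (R x₀ 0)| ≤ K * b := by
    have := hf.dist_le_mul (R y 0) (R x₀ 0)
    rw [Real.dist_eq, Real.dist_eq] at this
    exact this.trans (by gcongr)
  have h4 : |R y 1 - R x₀ 1| ≤ 3 * b + K * b := by
    have : R y 1 - R x₀ 1 = (R y 1 - f (R y 0)) + (f (R y 0) - f (R x₀ 0)) := by rw [hbase]; ring
    rw [this]
    exact (abs_add_le _ _).trans (add_le_add h2 h3)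
  nlinarith

/-- Height above the graph of `f`. -/
noncomputable def height (R : Plane ≃ₗᵢ[ℝ] Plane) (f : ℝ → ℝ) (y : Plane) : ℝ := R y 1 - f (R y 0)

lemma lipschitzWith_coord (R : Plane ≃ₗᵢ[ℝ] Plane) (i : Fin 2) :
    LipschitzWith 1 fun y => R y i := by
  refine LipschitzWith.of_dist_le_mul fun y y' => ?_
  rw [Real.dist_eq, ← PiLp.sub_apply, ← map_sub, NNReal.coe_one, one_mul, dist_eq_norm,
    ← R.norm_map (y - y')]
  exact abs_coord_le _ i

lemma coord_add_smul_zero (R : Plane ≃ₗᵢ[ℝ] Plane) (y : Plane) (s : ℝ) :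
    R (y + s • R.symm (e 1)) 0 = R y 0 := by
  simp [e]

lemma coord_add_smul_one (R : Plane ≃ₗᵢ[ℝ] Plane) (y : Plane) (s : ℝ) :
    R (y + s • R.symm (e 1)) 1 = R y 1 + s := by
  simp [e]

variable {Ω : Set Plane} {x₀ : Plane} {R : Plane ≃ₗᵢ[ℝ] Plane} {K : NNReal} {f : ℝ → ℝ} {b : ℝ}

lemma height_add_smul (y : Plane) (s : ℝ) :
    height R f (y + s • R.symm (e 1)) = height R f y + s := by
  rw [height, height, coord_add_smul_zero, coord_add_smul_one]; ring

lemma GraphBox.lipschitzWith_height (h : GraphBox Ω x₀ R K f b) :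
    LipschitzWith (1 + K) (height R f) := by
  have := (lipschitzWith_coord R 1).sub (h.lip.comp (lipschitzWith_coord R 0))
  rw [mul_one] at this
  exact this

/-- The points between two heights. -/
def GraphBox.slab (_ : GraphBox Ω x₀ R K f b) (l m : ℝ) : Set Plane :=
  {y | |R y 0 - R x₀ 0| ≤ b ∧ l ≤ height R f y ∧ height R f y ≤ m}

lemma GraphBox.isClosed_slab (h : GraphBox Ω x₀ R K f b) (l m : ℝ) : IsClosed (h.slab l m) := by
  have ch := h.lipschitzWith_height.continuous
  have c0 := continuous_coord R 0
  exact (isClosed_le (c0.sub continuous_const).abs continuous_const).inter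
    ((isClosed_le continuous_const ch).inter (isClosed_le ch continuous_const))

lemma GraphBox.isCompact_slab (h : GraphBox Ω x₀ R K f b) {l m : ℝ} (hl : 0 ≤ l) :
    IsCompact (h.slab l m) := by
  refine Metric.isCompact_of_isClosed_isBounded (h.isClosed_slab l m) ?_
  refine (Metric.isBounded_closedBall (x := x₀) (r := b + (m + K * b))).subset fun y hy => ?_
  rw [Metric.mem_closedBall, dist_eq_norm, ← R.norm_map, map_sub]
  refine (plane_norm_le _).trans ?_
  simp only [PiLp.sub_apply]
  refine add_le_add hy.1 ?_
  have h3 : |f (R y 0) - f (R x₀ 0)| ≤ K * b := by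
    have := h.lip.dist_le_mul (R y 0) (R x₀ 0)
    rw [Real.dist_eq, Real.dist_eq] at this
    exact this.trans (mul_le_mul_of_nonneg_left hy.1 K.coe_nonneg)
  have : R y 1 - R x₀ 1 = height R f y + (f (R y 0) - f (R x₀ 0)) := by
    rw [h.base, height]; ring
  rw [this]
  refine (abs_add_le _ _).trans (add_le_add ?_ h3)
  rw [abs_of_nonneg (hl.trans hy.2.1)]
  exact hy.2.2

lemma GraphBox.slab_subset (h : GraphBox Ω x₀ R K f b) {l m : ℝ} (hl : 0 < l) (hm : m ≤ 3 * b) :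
    h.slab l m ⊆ Ω := fun y hy => by
  have h1 : 0 < height R f y := hl.trans_le hy.2.1
  refine (h.mem y hy.1 ?_).2 (sub_pos.1 h1)
  change |height R f y| ≤ _
  rw [abs_of_pos h1]
  exact hy.2.2.trans hm

/-- A neighbourhood of the centre of the box. -/
def GraphBox.core (_ : GraphBox Ω x₀ R K f b) : Set Plane :=
  {y | |R y 0 - R x₀ 0| < b / 2 ∧ |height R f y| < b / 2}

lemma GraphBox.isOpen_core (h : GraphBox Ω x₀ R K f b) : IsOpen h.core := by
  have ch := h.lipschitzWith_height.continuous
  have c0 := continuous_coord R 0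
  exact (isOpen_lt (c0.sub continuous_const).abs continuous_const).inter (isOpen_lt ch.abs continuous_const)

lemma GraphBox.mem_core (h : GraphBox Ω x₀ R K f b) : x₀ ∈ h.core := by
  have := h.pos
  constructor
  · simpa using this
  · simpa [height, h.base] using this

lemma GraphBox.mem_iff_of_mem_core (h : GraphBox Ω x₀ R K f b) {y : Plane} (hy : y ∈ h.core) :
    y ∈ Ω ↔ 0 < height R f y := by
  have := h.pos
  rw [h.mem y (hy.1.le.trans (by linarith)) (le_trans (le_of_lt hy.2) (by linarith)), height,
    sub_pos]

/-- Lipschitz function that increases at unit speed away from the graph of `f + σ` near `x₀`. -/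
noncomputable def tent (x₀ : Plane) (R : Plane ≃ₗᵢ[ℝ] Plane) (f : ℝ → ℝ) (b σ : ℝ) (y : Plane) : ℝ :=
  max 0 (min (min (height R f y - σ) (2 * b - (height R f y - σ))) (b - |R y 0 - R x₀ 0|))

lemma GraphBox.lipschitzWith_tent (h : GraphBox Ω x₀ R K f b) (σ : ℝ) :
    LipschitzWith (1 + K) (tent x₀ R f b σ) := by
  have h1 : LipschitzWith (1 + K) fun y => height R f y - σ := by
    simpa using h.lipschitzWith_height.sub (LipschitzWith.const σ)
  have h2 : LipschitzWith (1 + K) fun y => 2 * b - (height R f y - σ) := by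
    simpa using (LipschitzWith.const (2 * b)).sub h1
  have h3 : LipschitzWith 1 fun y => b - |R y 0 - R x₀ 0| := by
    have a1 : LipschitzWith 1 fun y => R y 0 - R x₀ 0 := by
      simpa using (lipschitzWith_coord R 0).sub (LipschitzWith.const (R x₀ 0))
    have a2 : LipschitzWith 1 fun y => |R y 0 - R x₀ 0| := by
      have := lipschitzWith_one_norm.comp a1
      rw [mul_one] at this
      exact this
    simpa using (LipschitzWith.const b).sub a2
  have h4 := ((h1.min h2).min h3).const_max 0
  refine h4.weaken ?_
  simp

lemma tent_nonneg (σ : ℝ) (y : Plane) : 0 ≤ tent x₀ R f b σ y := le_max_left _ _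

lemma tent_pos {σ : ℝ} {y : Plane} (h : tent x₀ R f b σ y ≠ 0) :
    σ < height R f y ∧ height R f y < 2 * b + σ ∧ |R y 0 - R x₀ 0| < b := by
  have : 0 < min (min (height R f y - σ) (2 * b - (height R f y - σ))) (b - |R y 0 - R x₀ 0|) := by
    by_contra hcon
    exact h (max_eq_left (not_lt.1 hcon))
  rw [lt_min_iff, lt_min_iff] at this
  obtain ⟨⟨h1, h2⟩, h3⟩ := this
  exact ⟨by linarith, by linarith, by linarith⟩

lemma GraphBox.tsupport_tent (h : GraphBox Ω x₀ R K f b) {σ : ℝ} (hσ : σ < b) :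
    tsupport (tent x₀ R f b σ) ⊆ h.slab σ (3 * b) :=
  closure_minimal (fun y hy => by
    obtain ⟨h1, h2, h3⟩ := tent_pos hy
    exact ⟨h3.le, h1.le, by linarith⟩) (h.isClosed_slab _ _)

lemma tent_add_smul (σ : ℝ) (y : Plane) (s : ℝ) : tent x₀ R f b σ (y + s • R.symm (e 1)) =
    max 0 (min (min (height R f y + s - σ) (2 * b - (height R f y + s - σ)))
      (b - |R y 0 - R x₀ 0|)) := by
  rw [tent, height_add_smul, coord_add_smul_zero]

lemma norm_dir (R : Plane ≃ₗᵢ[ℝ] Plane) : ‖R.symm (e 1)‖ = 1 := by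
  rw [R.symm.norm_map]; simp [e]

lemma GraphBox.lineDeriv_tent_core (h : GraphBox Ω x₀ R K f b) {σ : ℝ} (hσ : 0 < σ) {y : Plane}
    (hy : y ∈ h.core) (hyσ : σ < height R f y) :
    lineDeriv ℝ (tent x₀ R f b σ) y (R.symm (e 1)) = 1 := by
  have h1 := abs_lt.1 hy.2
  have hev : (fun s : ℝ => tent x₀ R f b σ (y + s • R.symm (e 1)))
      =ᶠ[𝓝 0] fun s => height R f y - σ + s := by
    have : Ioo (σ - height R f y) (b / 2 - height R f y) ∈ 𝓝 (0 : ℝ) :=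
      Ioo_mem_nhds (by linarith) (by linarith)
    filter_upwards [this] with s hs
    rw [tent_add_smul, min_eq_left, min_eq_left, max_eq_right]
    · ring
    · linarith [hs.1]
    · linarith [hs.2]
    · rw [min_eq_left (by linarith [hs.2])]
      linarith [hs.2, hy.1]
  rw [lineDeriv, hev.deriv_eq]
  simp

lemma GraphBox.lineDeriv_tent_nonneg (h : GraphBox Ω x₀ R K f b) {σ : ℝ} {y : Plane}
    (hy : height R f y - σ < b) :
    0 ≤ lineDeriv ℝ (tent x₀ R f b σ) y (R.symm (e 1)) := by
  have hb := h.pos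
  set g : ℝ → ℝ := fun s => max 0 (min (height R f y - σ + s) (b - |R y 0 - R x₀ 0|)) with hg
  have hev : (fun s : ℝ => tent x₀ R f b σ (y + s • R.symm (e 1))) =ᶠ[𝓝 0] g := by
    have : Iio (b - (height R f y - σ)) ∈ 𝓝 (0 : ℝ) := Iio_mem_nhds (by linarith)
    filter_upwards [this] with s hs
    have hs' : s < b - (height R f y - σ) := hs
    rw [tent_add_smul, min_assoc, min_eq_right (a := 2 * b - (height R f y + s - σ))
      (by linarith [abs_nonneg (R y 0 - R x₀ 0)])]
    simp only [hg]
    congr 2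
    ring
  rw [lineDeriv, hev.deriv_eq]
  have hmono : Monotone g := fun s t hst => by
    simp only [hg]
    gcongr
  exact hmono.deriv_nonneg

end Geometry

section Conjugate

variable {Ω : Set Plane} {x₀ : Plane} {R : Plane ≃ₗᵢ[ℝ] Plane} {K : NNReal} {f : ℝ → ℝ} {b : ℝ}
  {u q : Plane → ℝ}

lemma GraphBox.le_lineDeriv_tent (h : GraphBox Ω x₀ R K f b) {σ : ℝ} (hσ : 0 < σ) (hσb : σ < b)
    (y : Plane) :
    (h.core ∩ {y | σ < height R f y}).indicator (fun _ => (1 : ℝ)) y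
      - (h.slab b (3 * b)).indicator (fun _ => ((1 + K : NNReal) : ℝ)) y
      ≤ lineDeriv ℝ (tent x₀ R f b σ) y (R.symm (e 1)) := by
  have hs0 : 0 ≤ (h.slab b (3 * b)).indicator (fun _ => ((1 + K : NNReal) : ℝ)) y :=
    indicator_nonneg (fun _ _ => NNReal.coe_nonneg _) y
  by_cases hy : y ∈ h.core ∩ {y | σ < height R f y}
  · rw [indicator_of_mem hy, h.lineDeriv_tent_core hσ hy.1 hy.2]
    linarith
  rw [indicator_of_notMem hy]
  rcases lt_or_ge (height R f y - σ) b with h1 | h1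
  · linarith [h.lineDeriv_tent_nonneg h1]
  by_cases h2 : tent x₀ R f b σ y = 0
  · have : lineDeriv ℝ (tent x₀ R f b σ) y (R.symm (e 1)) = 0 := by
      rw [lineDeriv]
      refine IsLocalMin.deriv_eq_zero (Eventually.of_forall fun s => ?_)
      simp only [zero_smul, add_zero, h2]
      exact tent_nonneg _ _
    rw [this]; linarith
  · obtain ⟨a1, a2, a3⟩ := tent_pos h2
    have hmem : y ∈ h.slab b (3 * b) := ⟨a3.le, by linarith, by linarith⟩
    rw [indicator_of_mem hmem]
    have := norm_lineDeriv_le_of_lipschitz ℝ (h.lipschitzWith_tent σ) (x₀ := y) (v := R.symm (e 1))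
    rw [norm_dir, mul_one, Real.norm_eq_abs] at this
    linarith [(abs_le.1 this).1]

lemma integrable_bdd_mul {α : Type*} [MeasurableSpace α] {μ : Measure α} {a g : α → ℝ} {C : ℝ}
    (ha : AEStronglyMeasurable a μ) (hC : ∀ x, ‖a x‖ ≤ C) (hg : Integrable g μ) :
    Integrable (fun x => a x * g x) μ :=
  hg.bdd_mul ha (Eventually.of_forall hC)

lemma norm_rot_le (d : Plane) (hd : ‖d‖ = 1) : ‖rot d‖ ≤ 2 := by
  have h0 := abs_coord_le d 0
  have h1 := abs_coord_le d 1
  have he : ∀ j : Fin 2, ‖e j‖ = 1 := fun j => by simp [e]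
  refine (norm_add_le _ _).trans ?_
  rw [norm_smul, norm_smul, he, he, norm_neg, Real.norm_eq_abs, Real.norm_eq_abs]
  linarith

lemma GraphBox.integral_core_height_le (h : GraphBox Ω x₀ R K f b) (ho : IsOpen Ω)
    (hbd : Bornology.IsBounded Ω) (huq : IsDivCurlFree Ω u q) {σ : ℝ} (hσ : 0 < σ) (hσb : σ < b) :
    ∫ x in Ω ∩ (h.core ∩ {y | σ < height R f y}), q x ^ 2 ≤
      (1 + K) * ((∫ x in h.slab b (3 * b), q x ^ 2) + (∫ x in Ω, u x ^ 2)
        + 4 * ∫ x in Ω, |u x * q x|) := by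
  set d := R.symm (e 1) with hd
  set θ := tent x₀ R f b σ with hθ
  have hlip := h.lipschitzWith_tent σ
  have hb := h.pos
  have hts := h.tsupport_tent (σ := σ) hσb
  have hcs : HasCompactSupport θ :=
    (h.isCompact_slab hσ.le).of_isClosed_subset (isClosed_tsupport _) hts
  have hrel := huq.rellich ho hbd hlip hcs (hts.trans (h.slab_subset hσ le_rfl)) d
  have mL : ∀ v, AEStronglyMeasurable (fun x => lineDeriv ℝ θ x v)
      ((volume : Measure Plane).restrict Ω) :=
    fun v => (measurable_lineDeriv hlip.continuous).aestronglyMeasurable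
  have bL : ∀ v x, ‖lineDeriv ℝ θ x v‖ ≤ (1 + K : NNReal) * ‖v‖ :=
    fun v x => norm_lineDeriv_le_of_lipschitz ℝ hlip
  have iu : Integrable (fun x => u x ^ 2) ((volume : Measure Plane).restrict Ω) :=
    huq.memLp_fst.integrable_sq
  have iq : Integrable (fun x => q x ^ 2) ((volume : Measure Plane).restrict Ω) :=
    huq.memLp_snd.integrable_sq
  have iuq : Integrable (fun x => u x * q x) ((volume : Measure Plane).restrict Ω) :=
    huq.memLp_fst.integrable_mul huq.memLp_snd
  have ch := h.lipschitzWith_height.continuous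
  have mA : MeasurableSet (h.core ∩ {y | σ < height R f y}) :=
    (h.isOpen_core.inter (isOpen_lt continuous_const ch)).measurableSet
  have mS : MeasurableSet (h.slab b (3 * b)) := (h.isClosed_slab _ _).measurableSet
  have hSΩ : h.slab b (3 * b) ⊆ Ω := h.slab_subset hb le_rfl
  have c0 : ((1 + K : NNReal) : ℝ) = 1 + K := by simp
  have hlow : (∫ x in Ω ∩ (h.core ∩ {y | σ < height R f y}), q x ^ 2)
      - (1 + K) * ∫ x in h.slab b (3 * b), q x ^ 2 ≤ ∫ x in Ω, lineDeriv ℝ θ x d * q x ^ 2 := by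
    have e1 : ∫ x in h.slab b (3 * b), q x ^ 2
        = ∫ x in Ω, (h.slab b (3 * b)).indicator (fun x => q x ^ 2) x := by
      rw [setIntegral_indicator mS, inter_eq_right.2 hSΩ]
    rw [e1, ← setIntegral_indicator mA, ← integral_const_mul, ← integral_sub (iq.indicator mA)
      ((iq.indicator mS).const_mul _)]
    refine integral_mono ((iq.indicator mA).sub ((iq.indicator mS).const_mul _))
      (integrable_bdd_mul (mL d) (bL d) iq) fun x => ?_
    have hx := mul_le_mul_of_nonneg_right (h.le_lineDeriv_tent hσ hσb x) (sq_nonneg (q x))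
    refine le_trans (le_of_eq ?_) hx
    by_cases h1 : x ∈ h.core ∩ {y | σ < height R f y} <;> by_cases h2 : x ∈ h.slab b (3 * b) <;>
      simp only [indicator_of_mem, indicator_of_notMem, h1, h2, not_false_iff, c0] <;> ring
  have hup1 : ∫ x in Ω, lineDeriv ℝ θ x d * (u x * u x) ≤ (1 + K) * ∫ x in Ω, u x ^ 2 := by
    rw [← integral_const_mul]
    have : Integrable (fun x => u x * u x) ((volume : Measure Plane).restrict Ω) := by
      simpa only [sq] using iu
    refine integral_mono (integrable_bdd_mul (mL d) (bL d) this) (iu.const_mul _) fun x => ?_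
    have hx := bL d x
    rw [norm_dir, mul_one, c0, Real.norm_eq_abs] at hx
    simp only [← sq]
    exact mul_le_mul_of_nonneg_right ((le_abs_self _).trans hx) (sq_nonneg _)
  have hup2 : ∫ x in Ω, lineDeriv ℝ θ x (rot d) * (u x * q x)
      ≤ (1 + K) * (2 * ∫ x in Ω, |u x * q x|) := by
    rw [← integral_const_mul, ← integral_const_mul]
    refine integral_mono (integrable_bdd_mul (mL _) (bL _) iuq)
      ((iuq.abs.const_mul _).const_mul _) fun x => ?_
    have hx := bL (rot d) x
    have hr := norm_rot_le d (norm_dir R)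
    rw [c0] at hx
    refine (le_abs_self _).trans ?_
    rw [abs_mul, ← mul_assoc]
    refine mul_le_mul_of_nonneg_right ?_ (abs_nonneg _)
    rw [← Real.norm_eq_abs]
    exact hx.trans (by gcongr)
  have e2 : ∫ x in Ω, lineDeriv ℝ θ x d * q x ^ 2 = ∫ x in Ω, lineDeriv ℝ θ x d * (q x * q x) := by
    simp only [sq]
  rw [e2] at hlow
  linarith

lemma GraphBox.integral_core_le (h : GraphBox Ω x₀ R K f b) (ho : IsOpen Ω)
    (hbd : Bornology.IsBounded Ω) (huq : IsDivCurlFree Ω u q) :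
    ∫ x in Ω ∩ h.core, q x ^ 2 ≤
      (1 + K) * ((∫ x in h.slab b (3 * b), q x ^ 2) + (∫ x in Ω, u x ^ 2)
        + 4 * ∫ x in Ω, |u x * q x|) := by
  have hb := h.pos
  have ch := h.lipschitzWith_height.continuous
  have iq : IntegrableOn (fun x => q x ^ 2) Ω := huq.memLp_snd.integrable_sq
  set A : ℕ → Set Plane := fun n => Ω ∩ (h.core ∩ {y | b / (n + 2) < height R f y}) with hA
  have hUn : ⋃ n, A n = Ω ∩ h.core := by
    refine Subset.antisymm (iUnion_subset fun n => inter_subset_inter_right _ inter_subset_left) ?_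
    rintro y ⟨hy1, hy2⟩
    have hpos := (h.mem_iff_of_mem_core hy2).1 hy1
    have hlim : Tendsto (fun n : ℕ => b / ((n : ℝ) + 2)) atTop (𝓝 0) :=
      tendsto_const_nhds.div_atTop (tendsto_atTop_add_const_right _ _ tendsto_natCast_atTop_atTop)
    obtain ⟨n, hn⟩ := (hlim.eventually_lt_const hpos).exists
    exact mem_iUnion.2 ⟨n, hy1, hy2, hn⟩
  have hmono : Monotone A := by
    intro m n hmn y hy
    refine ⟨hy.1, hy.2.1, mem_ofPred.2 (lt_of_le_of_lt ?_ (mem_ofPred.1 hy.2.2))⟩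
    gcongr
  have hlim := tendsto_setIntegral_of_monotone (μ := (volume : Measure Plane))
    (f := fun x => q x ^ 2) (s := A) (fun n => (ho.inter (h.isOpen_core.inter
      (isOpen_lt continuous_const ch))).measurableSet) hmono
    (by rw [hUn]; exact iq.mono_set inter_subset_left)
  rw [hUn] at hlim
  refine le_of_tendsto' hlim fun n => ?_
  refine h.integral_core_height_le ho hbd huq (by positivity) ?_
  exact div_lt_self hb (by have : (0 : ℝ) ≤ n := n.cast_nonneg; linarith)

/-- A square integrable conjugate harmonic function is controlled by its conjugate and by its
values in the interior. -/
theorem IsLipschitzDomain.exists_conjugate_bound (hΩ : IsLipschitzDomain Ω) :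
    ∃ (κ : Set Plane) (C : ℝ), IsCompact κ ∧ κ ⊆ Ω ∧ 0 ≤ C ∧ ∀ u q, IsDivCurlFree Ω u q →
      ∫ x in Ω, q x ^ 2 ≤ C * ((∫ x in κ, q x ^ 2) + ∫ x in Ω, u x ^ 2) := by
  have hbox := fun x : frontier Ω => hΩ.exists_graphBox x.2
  choose R K f b h using hbox
  obtain ⟨t, ht⟩ := (isCompact_frontier hΩ.isBounded).elim_finite_subcover (fun x => (h x).core)
    (fun x => (h x).isOpen_core) (fun x hx => mem_iUnion.2 ⟨⟨x, hx⟩, (h ⟨x, hx⟩).mem_core⟩)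
  set κ : Set Plane := (closure Ω \ ⋃ x ∈ t, (h x).core) ∪ ⋃ x ∈ t, (h x).slab (b x) (3 * b x)
    with hκ
  have hopen : IsOpen (⋃ x ∈ t, (h x).core) := isOpen_biUnion fun x _ => (h x).isOpen_core
  have hκc : IsCompact κ := by
    refine IsCompact.union (hΩ.isBounded.isCompact_closure.diff hopen) ?_
    exact t.isCompact_biUnion fun x _ => (h x).isCompact_slab (h x).pos.le
  have hκΩ : κ ⊆ Ω := by
    refine union_subset (fun y hy => ?_) (iUnion₂_subset fun x _ =>
      (h x).slab_subset (h x).pos le_rfl)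
    by_contra hcon
    refine hy.2 (ht ?_)
    rw [hΩ.isOpen.frontier_eq]
    exact ⟨hy.1, hcon⟩
  set C : ℝ := ∑ x ∈ t, (1 + (K x : ℝ)) with hC
  have hC0 : 0 ≤ C := Finset.sum_nonneg fun x _ => by positivity
  refine ⟨κ, 2 * (1 + C + 8 * C ^ 2), hκc, hκΩ, by positivity, fun u q huq => ?_⟩
  have iu : IntegrableOn (fun x => u x ^ 2) Ω := huq.memLp_fst.integrable_sq
  have iq : IntegrableOn (fun x => q x ^ 2) Ω := huq.memLp_snd.integrable_sq
  have iuq : IntegrableOn (fun x => u x * q x) Ω := huq.memLp_fst.integrable_mul huq.memLp_snd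
  set Iu := ∫ x in Ω, u x ^ 2 with hIu
  set Iq := ∫ x in Ω, q x ^ 2 with hIq
  set J := ∫ x in Ω, |u x * q x| with hJ
  set Ik := ∫ x in κ, q x ^ 2 with hIk
  have hIu0 : 0 ≤ Iu := integral_nonneg fun x => sq_nonneg _
  have hIk0 : 0 ≤ Ik := integral_nonneg fun x => sq_nonneg _
  have hJ0 : 0 ≤ J := integral_nonneg fun x => abs_nonneg _
  have hslab : ∀ x ∈ t, ∫ y in (h x).slab (b x) (3 * b x), q y ^ 2 ≤ Ik := fun x hx =>
    setIntegral_mono_set (iq.mono_set hκΩ) (Eventually.of_forall fun y => sq_nonneg _)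
      (LE.le.eventuallyLE (fun y hy => Or.inr (mem_iUnion₂.2 ⟨x, hx, hy⟩)))
  have hcover : Iq ≤ Ik + ∑ x ∈ t, ∫ y in Ω ∩ (h x).core, q y ^ 2 := by
    have hpt : ∀ y ∈ Ω, q y ^ 2 ≤ κ.indicator (fun y => q y ^ 2) y
        + ∑ x ∈ t, ((h x).core).indicator (fun y => q y ^ 2) y := by
      intro y hy
      have n1 : 0 ≤ κ.indicator (fun y => q y ^ 2) y := indicator_nonneg (fun _ _ => sq_nonneg _) _
      have n2 : ∀ x ∈ t, 0 ≤ ((h x).core).indicator (fun y => q y ^ 2) y := fun x _ =>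
        indicator_nonneg (fun _ _ => sq_nonneg _) _
      by_cases hyc : y ∈ ⋃ x ∈ t, (h x).core
      · obtain ⟨x, hx, hyx⟩ := mem_iUnion₂.1 hyc
        have := Finset.single_le_sum n2 hx
        rw [indicator_of_mem hyx] at this
        linarith
      · rw [indicator_of_mem (show y ∈ κ from Or.inl ⟨subset_closure hy, hyc⟩)]
        linarith [Finset.sum_nonneg n2]
    have i1 : IntegrableOn (κ.indicator fun y => q y ^ 2) Ω :=
      Integrable.indicator iq hκc.isClosed.measurableSet
    have i2 : ∀ x ∈ t, IntegrableOn ((h x).core.indicator fun y => q y ^ 2) Ω := fun x _ =>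
      Integrable.indicator iq (h x).isOpen_core.measurableSet
    calc Iq ≤ ∫ y in Ω, (κ.indicator (fun y => q y ^ 2) y
        + ∑ x ∈ t, ((h x).core).indicator (fun y => q y ^ 2) y) :=
          setIntegral_mono_on iq (i1.add (integrable_finsetSum t i2)) hΩ.isOpen.measurableSet hpt
      _ = _ := by
          rw [integral_add i1 (integrable_finsetSum t i2), integral_finsetSum t i2,
            setIntegral_indicator hκc.isClosed.measurableSet, inter_eq_right.2 hκΩ]
          congr 1
          exact Finset.sum_congr rfl fun x _ =>
            setIntegral_indicator (h x).isOpen_core.measurableSet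
  have hsum : ∑ x ∈ t, ∫ y in Ω ∩ (h x).core, q y ^ 2 ≤ C * (Ik + Iu + 4 * J) := by
    rw [hC, Finset.sum_mul]
    refine Finset.sum_le_sum fun x hx => ?_
    refine ((h x).integral_core_le hΩ.isOpen hΩ.isBounded huq).trans ?_
    gcongr
    exact hslab x hx
  have hJle : 4 * C * J ≤ 1 / 2 * Iq + 8 * C ^ 2 * Iu := by
    rw [hJ, hIq, hIu, ← integral_const_mul, ← integral_const_mul, ← integral_const_mul,
      ← integral_add (iq.const_mul _) (iu.const_mul _)]
    refine integral_mono (iuq.abs.const_mul _) ((iq.const_mul _).add (iu.const_mul _)) fun x => ?_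
    simp only [abs_mul]
    have := sq_nonneg (|q x| - 4 * C * |u x|)
    have e1 := sq_abs (q x)
    have e2 := sq_abs (u x)
    nlinarith
  nlinarith [mul_nonneg hC0 hIk0, mul_nonneg hC0 hIu0, mul_nonneg (sq_nonneg C) hIk0]

end Conjugate

/-! ### Korn's inequality -/

section Korn

variable {Ω : Set Plane}

lemma norm_sq_eq_sum_comp (w : L2 Ω Plane) : ‖w‖ ^ 2 = ∑ i, ‖comp Ω i w‖ ^ 2 := by
  have h : ∀ i, ‖comp Ω i w‖ ^ 2 = ∫ x in Ω, w x i * w x i := fun i => by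
    rw [← real_inner_self_eq_norm_sq, inner_L2_eq]
    refine integral_congr_ae ?_
    filter_upwards [coeFn_comp i w] with x hx
    rw [hx]
  have hi : ∀ i ∈ Finset.univ, Integrable (fun x => w x i * w x i)
      ((volume : Measure Plane).restrict Ω) := fun i _ => by
    have hm : MemLp (fun x => w x i) 2 ((volume : Measure Plane).restrict Ω) :=
      (EuclideanSpace.proj i : Plane →L[ℝ] ℝ).comp_memLp' (Lp.memLp w)
    exact hm.integrable_mul hm
  simp_rw [h]
  rw [← integral_finsetSum _ hi, ← real_inner_self_eq_norm_sq, L2.inner_def]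
  refine integral_congr_ae (Eventually.of_forall fun x => ?_)
  simp only [Fin.sum_univ_two]
  rw [real_inner_self_eq_norm_sq, EuclideanSpace.real_norm_sq_eq, Fin.sum_univ_two, sq, sq]

lemma norm_comp_le (i : Fin 2) (w : L2 Ω Plane) : ‖comp Ω i w‖ ≤ ‖w‖ := by
  refine le_of_sq_le_sq ?_ (norm_nonneg _)
  rw [norm_sq_eq_sum_comp w]
  exact Finset.single_le_sum (f := fun i => ‖comp Ω i w‖ ^ 2) (fun _ _ => sq_nonneg _)
    (Finset.mem_univ i)

lemma jet_norm_sq {F : Type*} [NormedAddCommGroup F] [InnerProductSpace ℝ F] (z : Jet Ω F) :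
    ‖z‖ ^ 2 = ‖z.fst‖ ^ 2 + ∑ j, ‖z.snd j‖ ^ 2 := by
  rw [WithLp.prod_norm_sq_eq_of_L2, PiLp.norm_sq_eq_of_L2]

lemma abs_integral_bdd_mul_le {a : Plane → ℝ} {C : ℝ} (ha : Continuous a) (hC : ∀ x, ‖a x‖ ≤ C)
    (f g : L2 Ω ℝ) : |∫ x in Ω, a x * (f x * g x)| ≤ C * (‖f‖ * ‖g‖) := by
  have hm : MemLp (fun x => a x * f x) 2 ((volume : Measure Plane).restrict Ω) :=
    (Lp.memLp f).mul (memLp_top_of_bound ha.aestronglyMeasurable C (Eventually.of_forall hC))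
  have e1 : ∫ x in Ω, a x * (f x * g x) = inner ℝ (hm.toLp _) g := by
    rw [inner_L2_eq]
    refine integral_congr_ae ?_
    filter_upwards [hm.coeFn_toLp] with x hx
    rw [hx, mul_assoc]
  have e2 : ‖hm.toLp _‖ ≤ C * ‖f‖ := by
    refine Lp.norm_le_mul_norm_of_ae_le_mul ?_
    filter_upwards [hm.coeFn_toLp] with x hx
    rw [hx, norm_mul]
    exact mul_le_mul_of_nonneg_right (hC x) (norm_nonneg _)
  rw [e1, ← mul_assoc]
  exact (abs_real_inner_le_norm _ _).trans (mul_le_mul_of_nonneg_right e2 (norm_nonneg _))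

lemma hasWeakPartial_comp {z : Jet Ω Plane} (hz : z ∈ H1 Ω Plane) (i j : Fin 2) :
    HasWeakPartial Ω j (comp Ω i z.fst) (comp Ω i (z.snd j)) := by
  intro φ h1 h2 h3
  have key : ∀ {ψ : Plane → ℝ} (_ : Continuous ψ) (_ : HasCompactSupport ψ) (w : L2 Ω Plane),
      ∫ x in Ω, ψ x • comp Ω i w x = (∫ x in Ω, ψ x • w x) i := by
    intro ψ hψ hc w
    have := (EuclideanSpace.proj i : Plane →L[ℝ] ℝ).integral_comp_comm
      (integrable_test_smul hψ hc w)
    refine Eq.trans ?_ this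
    refine integral_congr_ae ?_
    filter_upwards [coeFn_comp i w] with x hx
    simp [hx]
  rw [key (continuous_fderiv_test h1 (e j)) (h2.fderiv_apply ℝ (e j)), key h1.continuous h2,
    hz j φ h1 h2 h3]
  simp

lemma contDiff_fderiv_apply {φ : Plane → ℝ} (h1 : ContDiff ℝ ∞ φ) (v : Plane) :
    ContDiff ℝ ∞ fun x => fderiv ℝ φ x v :=
  (h1.fderiv_right (m := ∞) (by simp)).clm_apply contDiff_const

lemma tsupport_fderiv_apply {φ : Plane → ℝ} (v : Plane) :
    tsupport (fun x => fderiv ℝ φ x v) ⊆ tsupport φ :=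
  tsupport_fderiv_apply_subset ℝ v

lemma fderiv_fderiv_comm {φ : Plane → ℝ} (h1 : ContDiff ℝ ∞ φ) (x v w : Plane) :
    fderiv ℝ (fun y => fderiv ℝ φ y v) x w = fderiv ℝ (fun y => fderiv ℝ φ y w) x v := by
  have hd : DifferentiableAt ℝ (fderiv ℝ φ) x :=
    (h1.fderiv_right (m := ∞) (by simp)).differentiable (by simp) x
  have h : ∀ v w, fderiv ℝ (fun y => fderiv ℝ φ y v) x w = fderiv ℝ (fderiv ℝ φ) x w v := by
    intro v w
    rw [fderiv_clm_apply hd (differentiableAt_const v)]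
    simp
  rw [h, h]
  exact (h1.contDiffAt.isSymmSndFDerivAt (by simp; exact WithTop.coe_le_coe.2 le_top)) w v

/-- Weak gradients are curl free. -/
lemma curl_of_hasWeakPartial {f g₀ g₁ : Plane → ℝ} (h0 : HasWeakPartial Ω 0 f g₀)
    (h1 : HasWeakPartial Ω 1 f g₁) {φ : Plane → ℝ} (a1 : ContDiff ℝ ∞ φ) (a2 : HasCompactSupport φ)
    (a3 : tsupport φ ⊆ Ω) :
    (∫ x in Ω, fderiv ℝ φ x (e 0) * g₁ x) - ∫ x in Ω, fderiv ℝ φ x (e 1) * g₀ x = 0 := by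
  have b1 := h1 (fun x => fderiv ℝ φ x (e 0)) (contDiff_fderiv_apply a1 _)
    (a2.fderiv_apply ℝ _) ((tsupport_fderiv_apply _).trans a3)
  have b0 := h0 (fun x => fderiv ℝ φ x (e 1)) (contDiff_fderiv_apply a1 _)
    (a2.fderiv_apply ℝ _) ((tsupport_fderiv_apply _).trans a3)
  simp only [smul_eq_mul] at b0 b1
  simp only [fderiv_fderiv_comm a1 _ (e 0) (e 1)] at b1
  linarith

lemma hasWeakPartial_smooth {ψ : Plane → ℝ} (hψ : ContDiff ℝ ∞ ψ) (j : Fin 2) :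
    HasWeakPartial Ω j ψ fun x => fderiv ℝ ψ x (e j) := by
  intro φ h1 h2 h3
  have ext : ∀ (a b : Plane → ℝ), tsupport a ⊆ Ω → ∫ x in Ω, a x • b x = ∫ x, a x * b x := by
    intro a b ha
    refine setIntegral_eq_integral_of_forall_compl_eq_zero fun x hx => ?_
    rw [image_eq_zero_of_notMem_tsupport fun h => hx (ha h), zero_smul]
  rw [ext (fun x => fderiv ℝ φ x (e j)) ψ ((tsupport_fderiv_apply _).trans h3), ext φ _ h3]
  rw [integral_mul_fderiv_eq_neg_fderiv_mul_of_integrable (f := φ) (g := ψ) (v := e j)]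
  · rw [neg_neg]
  · exact ((continuous_fderiv_test h1 _).mul hψ.continuous).integrable_of_hasCompactSupport
      (h2.fderiv_apply ℝ _).mul_right
  · exact (h1.continuous.mul (continuous_fderiv_test hψ _)).integrable_of_hasCompactSupport
      h2.mul_right
  · exact (h1.continuous.mul hψ.continuous).integrable_of_hasCompactSupport h2.mul_right
  · exact fun x _ => h1.differentiable (by simp) x
  · exact fun x _ => hψ.differentiable (by simp) x

/-- Pairs of square integrable functions. -/
abbrev Grad (Ω : Set Plane) : Type := PiLp 2 (fun _ : Fin 2 => L2 Ω ℝ)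

open Classical in
/-- The gradient of a test function as a pair of square integrable functions. -/
noncomputable def gradTest (Ω : Set Plane) (φ : Plane → ℝ) : Grad Ω :=
  if h : ContDiff ℝ ∞ φ ∧ HasCompactSupport φ then
    WithLp.toLp 2 fun j => (memLp_test (Ω := Ω) (continuous_fderiv_test h.1 (e j))
      (h.2.fderiv_apply ℝ (e j)) 2).toLp _
  else 0

lemma coeFn_gradTest {φ : Plane → ℝ} (h1 : ContDiff ℝ ∞ φ) (h2 : HasCompactSupport φ)
    (j : Fin 2) : gradTest Ω φ j =ᵐ[(volume : Measure Plane).restrict Ω]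
      fun x => fderiv ℝ φ x (e j) := by
  rw [gradTest, dif_pos ⟨h1, h2⟩]
  exact (memLp_test (continuous_fderiv_test h1 (e j)) (h2.fderiv_apply ℝ (e j)) 2).coeFn_toLp

lemma inner_gradTest {φ : Plane → ℝ} (h1 : ContDiff ℝ ∞ φ) (h2 : HasCompactSupport φ)
    (p : Grad Ω) : inner ℝ (gradTest Ω φ) p = ∑ j, ∫ x in Ω, fderiv ℝ φ x (e j) * p j x := by
  rw [PiLp.inner_apply]
  refine Finset.sum_congr rfl fun j _ => ?_
  rw [inner_L2_eq]
  refine integral_congr_ae ?_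
  filter_upwards [coeFn_gradTest h1 h2 j] with x hx
  rw [hx]

/-- Closure of the gradients of test functions. -/
noncomputable def gradSpace (Ω : Set Plane) : Submodule ℝ (Grad Ω) :=
  (Submodule.span ℝ {p | ∃ φ : Plane → ℝ, ContDiff ℝ ∞ φ ∧ HasCompactSupport φ ∧ tsupport φ ⊆ Ω ∧
    p = gradTest Ω φ}).topologicalClosure

lemma gradTest_mem {φ : Plane → ℝ} (h1 : ContDiff ℝ ∞ φ) (h2 : HasCompactSupport φ)
    (h3 : tsupport φ ⊆ Ω) : gradTest Ω φ ∈ gradSpace Ω :=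
  Submodule.le_topologicalClosure _ (Submodule.subset_span ⟨φ, h1, h2, h3, rfl⟩)

/-- A continuous functional that vanishes on gradients of test functions vanishes on
`gradSpace Ω`. -/
lemma eq_zero_of_mem_gradSpace (l : Grad Ω →L[ℝ] ℝ)
    (hl : ∀ φ : Plane → ℝ, ContDiff ℝ ∞ φ → HasCompactSupport φ → tsupport φ ⊆ Ω →
      l (gradTest Ω φ) = 0) {p : Grad Ω} (hp : p ∈ gradSpace Ω) : l p = 0 := by
  have : gradSpace Ω ≤ LinearMap.ker (l : Grad Ω →ₗ[ℝ] ℝ) := by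
    refine Submodule.topologicalClosure_minimal _ ?_ l.isClosed_ker
    rw [Submodule.span_le]
    rintro _ ⟨φ, h1, h2, h3, rfl⟩
    exact hl φ h1 h2 h3
  exact this hp

lemma gradSpace_curl {p : Grad Ω} (hp : p ∈ gradSpace Ω) {φ : Plane → ℝ} (a1 : ContDiff ℝ ∞ φ)
    (a2 : HasCompactSupport φ) (a3 : tsupport φ ⊆ Ω) :
    (∫ x in Ω, fderiv ℝ φ x (e 0) * p 1 x) - ∫ x in Ω, fderiv ℝ φ x (e 1) * p 0 x = 0 := by
  have hin : ∀ (k j : Fin 2) (p : Grad Ω), inner ℝ (gradTest Ω φ k) (p j)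
      = ∫ x in Ω, fderiv ℝ φ x (e k) * p j x := fun k j p => by
    rw [inner_L2_eq]
    refine integral_congr_ae ?_
    filter_upwards [coeFn_gradTest a1 a2 k] with x hx
    rw [hx]
  let l : Grad Ω →L[ℝ] ℝ :=
    (innerSL ℝ (gradTest Ω φ 0)).comp (PiLp.proj 2 (fun _ : Fin 2 => L2 Ω ℝ) 1) -
      (innerSL ℝ (gradTest Ω φ 1)).comp (PiLp.proj 2 (fun _ : Fin 2 => L2 Ω ℝ) 0)
  have hl : ∀ p, l p = (∫ x in Ω, fderiv ℝ φ x (e 0) * p 1 x)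
      - ∫ x in Ω, fderiv ℝ φ x (e 1) * p 0 x := fun p => by
    rw [← hin 0 1, ← hin 1 0]; rfl
  rw [← hl]
  refine eq_zero_of_mem_gradSpace l (fun ψ b1 b2 _ => ?_) hp
  rw [hl]
  have := curl_of_hasWeakPartial (Ω := Ω) (hasWeakPartial_smooth b1 0) (hasWeakPartial_smooth b1 1)
    a1 a2 a3
  rw [← this]
  congr 1
  · refine integral_congr_ae ?_
    filter_upwards [coeFn_gradTest b1 b2 1] with x hx
    rw [hx]
  · refine integral_congr_ae ?_
    filter_upwards [coeFn_gradTest b1 b2 0] with x hx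
    rw [hx]

/-- The gradient of the `i`-th component. -/
noncomputable def gradComp (z : Jet Ω Plane) (i : Fin 2) : Grad Ω :=
  WithLp.toLp 2 fun j => comp Ω i (z.snd j)

/-- The `i`-th partial derivatives of the components. -/
noncomputable def partialComp (z : Jet Ω Plane) (i : Fin 2) : Grad Ω :=
  WithLp.toLp 2 fun j => comp Ω j (z.snd i)

lemma inner_partialComp_eq_zero {z : Jet Ω Plane} (hz : z ∈ H1 Ω Plane)
    (hdiv : ∀ᵐ x ∂(volume : Measure Plane).restrict Ω, ∑ j, (z.snd j x) j = 0) (i : Fin 2)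
    {p : Grad Ω} (hp : p ∈ gradSpace Ω) : inner ℝ (partialComp z i) p = 0 := by
  refine eq_zero_of_mem_gradSpace (innerSL ℝ (partialComp z i)) (fun φ h1 h2 h3 => ?_) hp
  rw [innerSL_apply_apply, real_inner_comm, inner_gradTest h1 h2]
  have hj : ∀ j, ∫ x in Ω, fderiv ℝ φ x (e j) * partialComp z i j x
      = ∫ x in Ω, fderiv ℝ φ x (e i) * comp Ω j (z.snd j) x := by
    intro j
    have b1 := hasWeakPartial_comp hz j i (fun x => fderiv ℝ φ x (e j)) (contDiff_fderiv_apply h1 _)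
      (h2.fderiv_apply ℝ _) ((tsupport_fderiv_apply _).trans h3)
    have b2 := hasWeakPartial_comp hz j j (fun x => fderiv ℝ φ x (e i)) (contDiff_fderiv_apply h1 _)
      (h2.fderiv_apply ℝ _) ((tsupport_fderiv_apply _).trans h3)
    simp only [smul_eq_mul, fderiv_fderiv_comm h1 _ (e i) (e j)] at b1 b2
    change ∫ x in Ω, fderiv ℝ φ x (e j) * comp Ω j (z.snd i) x = _
    linarith
  simp_rw [hj]
  have hint : ∀ j ∈ Finset.univ, Integrable (fun x => fderiv ℝ φ x (e i) * comp Ω j (z.snd j) x)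
      ((volume : Measure Plane).restrict Ω) := fun j _ =>
    integrable_test_smul (continuous_fderiv_test h1 _) (h2.fderiv_apply ℝ _) _
  rw [← integral_finsetSum _ hint]
  refine integral_eq_zero_of_ae ?_
  filter_upwards [hdiv, coeFn_comp 0 (z.snd 0), coeFn_comp 1 (z.snd 1)] with x h4 h5 h6
  rw [Fin.sum_univ_two] at h4 ⊢
  rw [h5, h6, ← mul_add, h4, mul_zero, Pi.zero_apply]

end Korn

section KornInequality

variable {Ω : Set Plane}

lemma TendstoL2.comp {φ : ℕ → Plane → Plane} {w : L2 Ω Plane} (h : TendstoL2 φ w) (i : Fin 2) :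
    TendstoL2 (fun m x => φ m x i) (comp Ω i w) := by
  refine tendsto_of_tendsto_of_tendsto_of_le_of_le tendsto_const_nhds h (fun _ => zero_le) ?_
  intro m
  refine eLpNorm_mono_ae ?_
  filter_upwards [coeFn_comp i w] with x hx
  rw [hx]
  exact PiLp.norm_apply_le (φ m x - w x) i

lemma fderiv_coord {φ : Plane → Plane} (h : ContDiff ℝ ∞ φ) (i : Fin 2) (x v : Plane) :
    fderiv ℝ (fun y => φ y i) x v = fderiv ℝ φ x v i := by
  have := ((EuclideanSpace.proj i : Plane →L[ℝ] ℝ).hasFDerivAt.comp x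
    (h.differentiable (by simp) x).hasFDerivAt).fderiv
  exact congrArg (fun l : Plane →L[ℝ] ℝ => l v) this

lemma contDiff_coord {φ : Plane → Plane} (h : ContDiff ℝ ∞ φ) (i : Fin 2) :
    ContDiff ℝ ∞ fun y => φ y i :=
  (EuclideanSpace.proj i : Plane →L[ℝ] ℝ).contDiff.comp h

/-- Testing a field orthogonal to the gradients of test functions with `∇(η f)`. -/
lemma sum_integral_cutoff_eq_zero (hΩ : Bornology.IsBounded Ω) {W g : Grad Ω}
    (hW : W ∈ (gradSpace Ω)ᗮ) {η : Plane → ℝ} (h1 : ContDiff ℝ ∞ η) (h2 : HasCompactSupport η)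
    (h3 : tsupport η ⊆ Ω) {f : L2 Ω ℝ} {φ : ℕ → Plane → ℝ} (hφ : ∀ m, ContDiff ℝ ∞ (φ m))
    (hf : TendstoL2 φ f) (hg : ∀ j, TendstoL2 (fun m x => fderiv ℝ (φ m) x (e j)) (g j)) :
    ∑ j, ((∫ x in Ω, η x * (W j x * g j x)) + ∫ x in Ω, fderiv ℝ η x (e j) * (W j x * f x)) = 0 := by
  have hzero : ∀ m, ∑ j, ((∫ x in Ω, η x * (W j x * fderiv ℝ (φ m) x (e j))) +
      ∫ x in Ω, fderiv ℝ η x (e j) * (W j x * φ m x)) = 0 := by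
    intro m
    have hs : ContDiff ℝ ∞ fun x => η x * φ m x := h1.mul (hφ m)
    have hc : HasCompactSupport fun x => η x * φ m x := h2.mul_right
    have ho := (Submodule.mem_orthogonal _ _).1 hW _ (gradTest_mem hs hc
      ((tsupport_mul_subset_left).trans h3))
    rw [inner_gradTest hs hc] at ho
    rw [← ho]
    refine Finset.sum_congr rfl fun j _ => ?_
    rw [← integral_add]
    · refine integral_congr_ae (Eventually.of_forall fun x => ?_)
      simp only
      rw [fderiv_fun_mul (h1.differentiable (by simp) x) ((hφ m).differentiable (by simp) x)]
      simp
      ring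
    · have := integrable_test_smul (Ω := Ω)
        (h1.continuous.mul (continuous_fderiv_test (hφ m) (e j))) (h2.mul_right) (W j)
      refine this.congr (Eventually.of_forall fun x => ?_)
      simp only [smul_eq_mul, Pi.mul_apply]
      ring
    · have := integrable_test_smul (Ω := Ω) ((continuous_fderiv_test h1 (e j)).mul (hφ m).continuous)
        ((h2.fderiv_apply ℝ (e j)).mul_right) (W j)
      refine this.congr (Eventually.of_forall fun x => ?_)
      simp only [smul_eq_mul, Pi.mul_apply]
      ring
  have hbd : ∀ {a : Plane → ℝ} (_ : Continuous a) (_ : HasCompactSupport a), ∃ C, ∀ x, ‖a x‖ ≤ C :=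
    fun ha hc => hc.exists_bound_of_continuous ha
  have hlim : Tendsto (fun m => ∑ j, ((∫ x in Ω, η x * (W j x * fderiv ℝ (φ m) x (e j))) +
      ∫ x in Ω, fderiv ℝ η x (e j) * (W j x * φ m x))) atTop
      (𝓝 (∑ j, ((∫ x in Ω, η x * (W j x * g j x)) +
        ∫ x in Ω, fderiv ℝ η x (e j) * (W j x * f x)))) := by
    refine tendsto_finsetSum _ fun j _ => ?_
    have hconst : Tendsto (fun _ : ℕ => eLpNorm (fun x => W j x - W j x) 2
        ((volume : Measure Plane).restrict Ω)) atTop (𝓝 0) := by simp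
    obtain ⟨C, hC⟩ := hbd h1.continuous h2
    obtain ⟨C', hC'⟩ := hbd (continuous_fderiv_test h1 (e j)) (h2.fderiv_apply ℝ (e j))
    refine Tendsto.add ?_ ?_
    · exact tendsto_integral_bdd_mul_mul h1.continuous.aestronglyMeasurable hC (Lp.memLp (W j))
        (Lp.memLp (g j)) (fun _ => Lp.memLp (W j))
        (fun m => memLp_of_continuous hΩ (continuous_fderiv_test (hφ m) (e j)) 2) hconst (hg j)
    · exact tendsto_integral_bdd_mul_mul (continuous_fderiv_test h1 (e j)).aestronglyMeasurable hC'
        (Lp.memLp (W j)) (Lp.memLp f) (fun _ => Lp.memLp (W j))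
        (fun m => memLp_of_continuous hΩ (hφ m).continuous 2) hconst hf
  simp only [hzero] at hlim
  exact (tendsto_nhds_unique hlim tendsto_const_nhds)

/-- The projection of a weak gradient onto the complement of the gradients of test functions is
divergence free and curl free. -/
lemma isDivCurlFree_of_orthogonal {f : Plane → ℝ} {g G W : Grad Ω} (hG : G ∈ gradSpace Ω)
    (hW : W ∈ (gradSpace Ω)ᗮ) (hg : ∀ j, HasWeakPartial Ω j f (g j)) (hgGW : g = G + W) :
    IsDivCurlFree Ω (W 0) (W 1) := by
  refine ⟨Lp.memLp _, Lp.memLp _, fun φ h1 h2 h3 => ?_, fun φ h1 h2 h3 => ?_⟩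
  · have := (Submodule.mem_orthogonal _ _).1 hW _ (gradTest_mem h1 h2 h3)
    rwa [inner_gradTest h1 h2, Fin.sum_univ_two] at this
  · have a := curl_of_hasWeakPartial (hg 0) (hg 1) h1 h2 h3
    have b := gradSpace_curl hG h1 h2 h3
    have hsum : ∀ k j, ∫ x in Ω, fderiv ℝ φ x (e k) * g j x =
        (∫ x in Ω, fderiv ℝ φ x (e k) * G j x) + ∫ x in Ω, fderiv ℝ φ x (e k) * W j x := fun k j => by
      have := integral_test_add (Ω := Ω) (continuous_fderiv_test h1 (e k)) (h2.fderiv_apply ℝ (e k))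
        (G j) (W j)
      simp only [smul_eq_mul] at this
      rw [← this, hgGW]
      rfl
    rw [hsum, hsum] at a
    linarith

lemma norm_sq_L2_eq (f : L2 Ω ℝ) : ‖f‖ ^ 2 = ∫ x in Ω, f x ^ 2 := by
  rw [← real_inner_self_eq_norm_sq, inner_L2_eq]
  simp only [sq]

lemma norm_sq_grad (p : Grad Ω) : ‖p‖ ^ 2 = ∑ j, ‖p j‖ ^ 2 := PiLp.norm_sq_eq_of_L2 _ p

lemma norm_grad_apply_le (p : Grad Ω) (j : Fin 2) : ‖p j‖ ≤ ‖p‖ := PiLp.norm_apply_le p j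

lemma sq_le_of_sq_le_add_mul {X p r : ℝ} (h : X ^ 2 ≤ p + X * r) : X ^ 2 ≤ 2 * p + r ^ 2 := by
  nlinarith [sq_nonneg (X - r)]

lemma sq_le_of_interior {X C₀ A s m : ℝ} (hC₀ : 0 ≤ C₀) (hA : 0 ≤ A)
    (h : X ^ 2 ≤ C₀ * (6 * s ^ 2 + 2 * A * (s * m)) + X * (C₀ * (A * m + s))) :
    X ^ 2 ≤ (2 * C₀ * (6 + A) + 2 * C₀ ^ 2 * (A ^ 2 + 1)) * (s ^ 2 + m ^ 2) := by
  have h3 := sq_le_of_sq_le_add_mul h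
  have d1 : A * (2 * (s * m)) ≤ A * (s ^ 2 + m ^ 2) := by
    gcongr; nlinarith [sq_nonneg (s - m)]
  have d2 : (A * m + s) ^ 2 ≤ 2 * (A ^ 2 + 1) * (s ^ 2 + m ^ 2) := by
    nlinarith [sq_nonneg (A * m - s), sq_nonneg (A * s), sq_nonneg m, sq_nonneg s]
  have d3 : C₀ ^ 2 * (A * m + s) ^ 2 ≤ C₀ ^ 2 * (2 * (A ^ 2 + 1) * (s ^ 2 + m ^ 2)) := by gcongr
  have d4 : 2 * C₀ * (6 * s ^ 2 + A * (2 * (s * m))) ≤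
      2 * C₀ * ((6 + A) * (s ^ 2 + m ^ 2)) := by
    gcongr; nlinarith [sq_nonneg m]
  linarith

/-- Bound of the non-gradient part of a row of the gradient. -/
lemma norm_sq_le_of_conjugate {C₀ A s m : ℝ} (hC₀ : 0 ≤ C₀) {η : Plane → ℝ} {κ : Set Plane}
    (hκ : MeasurableSet κ) (hκΩ : κ ⊆ Ω) (h1 : ContDiff ℝ ∞ η) (hη1 : ∀ x ∈ κ, η x = 1)
    (hη : ∀ x, η x ∈ Icc (0 : ℝ) 1) (hA : ∀ j x, ‖fderiv ℝ η x (e j)‖ ≤ A) {f : L2 Ω ℝ}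
    {g G W : Grad Ω} (i k : Fin 2) (hik : i ≠ k) (hgGW : g = G + W) (hs : 0 ≤ s)
    (hG : ‖G‖ ≤ s) (hgi : ‖g i‖ ≤ s) (hf : ‖f‖ ≤ m)
    (hcut : ∑ j, ((∫ x in Ω, η x * (W j x * g j x)) +
      ∫ x in Ω, fderiv ℝ η x (e j) * (W j x * f x)) = 0)
    (hconj : ∫ x in Ω, W k x ^ 2 ≤ C₀ * ((∫ x in κ, W k x ^ 2) + ∫ x in Ω, W i x ^ 2)) :
    ‖g‖ ^ 2 ≤ 2 * (5 + 2 * C₀ * (6 + A) + 2 * C₀ ^ 2 * (A ^ 2 + 1)) * (s ^ 2 + m ^ 2) := by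
  have hηc : ∀ x, ‖η x‖ ≤ 1 := fun x => by
    rw [Real.norm_eq_abs, abs_of_nonneg (hη x).1]; exact (hη x).2
  have hA0 : 0 ≤ A := (norm_nonneg _).trans (hA 0 0)
  have hm : 0 ≤ m := (norm_nonneg _).trans hf
  have hgj : ∀ j, g j = G j + W j := fun j => by rw [hgGW]; rfl
  have hWi : ‖W i‖ ≤ 2 * s := by
    have : W i = g i - G i := by rw [hgj]; abel
    rw [this]
    refine (norm_sub_le _ _).trans ?_
    linarith [(norm_grad_apply_le G i).trans hG]
  have hint : ∀ a b : L2 Ω ℝ, Integrable (fun x => η x * (a x * b x))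
      ((volume : Measure Plane).restrict Ω) := fun a b =>
    integrable_bdd_mul h1.continuous.aestronglyMeasurable hηc
      ((Lp.memLp a).integrable_mul (Lp.memLp b))
  have hsplit : ∫ x in Ω, η x * (W k x * g k x) =
      (∫ x in Ω, η x * (W k x * G k x)) + ∫ x in Ω, η x * (W k x * W k x) := by
    rw [← integral_add (hint _ _) (hint _ _)]
    refine integral_congr_ae ?_
    filter_upwards [Lp.coeFn_add (G k) (W k)] with x hx
    rw [hgj, hx, Pi.add_apply]
    ring
  have hκle : ∫ x in κ, W k x ^ 2 ≤ ∫ x in Ω, η x * (W k x * W k x) := by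
    have e1 : ∫ x in κ, W k x ^ 2 = ∫ x in κ, η x * (W k x * W k x) := by
      refine setIntegral_congr_fun hκ fun x hx => ?_
      simp only [hη1 x hx]
      ring
    rw [e1]
    refine setIntegral_mono_set (hint _ _) (Eventually.of_forall fun x => ?_)
      (hκΩ.eventuallyLE)
    exact mul_nonneg (hη x).1 (mul_self_nonneg _)
  have hsum : ∑ j, ((∫ x in Ω, η x * (W j x * g j x)) +
      ∫ x in Ω, fderiv ℝ η x (e j) * (W j x * f x)) =
      ((∫ x in Ω, η x * (W i x * g i x)) + ∫ x in Ω, fderiv ℝ η x (e i) * (W i x * f x)) +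
      ((∫ x in Ω, η x * (W k x * g k x)) + ∫ x in Ω, fderiv ℝ η x (e k) * (W k x * f x)) := by
    rw [Fin.sum_univ_two]
    fin_cases i <;> fin_cases k <;> simp at hik ⊢
    ring
  rw [hsum, hsplit] at hcut
  have b1 := abs_le.1 (abs_integral_bdd_mul_le h1.continuous hηc (W i) (g i))
  have b2 := abs_le.1 (abs_integral_bdd_mul_le (continuous_fderiv_test h1 (e i)) (hA i) (W i) f)
  have b3 := abs_le.1 (abs_integral_bdd_mul_le (continuous_fderiv_test h1 (e k)) (hA k) (W k) f)
  have b4 := abs_le.1 (abs_integral_bdd_mul_le h1.continuous hηc (W k) (G k))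
  rw [← norm_sq_L2_eq, ← norm_sq_L2_eq] at hconj
  set X := ‖W k‖ with hX
  have hX0 : 0 ≤ X := norm_nonneg _
  have c1 : ‖W i‖ * ‖g i‖ ≤ 2 * s * s := by gcongr
  have c2 : A * (‖W i‖ * ‖f‖) ≤ A * (2 * s * m) := by gcongr
  have c3 : A * (X * ‖f‖) ≤ A * (X * m) := by gcongr
  have c4 : X * ‖G k‖ ≤ X * s := by
    gcongr; exact (norm_grad_apply_le G k).trans hG
  have c5 : ‖W i‖ ^ 2 ≤ (2 * s) ^ 2 := by gcongr
  have hη2 : ∫ x in Ω, η x * (W k x * W k x) ≤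
      2 * s * s + A * (2 * s * m) + A * (X * m) + X * s := by linarith [b1.1, b2.1, b3.1, b4.1]
  have hX2 : X ^ 2 ≤ C₀ * (6 * s ^ 2 + 2 * A * (s * m)) + X * (C₀ * (A * m + s)) := by
    refine hconj.trans ?_
    have : (∫ x in κ, W k x ^ 2) + ‖W i‖ ^ 2 ≤
        2 * s * s + A * (2 * s * m) + A * (X * m) + X * s + (2 * s) ^ 2 := by linarith
    refine (mul_le_mul_of_nonneg_left this hC₀).trans (le_of_eq ?_)
    ring
  have hX4 := sq_le_of_interior hC₀ hA0 hX2
  have hW2 : ‖W‖ ^ 2 = ‖W i‖ ^ 2 + X ^ 2 := by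
    rw [norm_sq_grad, Fin.sum_univ_two, hX]
    fin_cases i <;> fin_cases k <;> simp at hik ⊢
    ring
  have hg2 : ‖g‖ ^ 2 ≤ 2 * (‖G‖ ^ 2 + ‖W‖ ^ 2) := by
    have := norm_add_le G W
    rw [← hgGW] at this
    nlinarith [sq_nonneg (‖G‖ - ‖W‖), norm_nonneg g]
  have hG2 : ‖G‖ ^ 2 ≤ s ^ 2 := by gcongr
  have hm2 := sq_nonneg m
  rw [hW2] at hg2
  linarith

/-- Korn's inequality for divergence free fields. -/
theorem IsLipschitzDomain.exists_korn (hΩ : IsLipschitzDomain Ω) :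
    ∃ C : ℝ, 0 < C ∧ ∀ (ΓD : Set Plane), ∀ z ∈ V1 Ω ΓD,
      ‖z‖ ^ 2 ≤ C * ((∑ i, ∑ j, ‖comp Ω i (z.snd j) + comp Ω j (z.snd i)‖ ^ 2) + ‖z.fst‖ ^ 2) := by
  obtain ⟨κ, C₀, hκ, hκΩ, hC₀, hconj⟩ := hΩ.exists_conjugate_bound
  obtain ⟨η, h1, h2, h3, hη1, hη⟩ := exists_smooth_cutoff_of_isCompact hκ hΩ.isOpen hκΩ
  have hA : ∃ A, ∀ j x, ‖fderiv ℝ η x (e j)‖ ≤ A := by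
    have := fun j => (h2.fderiv_apply ℝ (e j)).exists_bound_of_continuous
      (continuous_fderiv_test h1 (e j))
    choose A hA using this
    refine ⟨max (A 0) (A 1), fun j x => ?_⟩
    fin_cases j
    · exact (hA 0 x).trans (le_max_left _ _)
    · exact (hA 1 x).trans (le_max_right _ _)
  obtain ⟨A, hA⟩ := hA
  have hA0 : 0 ≤ A := (norm_nonneg _).trans (hA 0 0)
  set C₁ := 2 * (5 + 2 * C₀ * (6 + A) + 2 * C₀ ^ 2 * (A ^ 2 + 1)) with hC₁
  have hC₁0 : 0 < C₁ := by positivity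
  refine ⟨1 + 2 * C₁, by positivity, fun ΓD z hz => ?_⟩
  obtain ⟨hzH, hdiv, τ, ⟨φ, a1, a2, a3, -⟩, -⟩ := hz
  have hrow : ∀ i k : Fin 2, i ≠ k → ‖gradComp z i‖ ^ 2 ≤
      C₁ * (‖gradComp z i + partialComp z i‖ ^ 2 + ‖z.fst‖ ^ 2) := by
    intro i k hik
    have : CompleteSpace (gradSpace Ω) :=
      (Submodule.isClosed_topologicalClosure _).completeSpace_coe
    obtain ⟨G, hG, W, hW, hgGW⟩ := (gradSpace Ω).exists_add_mem_mem_orthogonal (gradComp z i)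
    have hWp : ∀ j, HasWeakPartial Ω j (comp Ω i z.fst) (gradComp z i j) :=
      fun j => hasWeakPartial_comp hzH i j
    have hdc := isDivCurlFree_of_orthogonal hG hW hWp hgGW
    have hGs : ‖G‖ ≤ ‖gradComp z i + partialComp z i‖ := by
      have e1 : inner ℝ (gradComp z i + partialComp z i) G = ‖G‖ ^ 2 := by
        rw [inner_add_left, inner_partialComp_eq_zero hzH hdiv i hG, hgGW, inner_add_left,
          real_inner_self_eq_norm_sq, Submodule.inner_left_of_mem_orthogonal hG hW]
        ring
      have e2 := real_inner_le_norm (gradComp z i + partialComp z i) G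
      rw [e1, sq] at e2
      rcases (norm_nonneg G).eq_or_lt with h0 | h0
      · rw [← h0]; positivity
      · exact le_of_mul_le_mul_right e2 h0
    have hgi : ‖gradComp z i i‖ ≤ ‖gradComp z i + partialComp z i‖ := by
      have e1 : (gradComp z i + partialComp z i) i = (2 : ℝ) • gradComp z i i := by
        rw [two_smul]; rfl
      have e2 := norm_grad_apply_le (gradComp z i + partialComp z i) i
      rw [e1, norm_smul, Real.norm_eq_abs, abs_two] at e2
      linarith [norm_nonneg (gradComp z i i)]
    refine norm_sq_le_of_conjugate hC₀ hκ.measurableSet hκΩ h1 hη1 hη hA i k hik hgGW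
      (norm_nonneg _) hGs hgi (norm_comp_le i z.fst) ?_ ?_
    · refine sum_integral_cutoff_eq_zero hΩ.isBounded hW h1 h2 h3
        (fun m => contDiff_coord (a1 m) i) (a2.comp i) fun j => ?_
      simp_rw [fderiv_coord (a1 _)]
      exact (a3 j).comp i
    · have hr := hconj _ _ hdc.rotate
      have hd := hconj _ _ hdc
      simp only [even_two, Even.neg_pow] at hr
      fin_cases i <;> fin_cases k <;> simp at hik
      · exact hd
      · exact hr
  have r0 := hrow 0 1 (by decide)
  have r1 := hrow 1 0 (by decide)
  have hE : ∀ i, ‖gradComp z i + partialComp z i‖ ^ 2 =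
      ∑ j, ‖comp Ω i (z.snd j) + comp Ω j (z.snd i)‖ ^ 2 := fun i => norm_sq_grad _
  have hg : ∀ i, ‖gradComp z i‖ ^ 2 = ∑ j, ‖comp Ω i (z.snd j)‖ ^ 2 := fun i => norm_sq_grad _
  have hz2 : ‖z‖ ^ 2 = ‖z.fst‖ ^ 2 + (‖gradComp z 0‖ ^ 2 + ‖gradComp z 1‖ ^ 2) := by
    rw [jet_norm_sq, hg, hg]
    simp_rw [norm_sq_eq_sum_comp (z.snd _), Fin.sum_univ_two]
    ring
  rw [hz2, Fin.sum_univ_two (f := fun i => ∑ j, ‖comp Ω i (z.snd j) + comp Ω j (z.snd i)‖ ^ 2),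
    ← hE, ← hE]
  nlinarith [sq_nonneg ‖gradComp z 0 + partialComp z 0‖, sq_nonneg ‖gradComp z 1 + partialComp z 1‖,
    sq_nonneg ‖z.fst‖]

end KornInequality

/-! ### Ladyzhenskaya's inequality -/

section Ladyzhenskaya

variable {Ω : Set Plane}

/-- Linear coordinates given by two transversal directions change integrals by a constant factor. -/
lemma exists_linear_coords {d : Fin 2 → Plane} (hd : LinearIndependent ℝ d) :
    ∃ (T : (ℝ × ℝ) ≃L[ℝ] Plane) (c : NNReal), (∀ a c, T (a, c) = a • d 0 + c • d 1) ∧ c ≠ 0 ∧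
      ∀ F : Plane → ℝ≥0∞, ∫⁻ x, F x = c * ∫⁻ p : ℝ × ℝ, F (T p) := by
  let b := basisOfLinearIndependentOfCardEqFinrank hd (by simp)
  let T : (ℝ × ℝ) ≃L[ℝ] Plane :=
    ((LinearEquiv.finTwoArrow ℝ ℝ).symm.trans b.equivFun.symm).toContinuousLinearEquiv
  have hT : ∀ a c, T (a, c) = a • d 0 + c • d 1 := fun a c => by
    simp [T, b, Module.Basis.equivFun_symm_apply, Fin.sum_univ_two, LinearEquiv.finTwoArrow]
  have := T.isAddHaarMeasure_map (volume : Measure (ℝ × ℝ))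
  obtain ⟨c, hc0, hc⟩ : ∃ c : NNReal, c ≠ 0 ∧
      (volume : Measure Plane) = c • Measure.map T (volume : Measure (ℝ × ℝ)) := by
    have hh := Measure.isAddLeftInvariant_eq_smul (volume : Measure Plane)
      (Measure.map T (volume : Measure (ℝ × ℝ)))
    refine ⟨_, fun h0 => ?_, hh⟩
    rw [h0, zero_smul] at hh
    exact (NeZero.ne (volume : Measure Plane)) hh
  refine ⟨T, c, hT, hc0, fun F => ?_⟩
  conv_lhs => rw [hc]
  rw [lintegral_smul_measure]
  have := lintegral_map_equiv (μ := (volume : Measure (ℝ × ℝ))) F T.toHomeomorph.toMeasurableEquiv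
  rw [show Measure.map T (volume : Measure (ℝ × ℝ)) =
    Measure.map T.toHomeomorph.toMeasurableEquiv volume from rfl, this]
  rfl

lemma linearIndependent_e : LinearIndependent ℝ e := by
  have hee : e = ![e 0, e 1] := by ext i; fin_cases i <;> rfl
  rw [hee, LinearIndependent.pair_iff]
  intro s t hst
  exact ⟨by simpa [e] using congrArg (fun v : Plane => v 0) hst,
    by simpa [e] using congrArg (fun v : Plane => v 1) hst⟩

/-- A function on the plane that is dominated by the integrals of `G` along all lines of two
transversal directions is square integrable. -/
lemma exists_lintegral_sq_le_of_lines {d : Fin 2 → Plane} (hd : LinearIndependent ℝ d) :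
    ∃ C : NNReal, ∀ h G : Plane → ℝ≥0∞, Measurable G →
      (∀ x i, h x ≤ ∫⁻ τ : ℝ, G (x + τ • d i)) → ∫⁻ x, h x ^ 2 ≤ C * (∫⁻ x, G x) ^ 2 := by
  obtain ⟨T, c, hT, hc0, hint⟩ := exists_linear_coords hd
  refine ⟨c⁻¹, fun h G hG hle => ?_⟩
  have hGT : Measurable fun p : ℝ × ℝ => G (T p) := hG.comp T.continuous.measurable
  have hGs : Measurable fun p : ℝ × ℝ => G (T (p.2, p.1)) := hGT.comp measurable_swap
  have h0 : ∀ a c, h (T (a, c)) ≤ ∫⁻ s, G (T (s, c)) := fun a c => by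
    refine (hle _ 0).trans (le_of_eq ?_)
    rw [← lintegral_add_left_eq_self (fun s => G (T (s, c))) a]
    refine lintegral_congr fun τ => ?_
    rw [hT, hT]
    congr 1
    module
  have h1 : ∀ a c, h (T (a, c)) ≤ ∫⁻ s, G (T (a, s)) := fun a c => by
    refine (hle _ 1).trans (le_of_eq ?_)
    rw [← lintegral_add_left_eq_self (fun s => G (T (a, s))) c]
    refine lintegral_congr fun τ => ?_
    rw [hT, hT]
    congr 1
    module
  have m0 : Measurable fun c => ∫⁻ s, G (T (s, c)) := hGs.lintegral_prod_right'
  have m1 : Measurable fun a => ∫⁻ s, G (T (a, s)) := hGT.lintegral_prod_right'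
  have key : ∫⁻ p : ℝ × ℝ, h (T p) ^ 2 ≤ (∫⁻ p : ℝ × ℝ, G (T p)) ^ 2 := by
    calc ∫⁻ p : ℝ × ℝ, h (T p) ^ 2
        ≤ ∫⁻ p : ℝ × ℝ, (∫⁻ s, G (T (p.1, s))) * ∫⁻ s, G (T (s, p.2)) := by
          refine lintegral_mono fun p => ?_
          rw [sq]
          exact mul_le_mul' (h1 p.1 p.2) (h0 p.1 p.2)
      _ = (∫⁻ a, ∫⁻ s, G (T (a, s))) * ∫⁻ c, ∫⁻ s, G (T (s, c)) :=
          lintegral_prod_mul m1.aemeasurable m0.aemeasurable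
      _ = (∫⁻ p : ℝ × ℝ, G (T p)) ^ 2 := by
          rw [sq, ← lintegral_prod _ hGT.aemeasurable, ← lintegral_prod_symm _ hGT.aemeasurable]
          rfl
  rw [hint, hint]
  have hcc : (c : ℝ≥0∞) = ((c⁻¹ : NNReal) : ℝ≥0∞) * (c : ℝ≥0∞) ^ 2 := by
    rw [ENNReal.coe_inv hc0, sq, ← mul_assoc, ENNReal.inv_mul_cancel (by simpa using hc0) (by simp),
      one_mul]
  calc (c : ℝ≥0∞) * ∫⁻ p : ℝ × ℝ, h (T p) ^ 2 ≤ c * (∫⁻ p : ℝ × ℝ, G (T p)) ^ 2 := by gcongr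
    _ = ((c⁻¹ : NNReal) : ℝ≥0∞) * (c * ∫⁻ p : ℝ × ℝ, G (T p)) ^ 2 := by
        rw [mul_pow, ← mul_assoc, ← hcc]

lemma enorm_zero_le_lintegral {F : Type*} [NormedAddCommGroup F] [NormedSpace ℝ F]
    [CompleteSpace F] {ψ ψ' : ℝ → F} (hd : ∀ t, HasDerivAt ψ (ψ' t) t)
    (hc : Continuous ψ') {ℓ : ℝ} (hℓ : 0 < ℓ) :
    ‖ψ 0‖ₑ ≤ ∫⁻ τ in Ioc 0 ℓ, (ENNReal.ofReal ℓ⁻¹ * ‖ψ τ‖ₑ + ‖ψ' τ‖ₑ) := by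
  have hψ : Continuous ψ := continuous_iff_continuousAt.2 fun t => (hd t).continuousAt
  have h1 : ∀ τ ∈ Ioc 0 ℓ, ‖ψ 0‖ₑ ≤ ‖ψ τ‖ₑ + ∫⁻ s in Ioc 0 ℓ, ‖ψ' s‖ₑ := by
    intro τ hτ
    have hftc := intervalIntegral.integral_eq_sub_of_hasDerivAt (a := 0) (b := τ)
      (fun t _ => hd t) (hc.intervalIntegrable 0 τ)
    have e1 : ψ 0 = ψ τ - ∫ s in (0 : ℝ)..τ, ψ' s := by rw [hftc]; abel
    rw [e1]
    refine (enorm_sub_le).trans ?_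
    gcongr
    rw [intervalIntegral.integral_of_le hτ.1.le]
    refine (enorm_integral_le_lintegral_enorm _).trans ?_
    exact lintegral_mono_set (Ioc_subset_Ioc_right hτ.2)
  have h2 : ∫⁻ _ in Ioc 0 ℓ, ‖ψ 0‖ₑ ≤ ∫⁻ τ in Ioc 0 ℓ, (‖ψ τ‖ₑ + ∫⁻ s in Ioc 0 ℓ, ‖ψ' s‖ₑ) :=
    setLIntegral_mono' measurableSet_Ioc h1
  rw [lintegral_add_left hψ.enorm.measurable, setLIntegral_const, setLIntegral_const,
    Real.volume_Ioc, sub_zero] at h2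
  have hℓi : ENNReal.ofReal ℓ⁻¹ * ENNReal.ofReal ℓ = 1 := by
    rw [← ENNReal.ofReal_mul (by positivity), inv_mul_cancel₀ hℓ.ne', ENNReal.ofReal_one]
  rw [lintegral_add_left (hψ.enorm.measurable.const_mul _), lintegral_const_mul _ hψ.enorm.measurable]
  calc ‖ψ 0‖ₑ = ENNReal.ofReal ℓ⁻¹ * (‖ψ 0‖ₑ * ENNReal.ofReal ℓ) := by
        rw [mul_comm ‖ψ 0‖ₑ, ← mul_assoc, hℓi, one_mul]
    _ ≤ ENNReal.ofReal ℓ⁻¹ * ((∫⁻ τ in Ioc 0 ℓ, ‖ψ τ‖ₑ) +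
          (∫⁻ s in Ioc 0 ℓ, ‖ψ' s‖ₑ) * ENNReal.ofReal ℓ) := by gcongr
    _ = _ := by
        rw [mul_add, mul_comm (∫⁻ s in Ioc 0 ℓ, ‖ψ' s‖ₑ), ← mul_assoc _ (ENNReal.ofReal ℓ), hℓi,
          one_mul]

/-- The square of a smooth function at a point is controlled by an integral along a segment. -/
lemma enorm_sq_le_lintegral_segment {φ : Plane → ℝ} (hφ : ContDiff ℝ ∞ φ) (x d : Plane) {ℓ : ℝ}
    (hℓ : 0 < ℓ) : ‖φ x‖ₑ ^ 2 ≤ ∫⁻ τ in Ioc 0 ℓ, (ENNReal.ofReal ℓ⁻¹ * ‖φ (x + τ • d)‖ₑ ^ 2 +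
      2 * ‖φ (x + τ • d)‖ₑ * ‖fderiv ℝ φ (x + τ • d) d‖ₑ) := by
  have hline : ∀ t : ℝ, HasDerivAt (fun τ : ℝ => x + τ • d) d t := fun t => by
    simpa using ((hasDerivAt_id t).smul_const d).const_add x
  have hd : ∀ t : ℝ, HasDerivAt (fun τ : ℝ => φ (x + τ • d) ^ 2)
      (2 * φ (x + t • d) * fderiv ℝ φ (x + t • d) d) t := fun t => by
    have h1 : HasDerivAt (fun τ : ℝ => φ (x + τ • d)) (fderiv ℝ φ (x + t • d) d) t :=
      (hφ.differentiable (by simp) (x + t • d)).hasFDerivAt.comp_hasDerivAt t (hline t)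
    exact (h1.fun_pow 2).congr_deriv (by simp)
  have hlc : Continuous fun τ : ℝ => x + τ • d := by fun_prop
  have hc : Continuous fun t : ℝ => 2 * φ (x + t • d) * fderiv ℝ φ (x + t • d) d :=
    (continuous_const.mul (hφ.continuous.comp hlc)).mul ((continuous_fderiv_test hφ d).comp hlc)
  have := enorm_zero_le_lintegral hd hc hℓ
  have h2 : ‖(2 : ℝ)‖ₑ = 2 := by rw [Real.enorm_of_nonneg (by norm_num), ENNReal.ofReal_ofNat]
  simpa [enorm_mul, enorm_pow, h2] using this

/-- Near each point of the closure, `Ω` contains segments in two transversal directions. -/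
lemma IsLipschitzDomain.exists_segments (hΩ : IsLipschitzDomain Ω) {x₀ : Plane}
    (hx : x₀ ∈ closure Ω) : ∃ (N : Set Plane) (ℓ : ℝ) (d : Fin 2 → Plane), IsOpen N ∧ x₀ ∈ N ∧
      0 < ℓ ∧ LinearIndependent ℝ d ∧ ∀ x ∈ N ∩ Ω, ∀ i, ∀ τ ∈ Icc 0 ℓ, x + τ • d i ∈ Ω := by
  by_cases hxΩ : x₀ ∈ Ω
  · obtain ⟨r, hr, hball⟩ := Metric.isOpen_iff.1 hΩ.isOpen x₀ hxΩ
    refine ⟨Metric.ball x₀ (r / 2), r / 4, e, Metric.isOpen_ball, Metric.mem_ball_self (by positivity),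
      by positivity, linearIndependent_e, fun x hx i τ hτ => hball ?_⟩
    have he : ‖e i‖ = 1 := by simp [e]
    rw [Metric.mem_ball, dist_eq_norm]
    have h1 := mem_ball_iff_norm.1 hx.1
    have h2 : ‖τ • e i‖ ≤ r / 4 := by
      rw [norm_smul, he, mul_one, Real.norm_eq_abs, abs_of_nonneg hτ.1]; exact hτ.2
    calc ‖x + τ • e i - x₀‖ = ‖(x - x₀) + τ • e i‖ := by congr 1; abel
      _ ≤ _ := norm_add_le _ _
      _ < r := by linarith
  · have hfr : x₀ ∈ frontier Ω := by
      rw [hΩ.isOpen.frontier_eq]; exact ⟨hx, hxΩ⟩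
    obtain ⟨R, K, f, b, hbox⟩ := hΩ.exists_graphBox hfr
    have hb := hbox.pos
    let σ : Fin 2 → ℝ := ![1, -1]
    have hσ : ∀ i, |σ i| = 1 := fun i => by fin_cases i <;> simp [σ]
    let d : Fin 2 → Plane := fun i => R.symm (σ i • e 0 + (K + 1 : ℝ) • e 1)
    have hd0 : ∀ i x (τ : ℝ), R (x + τ • d i) 0 = R x 0 + τ * σ i := fun i x τ => by simp [d, e]
    have hd1 : ∀ i x (τ : ℝ), R (x + τ • d i) 1 = R x 1 + τ * (K + 1) := fun i x τ => by simp [d, e]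
    have hℓ : 0 < b / (2 * (K + 1)) := by positivity
    refine ⟨hbox.core, b / (2 * (K + 1)), d, hbox.isOpen_core, hbox.mem_core, hℓ, ?_,
      fun x hx i τ hτ => ?_⟩
    · have hdd : d = ![d 0, d 1] := by ext i; fin_cases i <;> rfl
      rw [hdd, LinearIndependent.pair_iff]
      intro s t hst
      have h := congrArg R hst
      have h0 := congrArg (fun v : Plane => v 0) h
      have h1 := congrArg (fun v : Plane => v 1) h
      simp [d, e, σ] at h0 h1
      have hK : (0 : ℝ) < K + 1 := by positivity
      have h2 : (s + t) * (K + 1) = 0 := by linarith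
      have h3 : s + t = 0 := by
        rcases mul_eq_zero.1 h2 with h | h
        · exact h
        · exact absurd h hK.ne'
      constructor <;> linarith
    · obtain ⟨⟨hc0, hc1⟩, hxΩ'⟩ := hx
      have hpos := (hbox.mem_iff_of_mem_core ⟨hc0, hc1⟩).1 hxΩ'
      have hτℓ : τ * (2 * (K + 1)) ≤ b := (le_div_iff₀ (by positivity)).1 hτ.2
      have hKn : (0 : ℝ) ≤ K := K.2
      have hKτ : 0 ≤ (K : ℝ) * τ := mul_nonneg hKn hτ.1
      have hl : |f (R x 0 + τ * σ i) - f (R x 0)| ≤ K * τ := by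
        have := hbox.lip.dist_le_mul (R x 0 + τ * σ i) (R x 0)
        rwa [Real.dist_eq, Real.dist_eq, add_sub_cancel_left, abs_mul, hσ, mul_one,
          abs_of_nonneg hτ.1] at this
      have hl' := abs_le.1 hl
      have hc1' := abs_lt.1 hc1
      have hh : R x 1 - f (R x 0) = height R f x := rfl
      refine (hbox.mem _ ?_ ?_).2 ?_
      · rw [hd0]
        have : |R x 0 + τ * σ i - R x₀ 0| ≤ |R x 0 - R x₀ 0| + |τ * σ i| := by
          rw [show R x 0 + τ * σ i - R x₀ 0 = (R x 0 - R x₀ 0) + τ * σ i by ring]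
          exact abs_add_le _ _
        rw [abs_mul, hσ, mul_one, abs_of_nonneg hτ.1] at this
        nlinarith
      · rw [hd0, hd1, abs_le]
        have h1 : τ * (K + 1) = K * τ + τ := by ring
        have h2 : τ * (2 * (K + 1)) = 2 * (K * τ) + 2 * τ := by ring
        constructor <;> linarith [hτ.1]
      · rw [hd0, hd1]
        have : τ * (K + 1) = K * τ + τ := by ring
        linarith [hτ.1]

end Ladyzhenskaya

section LadyzhenskayaInequality

variable {Ω : Set Plane}

lemma lintegral_mul_le_of_sq {α : Type*} [MeasurableSpace α] {μ : Measure α} {a b : α → ℝ≥0∞}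
    (ha : AEMeasurable a μ) (hb : AEMeasurable b μ) {P Q : ℝ≥0∞} (hP : ∫⁻ x, a x ^ 2 ∂μ ≤ P ^ 2)
    (hQ : ∫⁻ x, b x ^ 2 ∂μ ≤ Q ^ 2) : ∫⁻ x, a x * b x ∂μ ≤ P * Q := by
  have h := ENNReal.lintegral_mul_le_Lp_mul_Lq μ Real.HolderConjugate.two_two ha hb
  have hr : ∀ {s p : ℝ≥0∞}, s ≤ p ^ 2 → s ^ (1 / 2 : ℝ) ≤ p := by
    intro s p hsp
    calc s ^ (1 / 2 : ℝ) ≤ (p ^ 2) ^ (1 / 2 : ℝ) := ENNReal.rpow_le_rpow hsp (by norm_num)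
      _ = p := by rw [← ENNReal.rpow_natCast, ← ENNReal.rpow_mul]; norm_num
  refine h.trans ?_
  simp only [ENNReal.rpow_two]
  exact mul_le_mul' (hr hP) (hr hQ)

lemma enorm_sq_L2 {F : Type*} [NormedAddCommGroup F] [InnerProductSpace ℝ F] (f : L2 Ω F) :
    ‖f‖ₑ ^ 2 = ∫⁻ x in Ω, ‖f x‖ₑ ^ 2 := by
  rw [Lp.enorm_def, eLpNorm_two_sq]

lemma lintegral_sq_moll_indicator_le (hΩ : MeasurableSet Ω) (n : ℕ) (f : L2 Ω ℝ) :
    ∫⁻ x, ‖moll n (Ω.indicator f) x‖ₑ ^ 2 ≤ ‖f‖ₑ ^ 2 := by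
  refine (lintegral_sq_moll_le n (memLp_indicator hΩ (Lp.memLp f)).1).trans (le_of_eq ?_)
  rw [enorm_sq_L2, ← lintegral_indicator hΩ]
  refine lintegral_congr fun x => ?_
  by_cases hx : x ∈ Ω <;> simp [hx]

lemma lintegral_biUnion_finset_le {α ι : Type*} [MeasurableSpace α] {μ : Measure α} (t : Finset ι)
    (s : ι → Set α) (f : α → ℝ≥0∞) :
    ∫⁻ x in ⋃ i ∈ t, s i, f x ∂μ ≤ ∑ i ∈ t, ∫⁻ x in s i, f x ∂μ := by
  rw [← Finset.sum_coe_sort, ← tsum_fintype (L := .unconditional _)]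
  have h : ⋃ i ∈ t, s i = ⋃ i : t, s i := biUnion_eq_iUnion (t : Set ι) fun i _ => s i
  rw [h]
  exact lintegral_iUnion_le (fun i : t => s i) f

lemma closedBall_subset_of_infDist {y : Plane} {r : ℝ} (hr : 0 < r)
    (h : 2 * r ≤ Metric.infDist y Ωᶜ) : Metric.closedBall y r ⊆ Ω := by
  intro w hw
  by_contra hwΩ
  have := Metric.infDist_le_dist_of_mem (x := y) (show w ∈ Ωᶜ from hwΩ)
  rw [Metric.mem_closedBall, dist_comm] at hw
  linarith

lemma exists_ladyzhenskaya_local (hΩ : IsOpen Ω) (hne : (Ωᶜ).Nonempty) {N : Set Plane}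
    (hN : IsOpen N) {ℓ : ℝ} (hℓ : 0 < ℓ) {d : Fin 2 → Plane} (hd : LinearIndependent ℝ d)
    (hseg : ∀ x ∈ N ∩ Ω, ∀ i, ∀ τ ∈ Icc 0 ℓ, x + τ • d i ∈ Ω) :
    ∃ C : NNReal, ∀ (f : L2 Ω ℝ) (g : Fin 2 → L2 Ω ℝ), (∀ j, HasWeakPartial Ω j f (g j)) →
      ∫⁻ x in N ∩ Ω, ‖f x‖ₑ ^ 4 ≤ C * (‖f‖ₑ * (‖f‖ₑ + ‖g 0‖ₑ + ‖g 1‖ₑ)) ^ 2 := by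
  obtain ⟨C, hC⟩ := exists_lintegral_sq_le_of_lines hd
  have hm := hΩ.measurableSet
  let D : NNReal := ‖d 0‖₊ + ‖d 1‖₊
  have hD : ∀ i j, ‖d i j‖ₑ ≤ D := fun i j => by
    have h1 : ‖d i j‖₊ ≤ ‖d i‖₊ := PiLp.nnnorm_apply_le (d i) j
    have h2 : ‖d i‖₊ ≤ D := by
      fin_cases i
      · exact le_self_add
      · exact le_add_self
    exact_mod_cast h1.trans h2
  let A : NNReal := ℓ⁻¹.toNNReal + 2 * D
  refine ⟨C * A ^ 2, fun f g hfg => ?_⟩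
  let fn : ℕ → Plane → ℝ := fun n => moll n (Ω.indicator f)
  let gn : Fin 2 → ℕ → Plane → ℝ := fun j n => moll n (Ω.indicator (g j))
  have hloc : ∀ f : L2 Ω ℝ, LocallyIntegrable (Ω.indicator f) :=
    fun f => (memLp_indicator hm (Lp.memLp f)).locallyIntegrable (by norm_num)
  have hfn : ∀ n, ContDiff ℝ ∞ (fn n) := fun n => contDiff_moll n (hloc f)
  have hgn : ∀ j n, ContDiff ℝ ∞ (gn j n) := fun j n => contDiff_moll n (hloc (g j))
  let G : ℕ → Plane → ℝ≥0∞ := fun n y =>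
    A * (‖fn n y‖ₑ * ‖fn n y‖ₑ + ‖fn n y‖ₑ * ‖gn 0 n y‖ₑ + ‖fn n y‖ₑ * ‖gn 1 n y‖ₑ)
  have mf : ∀ n, Measurable fun y => ‖fn n y‖ₑ := fun n => (hfn n).continuous.enorm.measurable
  have mg : ∀ j n, Measurable fun y => ‖gn j n y‖ₑ := fun j n => (hgn j n).continuous.enorm.measurable
  have hG : ∀ n, Measurable (G n) := fun n =>
    ((((mf n).mul (mf n)).add ((mf n).mul (mg 0 n))).add ((mf n).mul (mg 1 n))).const_mul _
  have hGint : ∀ n, ∫⁻ y, G n y ≤ A * (‖f‖ₑ * (‖f‖ₑ + ‖g 0‖ₑ + ‖g 1‖ₑ)) := fun n => by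
    simp only [G]
    have m0 : Measurable fun y => ‖fn n y‖ₑ * ‖fn n y‖ₑ := (mf n).mul (mf n)
    have m1 : Measurable fun y => ‖fn n y‖ₑ * ‖gn 0 n y‖ₑ := (mf n).mul (mg 0 n)
    have m2 : Measurable fun y => ‖fn n y‖ₑ * ‖gn 1 n y‖ₑ := (mf n).mul (mg 1 n)
    have m3 : Measurable fun y => ‖fn n y‖ₑ * ‖fn n y‖ₑ + ‖fn n y‖ₑ * ‖gn 0 n y‖ₑ := m0.add m1
    have m4 : Measurable fun y => ‖fn n y‖ₑ * ‖fn n y‖ₑ + ‖fn n y‖ₑ * ‖gn 0 n y‖ₑ +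
      ‖fn n y‖ₑ * ‖gn 1 n y‖ₑ := m3.add m2
    rw [lintegral_const_mul _ m4, lintegral_add_left m3, lintegral_add_left m0, mul_add ‖f‖ₑ,
      mul_add ‖f‖ₑ]
    have b := lintegral_sq_moll_indicator_le hm n f
    gcongr
    · exact lintegral_mul_le_of_sq (mf n).aemeasurable (mf n).aemeasurable b b
    · exact lintegral_mul_le_of_sq (mf n).aemeasurable (mg 0 n).aemeasurable b
        (lintegral_sq_moll_indicator_le hm n (g 0))
    · exact lintegral_mul_le_of_sq (mf n).aemeasurable (mg 1 n).aemeasurable b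
        (lintegral_sq_moll_indicator_le hm n (g 1))
  let s : ℕ → Set Plane := fun n =>
    {x | ∀ i, ∀ τ ∈ Icc 0 ℓ, 2 * mollRad n ≤ Metric.infDist (x + τ • d i) Ωᶜ}
  have hcont : ∀ i (τ : ℝ), Continuous fun x => Metric.infDist (x + τ • d i) Ωᶜ := fun i τ =>
    (Metric.continuous_infDist_pt _).comp (continuous_id.add continuous_const)
  have hs : ∀ n, MeasurableSet (s n) := fun n => by
    refine IsClosed.measurableSet ?_
    simp only [s, Set.ofPred_forall]
    exact isClosed_iInter fun i => isClosed_iInter fun τ => isClosed_iInter fun _ =>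
      isClosed_le continuous_const (hcont i τ)
  let h : ℕ → Plane → ℝ≥0∞ := fun n => (s n).indicator fun x => ‖fn n x‖ₑ ^ 2
  have hh : ∀ n, Measurable (h n) := fun n => ((mf n).pow_const 2).indicator (hs n)
  have hline : ∀ n x i, h n x ≤ ∫⁻ τ : ℝ, G n (x + τ • d i) := by
    intro n x i
    by_cases hx : x ∈ s n
    · simp only [h, indicator_of_mem hx]
      refine (enorm_sq_le_lintegral_segment (hfn n) x (d i) hℓ).trans ?_
      refine le_trans (setLIntegral_mono' measurableSet_Ioc fun τ hτ => ?_) (setLIntegral_le_lintegral _ _)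
      have hb := closedBall_subset_of_infDist (mollRad_pos n) (hx i τ ⟨hτ.1.le, hτ.2⟩)
      rw [fderiv_apply_plane, Fin.sum_univ_two,
        fderiv_moll_of_hasWeakPartial hm (Lp.memLp f) (hfg 0) hb,
        fderiv_moll_of_hasWeakPartial hm (Lp.memLp f) (hfg 1) hb]
      change _ ≤ A * (‖fn n (x + τ • d i)‖ₑ * ‖fn n (x + τ • d i)‖ₑ +
        ‖fn n (x + τ • d i)‖ₑ * ‖gn 0 n (x + τ • d i)‖ₑ +
        ‖fn n (x + τ • d i)‖ₑ * ‖gn 1 n (x + τ • d i)‖ₑ)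
      set F := ‖fn n (x + τ • d i)‖ₑ
      change _ + 2 * F * ‖gn 0 n (x + τ • d i) * _ + gn 1 n (x + τ • d i) * _‖ₑ ≤ _
      set g0 := gn 0 n (x + τ • d i)
      set g1 := gn 1 n (x + τ • d i)
      have e1 : ‖g0 * d i 0 + g1 * d i 1‖ₑ ≤ (‖g0‖ₑ + ‖g1‖ₑ) * D := by
        refine (enorm_add_le _ _).trans ?_
        rw [enorm_mul, enorm_mul, add_mul]
        exact add_le_add (mul_le_mul' le_rfl (hD i 0)) (mul_le_mul' le_rfl (hD i 1))
      have hA : (A : ℝ≥0∞) = ENNReal.ofReal ℓ⁻¹ + 2 * D := by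
        simp only [A]; push_cast; rfl
      calc ENNReal.ofReal ℓ⁻¹ * F ^ 2 + 2 * F * ‖g0 * d i 0 + g1 * d i 1‖ₑ
          ≤ A * F ^ 2 + 2 * F * ((‖g0‖ₑ + ‖g1‖ₑ) * D) := by
            gcongr
            rw [hA]; exact le_self_add
        _ = A * F ^ 2 + (2 * D) * (F * ‖g0‖ₑ + F * ‖g1‖ₑ) := by ring
        _ ≤ A * F ^ 2 + A * (F * ‖g0‖ₑ + F * ‖g1‖ₑ) := by
            gcongr
            rw [hA]; exact le_add_self
        _ = A * (F * F + F * ‖g0‖ₑ + F * ‖g1‖ₑ) := by ring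
    · simp [h, hx]
  have hbound : ∀ n, ∫⁻ x in N ∩ Ω, h n x ^ 2 ≤
      (C * A ^ 2 : NNReal) * (‖f‖ₑ * (‖f‖ₑ + ‖g 0‖ₑ + ‖g 1‖ₑ)) ^ 2 := fun n => by
    refine (setLIntegral_le_lintegral _ _).trans ((hC (h n) (G n) (hG n) (hline n)).trans ?_)
    calc (C : ℝ≥0∞) * (∫⁻ y, G n y) ^ 2
        ≤ C * (A * (‖f‖ₑ * (‖f‖ₑ + ‖g 0‖ₑ + ‖g 1‖ₑ))) ^ 2 := by gcongr; exact hGint n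
      _ = _ := by push_cast; ring
  have hlim : ∀ᵐ x ∂(volume : Measure Plane).restrict (N ∩ Ω),
      Tendsto (fun n => h n x ^ 2) atTop (𝓝 (‖f x‖ₑ ^ 4)) := by
    filter_upwards [ae_restrict_of_ae (ae_tendsto_moll (hloc f)),
      ae_restrict_mem (hN.measurableSet.inter hm)] with x hx hxN
    rw [indicator_of_mem hxN.2] at hx
    have hev : ∀ᶠ n in atTop, x ∈ s n := by
      have hi : ∀ i, ∃ δ > 0, ∀ τ ∈ Icc 0 ℓ, δ ≤ Metric.infDist (x + τ • d i) Ωᶜ := by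
        intro i
        have hc : Continuous fun τ : ℝ => Metric.infDist (x + τ • d i) Ωᶜ :=
          (Metric.continuous_infDist_pt _).comp (by fun_prop)
        obtain ⟨τ₀, hτ₀, hmin⟩ := isCompact_Icc.exists_isMinOn (nonempty_Icc.2 hℓ.le) hc.continuousOn
        refine ⟨_, ?_, hmin⟩
        refine (hΩ.isClosed_compl.notMem_iff_infDist_pos hne).1 ?_
        simpa using hseg x hxN i τ₀ hτ₀
      choose δ hδ hδ' using hi
      have ht : Tendsto (fun n => 2 * mollRad n) atTop (𝓝 0) := by
        simpa using tendsto_mollRad.const_mul 2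
      filter_upwards [ht.eventually (gt_mem_nhds (hδ 0)), ht.eventually (gt_mem_nhds (hδ 1))]
        with n h0 h1 i τ hτ
      fin_cases i
      · exact h0.le.trans (hδ' 0 τ hτ)
      · exact h1.le.trans (hδ' 1 τ hτ)
    have ht : Tendsto (fun n => (‖fn n x‖ₑ ^ 2) ^ 2) atTop (𝓝 ((‖f x‖ₑ ^ 2) ^ 2)) := by
      have := hx.enorm
      exact ((ENNReal.continuous_pow 2).tendsto _).comp (((ENNReal.continuous_pow 2).tendsto _).comp this)
    rw [← pow_mul] at ht
    refine ht.congr' ?_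
    filter_upwards [hev] with n hn
    simp only [h, indicator_of_mem hn]
  calc ∫⁻ x in N ∩ Ω, ‖f x‖ₑ ^ 4 = ∫⁻ x in N ∩ Ω, liminf (fun n => h n x ^ 2) atTop := by
        refine lintegral_congr_ae ?_
        filter_upwards [hlim] with x hx
        exact hx.liminf_eq.symm
    _ ≤ liminf (fun n => ∫⁻ x in N ∩ Ω, h n x ^ 2) atTop :=
        lintegral_liminf_le fun n => (hh n).pow_const 2
    _ ≤ liminf (fun _ : ℕ => ((C * A ^ 2 : NNReal) : ℝ≥0∞) *
          (‖f‖ₑ * (‖f‖ₑ + ‖g 0‖ₑ + ‖g 1‖ₑ)) ^ 2) atTop :=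
        liminf_le_liminf (Eventually.of_forall hbound)
    _ = _ := liminf_const _

/-- Ladyzhenskaya's inequality on a bounded Lipschitz domain. -/
theorem IsLipschitzDomain.exists_ladyzhenskaya (hΩ : IsLipschitzDomain Ω) :
    ∃ C : NNReal, ∀ (f : L2 Ω ℝ) (g : Fin 2 → L2 Ω ℝ), (∀ j, HasWeakPartial Ω j f (g j)) →
      ∫⁻ x in Ω, ‖f x‖ₑ ^ 4 ≤ C * (‖f‖ₑ * (‖f‖ₑ + ‖g 0‖ₑ + ‖g 1‖ₑ)) ^ 2 := by
  have hne : (Ωᶜ).Nonempty := by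
    by_contra h
    rw [not_nonempty_iff_eq_empty, compl_empty_iff] at h
    exact NormedSpace.unbounded_univ ℝ Plane (h ▸ hΩ.isBounded)
  have hloc : ∀ x : closure Ω, ∃ N : Set Plane, IsOpen N ∧ (x : Plane) ∈ N ∧ ∃ C : NNReal,
      ∀ (f : L2 Ω ℝ) (g : Fin 2 → L2 Ω ℝ), (∀ j, HasWeakPartial Ω j f (g j)) →
        ∫⁻ y in N ∩ Ω, ‖f y‖ₑ ^ 4 ≤ C * (‖f‖ₑ * (‖f‖ₑ + ‖g 0‖ₑ + ‖g 1‖ₑ)) ^ 2 := fun x => by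
    obtain ⟨N, ℓ, d, hN, hxN, hℓ, hd, hseg⟩ := hΩ.exists_segments x.2
    exact ⟨N, hN, hxN, exists_ladyzhenskaya_local hΩ.isOpen hne hN hℓ hd hseg⟩
  choose N hN hxN C hC using hloc
  obtain ⟨t, ht⟩ := hΩ.isBounded.isCompact_closure.elim_finite_subcover N hN
    fun x hx => mem_iUnion.2 ⟨⟨x, hx⟩, hxN ⟨x, hx⟩⟩
  refine ⟨∑ x ∈ t, C x, fun f g hfg => ?_⟩
  have hsub : Ω ⊆ ⋃ x ∈ t, N x ∩ Ω := fun y hy => by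
    obtain ⟨x, hx, hy'⟩ := mem_iUnion₂.1 (ht (subset_closure hy))
    exact mem_iUnion₂.2 ⟨x, hx, hy', hy⟩
  calc ∫⁻ x in Ω, ‖f x‖ₑ ^ 4 ≤ ∫⁻ y in ⋃ x ∈ t, N x ∩ Ω, ‖f y‖ₑ ^ 4 := lintegral_mono_set hsub
    _ ≤ ∑ x ∈ t, ∫⁻ y in N x ∩ Ω, ‖f y‖ₑ ^ 4 := lintegral_biUnion_finset_le _ _ _
    _ ≤ ∑ x ∈ t, C x * (‖f‖ₑ * (‖f‖ₑ + ‖g 0‖ₑ + ‖g 1‖ₑ)) ^ 2 :=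
        Finset.sum_le_sum fun x _ => hC x f g hfg
    _ = _ := by rw [← Finset.sum_mul]; push_cast; rfl

end LadyzhenskayaInequality

/-! ### The trace inequality -/

section TraceInequality

variable {Ω : Set Plane} {F : Type*} [NormedAddCommGroup F] [InnerProductSpace ℝ F]

lemma sq_add_add_le {M k a b c : ℝ≥0∞} (hk : k ≤ M) (h1 : 1 ≤ M) :
    (k * a + (b + c)) ^ 2 ≤ 9 * M ^ 2 * (a ^ 2 + (b ^ 2 + c ^ 2)) := by
  have key : ∀ {m : ℝ≥0∞}, a ≤ m → b ≤ m → c ≤ m → (k * a + (b + c)) ^ 2 ≤ 9 * M ^ 2 * m ^ 2 := by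
    intro m ha hb hc
    calc (k * a + (b + c)) ^ 2 ≤ (M * m + (1 * m + 1 * m)) ^ 2 := by
          rw [one_mul]; gcongr
      _ ≤ (M * m + (M * m + M * m)) ^ 2 := by gcongr
      _ = 9 * M ^ 2 * m ^ 2 := by ring
  have hm : max a (max b c) ^ 2 ≤ a ^ 2 + (b ^ 2 + c ^ 2) := by
    rcases max_choice a (max b c) with h | h
    · rw [h]; exact le_self_add
    · rw [h]
      rcases max_choice b c with h | h
      · rw [h]; exact le_self_add.trans le_add_self
      · rw [h]; exact le_add_self.trans le_add_self
  refine (key (le_max_left _ _) ((le_max_left _ _).trans (le_max_right _ _))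
    ((le_max_right _ _).trans (le_max_right _ _))).trans ?_
  gcongr

lemma enorm_fderiv_apply_le {φ : Plane → F} (x : Plane) {d : Plane} (hd : ‖d‖ ≤ 1) :
    ‖fderiv ℝ φ x d‖ₑ ≤ ‖fderiv ℝ φ x (e 0)‖ₑ + ‖fderiv ℝ φ x (e 1)‖ₑ := by
  have hj : ∀ j, ‖d j‖ₑ ≤ 1 := fun j => by
    have : ‖d j‖₊ ≤ 1 := ((abs_coord_le d j).trans hd)
    rw [enorm_eq_nnnorm]
    exact_mod_cast this
  conv_lhs => rw [plane_eq_sum d]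
  rw [Fin.sum_univ_two, map_add, map_smul, map_smul]
  refine (enorm_add_le _ _).trans ?_
  rw [enorm_smul, enorm_smul]
  exact add_le_add (mul_le_of_le_one_left' (hj 0)) (mul_le_of_le_one_left' (hj 1))

/-- The sum of the squares of a function and of its derivatives. -/
noncomputable def energy (φ : Plane → F) (x : Plane) : ℝ≥0∞ :=
  ‖φ x‖ₑ ^ 2 + (‖fderiv ℝ φ x (e 0)‖ₑ ^ 2 + ‖fderiv ℝ φ x (e 1)‖ₑ ^ 2)

lemma continuous_fderiv_apply {φ : Plane → F} (hφ : ContDiff ℝ ∞ φ) (v : Plane) :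
    Continuous fun x => fderiv ℝ φ x v :=
  (hφ.continuous_fderiv (by simp)).clm_apply continuous_const

lemma measurable_energy {φ : Plane → F} (hφ : ContDiff ℝ ∞ φ) : Measurable (energy φ) :=
  (hφ.continuous.enorm.measurable.pow_const 2).add
    (((continuous_fderiv_apply hφ _).enorm.measurable.pow_const 2).add
      ((continuous_fderiv_apply hφ _).enorm.measurable.pow_const 2))

lemma enorm_sq_le_lintegral_energy [CompleteSpace F] {φ : Plane → F} (hφ : ContDiff ℝ ∞ φ)
    (x : Plane) {d : Plane} (hd : ‖d‖ ≤ 1) {ℓ : ℝ} (hℓ : 0 < ℓ) :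
    ‖φ x‖ₑ ^ 2 ≤ ENNReal.ofReal ℓ * (9 * (ENNReal.ofReal ℓ⁻¹ + 1) ^ 2) *
      ∫⁻ τ in Ioc 0 ℓ, energy φ (x + τ • d) := by
  have hline : ∀ t : ℝ, HasDerivAt (fun τ : ℝ => x + τ • d) d t := fun t => by
    simpa using ((hasDerivAt_id t).smul_const d).const_add x
  have hdd : ∀ t : ℝ, HasDerivAt (fun τ : ℝ => φ (x + τ • d)) (fderiv ℝ φ (x + t • d) d) t :=
    fun t => (hφ.differentiable (by simp) (x + t • d)).hasFDerivAt.comp_hasDerivAt t (hline t)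
  have hlc : Continuous fun τ : ℝ => x + τ • d := by fun_prop
  have hc : Continuous fun t : ℝ => fderiv ℝ φ (x + t • d) d :=
    (continuous_fderiv_apply hφ d).comp hlc
  have h := enorm_zero_le_lintegral hdd hc hℓ
  simp only [zero_smul, add_zero] at h
  have m1 : Measurable fun τ : ℝ => ENNReal.ofReal ℓ⁻¹ * ‖φ (x + τ • d)‖ₑ +
      ‖fderiv ℝ φ (x + τ • d) d‖ₑ :=
    ((hφ.continuous.comp hlc).enorm.measurable.const_mul _).add hc.enorm.measurable
  have hcs := sq_lintegral_mul_le (μ := (volume : Measure ℝ).restrict (Ioc 0 ℓ)) (k := fun _ => 1)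
    aemeasurable_const m1.aemeasurable
  simp only [one_mul, lintegral_const, Measure.restrict_apply MeasurableSet.univ, univ_inter,
    Real.volume_Ioc, sub_zero] at hcs
  calc ‖φ x‖ₑ ^ 2 ≤ _ := pow_le_pow_left' h 2
    _ ≤ _ := hcs
    _ ≤ ENNReal.ofReal ℓ * ∫⁻ τ in Ioc 0 ℓ,
          9 * (ENNReal.ofReal ℓ⁻¹ + 1) ^ 2 * energy φ (x + τ • d) := by
        gcongr with τ
        refine le_trans ?_ (sq_add_add_le le_self_add le_add_self)
        gcongr
        exact enorm_fderiv_apply_le _ hd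
    _ = _ := by
        have hm : Measurable fun τ : ℝ => energy φ (x + τ • d) :=
          (measurable_energy hφ).comp hlc.measurable
        rw [lintegral_const_mul _ hm]; ring

variable {x₀ : Plane} {R : Plane ≃ₗᵢ[ℝ] Plane} {K : NNReal} {f : ℝ → ℝ} {b : ℝ}

/-- The boundary as a curve. -/
noncomputable def graphCurve (R : Plane ≃ₗᵢ[ℝ] Plane) (f : ℝ → ℝ) (s : ℝ) : Plane :=
  s • R.symm (e 0) + f s • R.symm (e 1)

lemma GraphBox.lipschitzWith_graphCurve (h : GraphBox Ω x₀ R K f b) :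
    LipschitzWith (1 + K) (graphCurve R f) := by
  refine LipschitzWith.of_dist_le_mul fun s t => ?_
  have he : ∀ j : Fin 2, ‖R.symm (e j)‖ = 1 := fun j => by simp [e]
  have hl := h.lip.dist_le_mul s t
  rw [Real.dist_eq, Real.dist_eq] at hl
  rw [dist_eq_norm, Real.dist_eq, NNReal.coe_add, NNReal.coe_one]
  have : graphCurve R f s - graphCurve R f t =
      (s - t) • R.symm (e 0) + (f s - f t) • R.symm (e 1) := by unfold graphCurve; module
  rw [this]
  refine (norm_add_le _ _).trans ?_
  rw [norm_smul, norm_smul, he, he, Real.norm_eq_abs, Real.norm_eq_abs]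
  linarith

lemma coord_graph (R : Plane ≃ₗᵢ[ℝ] Plane) (s t : ℝ) :
    R (s • R.symm (e 0) + t • R.symm (e 1)) 0 = s ∧
      R (s • R.symm (e 0) + t • R.symm (e 1)) 1 = t := by
  constructor <;> simp [e]

lemma GraphBox.height_eq_zero (h : GraphBox Ω x₀ R K f b) (ho : IsOpen Ω) {y : Plane}
    (hy : y ∈ frontier Ω) (hc : y ∈ h.core) : height R f y = 0 := by
  have hyΩ : y ∉ Ω := fun hh => by rw [ho.frontier_eq] at hy; exact hy.2 hh
  refine le_antisymm (not_lt.1 fun hh => hyΩ ((h.mem_iff_of_mem_core hc).2 hh)) ?_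
  have hcl : y ∈ closure (h.core ∩ Ω) :=
    h.isOpen_core.inter_closure ⟨hc, frontier_subset_closure hy⟩
  exact closure_minimal (fun w hw => ((h.mem_iff_of_mem_core hw.1).1 hw.2).le)
    (isClosed_le continuous_const h.lipschitzWith_height.continuous) hcl

lemma GraphBox.eq_graphCurve (h : GraphBox Ω x₀ R K f b) (ho : IsOpen Ω) {y : Plane}
    (hy : y ∈ frontier Ω) (hc : y ∈ h.core) : graphCurve R f (R y 0) = y := by
  have h0 := h.height_eq_zero ho hy hc
  rw [height, sub_eq_zero] at h0
  refine R.injective ?_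
  ext i
  fin_cases i
  · exact (coord_graph R _ _).1
  · exact (coord_graph R _ _).2.trans h0.symm

lemma GraphBox.restrict_le (h : GraphBox Ω x₀ R K f b) (ho : IsOpen Ω) :
    (bdry Ω).restrict h.core ≤ ((1 + K : NNReal) : ℝ≥0∞) • Measure.map (graphCurve R f)
      ((volume : Measure ℝ).restrict (Icc (R x₀ 0 - b) (R x₀ 0 + b))) := by
  have hl := h.lipschitzWith_graphCurve
  refine Measure.le_iff.2 fun E hE => ?_
  rw [Measure.restrict_apply hE, Measure.restrict_apply (hE.inter h.isOpen_core.measurableSet),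
    Measure.smul_apply, smul_eq_mul, Measure.map_apply hl.continuous.measurable hE,
    Measure.restrict_apply (hl.continuous.measurable hE)]
  have hsub : E ∩ h.core ∩ frontier Ω ⊆ graphCurve R f ''
      (graphCurve R f ⁻¹' E ∩ Icc (R x₀ 0 - b) (R x₀ 0 + b)) := by
    rintro y ⟨⟨hyE, hyc⟩, hyf⟩
    have hy := h.eq_graphCurve ho hyf hyc
    refine ⟨R y 0, ⟨?_, ?_⟩, hy⟩
    · rw [mem_preimage, hy]; exact hyE
    · have := abs_lt.1 hyc.1
      have := h.pos
      constructor <;> linarith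
  refine (measure_mono hsub).trans ?_
  refine (hl.hausdorffMeasure_image_le zero_le_one _).trans (le_of_eq ?_)
  rw [hausdorffMeasure_real, ENNReal.rpow_one]

lemma GraphBox.exists_trace_bound [CompleteSpace F] (h : GraphBox Ω x₀ R K f b) (ho : IsOpen Ω) :
    ∃ C : NNReal, ∀ φ : Plane → F, ContDiff ℝ ∞ φ →
      ∫⁻ x in h.core, ‖φ x‖ₑ ^ 2 ∂bdry Ω ≤ C * ∫⁻ x in Ω, energy φ x := by
  have hb := h.pos
  have hlin : LinearIndependent ℝ (fun j => R.symm (e j)) :=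
    linearIndependent_e.map' R.symm.toLinearEquiv.toLinearMap (LinearEquiv.ker _)
  obtain ⟨T, c, hT, hc0, hint⟩ := exists_linear_coords hlin
  have hl := h.lipschitzWith_graphCurve
  have hdn : ‖R.symm (e 1)‖ ≤ 1 := by simp [e]
  let A : NNReal := b.toNNReal * (9 * (b⁻¹.toNNReal + 1) ^ 2)
  refine ⟨(1 + K) * (A * c⁻¹), fun φ hφ => ?_⟩
  have hme := (measurable_energy hφ).indicator ho.measurableSet
  have hmT : Measurable fun p : ℝ × ℝ => Ω.indicator (energy φ) (T p) :=
    hme.comp T.continuous.measurable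
  have hstep : ∀ s ∈ Icc (R x₀ 0 - b) (R x₀ 0 + b), ‖φ (graphCurve R f s)‖ₑ ^ 2 ≤
      A * ∫⁻ t, Ω.indicator (energy φ) (T (s, t)) := by
    intro s hs
    refine (enorm_sq_le_lintegral_energy hφ (graphCurve R f s) hdn hb).trans ?_
    have hA : (A : ℝ≥0∞) = ENNReal.ofReal b * (9 * (ENNReal.ofReal b⁻¹ + 1) ^ 2) := by
      simp only [A]; push_cast; rfl
    rw [← hA]
    refine mul_le_mul' le_rfl ?_
    rw [← lintegral_add_left_eq_self (fun t => Ω.indicator (energy φ) (T (s, t))) (f s)]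
    refine le_trans (setLIntegral_mono' measurableSet_Ioc fun τ hτ => ?_)
      (setLIntegral_le_lintegral (Ioc 0 b) _)
    have hp : graphCurve R f s + τ • R.symm (e 1) = T (s, f s + τ) := by
      rw [hT]; unfold graphCurve; module
    rw [hp, indicator_of_mem]
    rw [hT]
    have h0 := (coord_graph R s (f s + τ)).1
    have h1 := (coord_graph R s (f s + τ)).2
    refine (h.mem _ ?_ ?_).2 ?_
    · rw [h0, abs_le]; constructor <;> linarith [hs.1, hs.2]
    · rw [h0, h1, add_sub_cancel_left, abs_of_pos hτ.1]; linarith [hτ.2]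
    · rw [h0, h1]; linarith [hτ.1]
  calc ∫⁻ x in h.core, ‖φ x‖ₑ ^ 2 ∂bdry Ω
      ≤ ∫⁻ x, ‖φ x‖ₑ ^ 2 ∂(((1 + K : NNReal) : ℝ≥0∞) • Measure.map (graphCurve R f)
        ((volume : Measure ℝ).restrict (Icc (R x₀ 0 - b) (R x₀ 0 + b)))) :=
        lintegral_mono' (h.restrict_le ho) le_rfl
    _ = (1 + K : NNReal) * ∫⁻ s in Icc (R x₀ 0 - b) (R x₀ 0 + b), ‖φ (graphCurve R f s)‖ₑ ^ 2 := by
        rw [lintegral_smul_measure, lintegral_map (hφ.continuous.enorm.measurable.pow_const 2)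
          hl.continuous.measurable, smul_eq_mul]
    _ ≤ (1 + K : NNReal) * ∫⁻ s, A * ∫⁻ t, Ω.indicator (energy φ) (T (s, t)) := by
        exact mul_le_mul' le_rfl
          ((setLIntegral_mono' measurableSet_Icc hstep).trans (setLIntegral_le_lintegral _ _))
    _ = (1 + K : NNReal) * (A * ∫⁻ p : ℝ × ℝ, Ω.indicator (energy φ) (T p)) := by
        rw [lintegral_const_mul _ hmT.lintegral_prod_right', ← lintegral_prod _ hmT.aemeasurable]
        rfl
    _ = ((1 + K) * (A * c⁻¹) : NNReal) * ∫⁻ x in Ω, energy φ x := by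
        rw [← lintegral_indicator ho.measurableSet, hint]
        push_cast [ENNReal.coe_inv hc0]
        have hcc : (c : ℝ≥0∞)⁻¹ * c = 1 := ENNReal.inv_mul_cancel (by simpa using hc0) (by simp)
        calc _ = (1 + (K : ℝ≥0∞)) * (A * (1 * ∫⁻ p : ℝ × ℝ, Ω.indicator (energy φ) (T p))) := by
              rw [one_mul]
          _ = _ := by rw [← hcc]; ring

/-- The trace inequality for smooth functions. -/
theorem IsLipschitzDomain.exists_trace_bound [CompleteSpace F] (hΩ : IsLipschitzDomain Ω) :
    ∃ C : NNReal, ∀ φ : Plane → F, ContDiff ℝ ∞ φ →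
      ∫⁻ x, ‖φ x‖ₑ ^ 2 ∂bdry Ω ≤ C * ∫⁻ x in Ω, energy φ x := by
  have hloc : ∀ x : frontier Ω, ∃ N : Set Plane, IsOpen N ∧ (x : Plane) ∈ N ∧ ∃ C : NNReal,
      ∀ φ : Plane → F, ContDiff ℝ ∞ φ →
        ∫⁻ y in N, ‖φ y‖ₑ ^ 2 ∂bdry Ω ≤ C * ∫⁻ y in Ω, energy φ y := fun x => by
    obtain ⟨R, K, f, b, h⟩ := hΩ.exists_graphBox x.2
    exact ⟨h.core, h.isOpen_core, h.mem_core, h.exists_trace_bound hΩ.isOpen⟩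
  choose N hN hxN C hC using hloc
  obtain ⟨t, ht⟩ := (isCompact_frontier hΩ.isBounded).elim_finite_subcover N hN
    fun x hx => mem_iUnion.2 ⟨⟨x, hx⟩, hxN ⟨x, hx⟩⟩
  refine ⟨∑ x ∈ t, C x, fun φ hφ => ?_⟩
  have hr : bdry Ω = (bdry Ω).restrict (⋃ x ∈ t, N x) := by
    rw [Measure.restrict_restrict (Finset.measurableSet_biUnion t fun x _ => (hN x).measurableSet),
      inter_eq_self_of_subset_right ht]
  calc ∫⁻ x, ‖φ x‖ₑ ^ 2 ∂bdry Ω = ∫⁻ y in ⋃ x ∈ t, N x, ‖φ y‖ₑ ^ 2 ∂bdry Ω := by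
        conv_lhs => rw [hr]
    _ ≤ ∑ x ∈ t, ∫⁻ y in N x, ‖φ y‖ₑ ^ 2 ∂bdry Ω := lintegral_biUnion_finset_le _ _ _
    _ ≤ ∑ x ∈ t, C x * ∫⁻ y in Ω, energy φ y := Finset.sum_le_sum fun x _ => hC x φ hφ
    _ = _ := by rw [← Finset.sum_mul]; push_cast; rfl

end TraceInequality

/-! ### `V¹` is complete -/

section Complete

set_option linter.unusedSectionVars false

variable {Ω : Set Plane} {F : Type*} [NormedAddCommGroup F] [InnerProductSpace ℝ F]

lemma tendsto_lintegral_sq_of_tendstoL2 {μ : Measure Plane} {φ : ℕ → Plane → F} {g : Lp F 2 μ}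
    (hφ : ∀ m, AEStronglyMeasurable (φ m) μ) (h : TendstoL2 φ g) :
    Tendsto (fun m => ∫⁻ x, ‖φ m x‖ₑ ^ 2 ∂μ) atTop (𝓝 (‖g‖ₑ ^ 2)) := by
  simp_rw [← eLpNorm_two_sq]
  refine ((ENNReal.continuous_pow 2).tendsto _).comp ?_
  have hg : ‖g‖ₑ ≠ ⊤ := enorm_ne_top
  refine tendsto_of_tendsto_of_tendsto_of_le_of_le
    (g := fun m => ‖g‖ₑ - eLpNorm (fun x => φ m x - g x) 2 μ)
    (h := fun m => ‖g‖ₑ + eLpNorm (fun x => φ m x - g x) 2 μ) ?_ ?_ ?_ ?_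
  · simpa using ENNReal.Tendsto.sub tendsto_const_nhds h (Or.inl hg)
  · simpa using Tendsto.add tendsto_const_nhds h
  · intro m
    rw [tsub_le_iff_right, Lp.enorm_def]
    have := eLpNorm_sub_le (p := 2) (hφ m) ((hφ m).sub (Lp.aestronglyMeasurable g)) (by norm_num)
    rw [sub_sub_cancel] at this
    exact this
  · intro m
    rw [Lp.enorm_def]
    have := eLpNorm_add_le (p := 2) (Lp.aestronglyMeasurable g)
      ((hφ m).sub (Lp.aestronglyMeasurable g)) (by norm_num)
    rw [add_sub_cancel] at this
    exact this

lemma jet_enorm_sq (z : Jet Ω F) : ‖z‖ₑ ^ 2 = ‖z.fst‖ₑ ^ 2 + (‖z.snd 0‖ₑ ^ 2 + ‖z.snd 1‖ₑ ^ 2) := by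
  have h := jet_norm_sq z
  rw [Fin.sum_univ_two] at h
  simp_rw [enorm_eq_nnnorm]
  have h' : ‖z‖₊ ^ 2 = ‖z.fst‖₊ ^ 2 + (‖z.snd 0‖₊ ^ 2 + ‖z.snd 1‖₊ ^ 2) := by
    ext; push_cast; exact h
  exact_mod_cast h'

/-- The trace inequality. -/
lemma HasTrace.enorm_sq_le {C : NNReal} (hC : ∀ φ : Plane → F, ContDiff ℝ ∞ φ →
    ∫⁻ x, ‖φ x‖ₑ ^ 2 ∂bdry Ω ≤ C * ∫⁻ x in Ω, energy φ x) {z : Jet Ω F} {τ : Lp F 2 (bdry Ω)}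
    (h : HasTrace Ω z τ) : ‖τ‖ₑ ^ 2 ≤ C * ‖z‖ₑ ^ 2 := by
  obtain ⟨φ, a1, a2, a3, a4⟩ := h
  have l1 := tendsto_lintegral_sq_of_tendstoL2 (fun m => (a1 m).continuous.aestronglyMeasurable) a4
  have l2 := tendsto_lintegral_sq_of_tendstoL2 (fun m => (a1 m).continuous.aestronglyMeasurable) a2
  have l3 := fun j => tendsto_lintegral_sq_of_tendstoL2
    (fun m => smooth_fderiv_meas (a1 m) (e j)) (a3 j)
  have l4 : Tendsto (fun m => ∫⁻ x in Ω, energy (φ m) x) atTop (𝓝 (‖z‖ₑ ^ 2)) := by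
    rw [jet_enorm_sq]
    refine (l2.add ((l3 0).add (l3 1))).congr fun m => ?_
    have m0 := ((a1 m).continuous.enorm.measurable.pow_const 2)
    have m1 := ((continuous_fderiv_apply (a1 m) (e 0)).enorm.measurable.pow_const 2)
    rw [← lintegral_add_left m1, ← lintegral_add_left m0]
    rfl
  exact le_of_tendsto_of_tendsto' l1 (ENNReal.Tendsto.const_mul l4 (Or.inr (by simp)))
    fun m => hC (φ m) (a1 m)

lemma hasTrace_of_forall {z : Jet Ω F} {τ : Lp F 2 (bdry Ω)}
    (h : ∀ ε : ℝ≥0∞, ε ≠ 0 → ∃ φ : Plane → F, ContDiff ℝ ∞ φ ∧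
      eLpNorm (fun x => φ x - z.fst x) 2 ((volume : Measure Plane).restrict Ω) ≤ ε ∧
      (∀ j, eLpNorm (fun x => fderiv ℝ φ x (e j) - z.snd j x) 2
        ((volume : Measure Plane).restrict Ω) ≤ ε) ∧
      eLpNorm (fun x => φ x - τ x) 2 (bdry Ω) ≤ ε) : HasTrace Ω z τ := by
  have hu : Tendsto (fun n : ℕ => ((n : ℝ≥0∞) + 1)⁻¹) atTop (𝓝 0) := by
    have := (ENNReal.tendsto_inv_nat_nhds_zero).comp (tendsto_add_atTop_nat 1)
    refine this.congr fun n => ?_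
    simp
  have hn : ∀ n : ℕ, ((n : ℝ≥0∞) + 1)⁻¹ ≠ 0 := fun n => by
    rw [ENNReal.inv_ne_zero]; finiteness
  choose φ b1 b2 b3 b4 using fun n : ℕ => h _ (hn n)
  have sq : ∀ {a : ℕ → ℝ≥0∞}, (∀ n, a n ≤ ((n : ℝ≥0∞) + 1)⁻¹) → Tendsto a atTop (𝓝 0) :=
    fun ha => tendsto_of_tendsto_of_tendsto_of_le_of_le tendsto_const_nhds hu (fun _ => zero_le) ha
  exact ⟨φ, b1, sq b2, fun j => sq fun n => b3 n j, sq b4⟩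

lemma eLpNorm_sub_le_add_enorm {μ : Measure Plane} {φ : Plane → F} (hφ : AEStronglyMeasurable φ μ)
    (f g : Lp F 2 μ) : eLpNorm (fun x => φ x - g x) 2 μ ≤
      eLpNorm (fun x => φ x - f x) 2 μ + ‖f - g‖ₑ := by
  have := eLpNorm_add_le (p := 2) (hφ.sub (Lp.aestronglyMeasurable f))
    (Lp.aestronglyMeasurable (f - g)) (by norm_num)
  rw [Lp.enorm_def]
  refine le_trans (le_of_eq (eLpNorm_congr_ae ?_)) this
  filter_upwards [Lp.coeFn_sub f g] with x hx
  rw [Pi.add_apply, hx, Pi.sub_apply, Pi.sub_apply, sub_add_sub_cancel]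

lemma HasTrace.of_tendsto {z : ℕ → Jet Ω F} {τ : ℕ → Lp F 2 (bdry Ω)} {z' : Jet Ω F}
    {τ' : Lp F 2 (bdry Ω)} (h : ∀ k, HasTrace Ω (z k) (τ k)) (hz : Tendsto z atTop (𝓝 z'))
    (hτ : Tendsto τ atTop (𝓝 τ')) : HasTrace Ω z' τ' := by
  refine hasTrace_of_forall fun ε hε => ?_
  have hε2 : 0 < ε / 2 := ENNReal.half_pos hε
  have t1 : Tendsto (fun k => (z k).fst) atTop (𝓝 z'.fst) :=
    ((WithLp.fstL 2 ℝ (L2 Ω F) _).continuous.tendsto _).comp hz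
  have t2 : ∀ j, Tendsto (fun k => (z k).snd j) atTop (𝓝 (z'.snd j)) := fun j =>
    (((PiLp.proj 2 (fun _ : Fin 2 => L2 Ω F) j (𝕜 := ℝ)).continuous.comp
      (WithLp.sndL 2 ℝ (L2 Ω F) _).continuous).tendsto _).comp hz
  have ev : ∀ {μ : Measure Plane} {f : ℕ → Lp F 2 μ} {g : Lp F 2 μ}, Tendsto f atTop (𝓝 g) →
      ∀ᶠ k in atTop, ‖f k - g‖ₑ ≤ ε / 2 := fun {μ f g} hf => by
    have : Tendsto (fun k => ‖f k - g‖ₑ) atTop (𝓝 0) := by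
      simpa using (hf.sub_const g).enorm
    exact (this.eventually (gt_mem_nhds hε2)).mono fun k hk => le_of_lt hk
  obtain ⟨k, k1, k2, k3, k4⟩ := ((ev t1).and ((ev (t2 0)).and ((ev (t2 1)).and (ev hτ)))).exists
  obtain ⟨φ, a1, a2, a3, a4⟩ := h k
  have ev' : ∀ {a : ℕ → ℝ≥0∞}, Tendsto a atTop (𝓝 0) → ∀ᶠ m in atTop, a m ≤ ε / 2 := fun ha =>
    (ha.eventually (gt_mem_nhds hε2)).mono fun k hk => le_of_lt hk
  obtain ⟨m, m1, m2, m3, m4⟩ :=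
    ((ev' a2).and ((ev' (a3 0)).and ((ev' (a3 1)).and (ev' a4)))).exists
  have hsum : ε / 2 + ε / 2 = ε := ENNReal.add_halves ε
  refine ⟨φ m, a1 m, ?_, fun j => ?_, ?_⟩
  · exact ((eLpNorm_sub_le_add_enorm (a1 m).continuous.aestronglyMeasurable (z k).fst _).trans
      (add_le_add m1 k1)).trans_eq hsum
  · fin_cases j
    · exact ((eLpNorm_sub_le_add_enorm (smooth_fderiv_meas (a1 m) (e 0)) ((z k).snd 0) _).trans
        (add_le_add m2 k2)).trans_eq hsum
    · exact ((eLpNorm_sub_le_add_enorm (smooth_fderiv_meas (a1 m) (e 1)) ((z k).snd 1) _).trans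
        (add_le_add m3 k3)).trans_eq hsum
  · exact ((eLpNorm_sub_le_add_enorm (a1 m).continuous.aestronglyMeasurable (τ k) _).trans
      (add_le_add m4 k4)).trans_eq hsum

lemma ae_eq_zero_of_tendsto {μ : Measure Plane} {Γ : Set Plane} {τ : ℕ → Lp F 2 μ} {τ' : Lp F 2 μ}
    (h : ∀ k, ∀ᵐ x ∂μ.restrict Γ, τ k x = 0) (hτ : Tendsto τ atTop (𝓝 τ')) :
    ∀ᵐ x ∂μ.restrict Γ, τ' x = 0 := by
  have h0 : eLpNorm τ' 2 (μ.restrict Γ) = 0 := by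
    have hle : ∀ k, eLpNorm τ' 2 (μ.restrict Γ) ≤ ‖τ k - τ'‖ₑ := fun k => by
      rw [Lp.enorm_def]
      refine le_trans (le_of_eq ?_) (eLpNorm_mono_measure _ (Measure.restrict_le_self (s := Γ)))
      refine eLpNorm_congr_norm_ae ?_
      filter_upwards [h k, ae_restrict_of_ae (Lp.coeFn_sub (τ k) τ')] with x h1 h2
      rw [h2, Pi.sub_apply, h1, zero_sub, norm_neg]
    have ht : Tendsto (fun k => ‖τ k - τ'‖ₑ) atTop (𝓝 0) := by
      simpa using (hτ.sub_const τ').enorm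
    exact le_antisymm (ge_of_tendsto' ht hle) zero_le
  exact (eLpNorm_eq_zero_iff (Lp.aestronglyMeasurable τ').restrict (by norm_num)).1 h0

theorem IsLipschitzDomain.isClosed_V1 (hΩ : IsLipschitzDomain Ω) (ΓD : Set Plane) :
    IsClosed (V1 Ω ΓD : Set (Jet Ω Plane)) := by
  obtain ⟨C, hC⟩ := hΩ.exists_trace_bound (F := Plane)
  refine IsSeqClosed.isClosed fun z z' hz hzz' => ?_
  choose h1 h2 τ h3 h4 using hz
  have hdist : ∀ k l, ‖τ k - τ l‖ ≤ Real.sqrt C * ‖z k - z l‖ := fun k l => by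
    have ht : HasTrace Ω (z k - z l) (τ k - τ l) := by
      have := (h3 k).add ((h3 l).smul (-1))
      simpa only [neg_smul, one_smul, ← sub_eq_add_neg] using this
    have := ht.enorm_sq_le hC
    simp_rw [enorm_eq_nnnorm] at this
    have h' : ‖τ k - τ l‖₊ ^ 2 ≤ C * ‖z k - z l‖₊ ^ 2 := by exact_mod_cast this
    have h'' : ‖τ k - τ l‖ ^ 2 ≤ C * ‖z k - z l‖ ^ 2 := h'
    refine le_of_sq_le_sq ?_ (by positivity)
    rw [mul_pow, Real.sq_sqrt C.coe_nonneg]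
    exact h''
  have hcau : CauchySeq τ := by
    have hzc := hzz'.cauchySeq
    rw [Metric.cauchySeq_iff] at hzc ⊢
    intro ε hε
    have hs : 0 < Real.sqrt C + 1 := by positivity
    obtain ⟨n, hn⟩ := hzc (ε / (Real.sqrt C + 1)) (by positivity)
    refine ⟨n, fun k hk l hl => ?_⟩
    have := hn k hk l hl
    rw [lt_div_iff₀ hs] at this
    rw [dist_eq_norm] at this ⊢
    refine (hdist k l).trans_lt ?_
    nlinarith [norm_nonneg (z k - z l)]
  obtain ⟨τ', hτ'⟩ := cauchySeq_tendsto_of_complete hcau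
  refine ⟨(isClosed_H1 Ω Plane).mem_of_tendsto hzz' (Eventually.of_forall h1), ?_, τ',
    HasTrace.of_tendsto h3 hzz' hτ', ae_eq_zero_of_tendsto h4 hτ'⟩
  let D : Jet Ω Plane →L[ℝ] L2 Ω ℝ :=
    ∑ j, (comp Ω j).comp ((PiLp.proj 2 (fun _ : Fin 2 => L2 Ω Plane) j (𝕜 := ℝ)).comp
      (WithLp.sndL 2 ℝ (L2 Ω Plane) _))
  have hD : ∀ z : Jet Ω Plane, D z =ᵐ[(volume : Measure Plane).restrict Ω]
      fun x => ∑ j, (z.snd j x) j := fun z => by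
    have e1 : D z = comp Ω 0 (z.snd 0) + comp Ω 1 (z.snd 1) := by
      simp only [D, Fin.sum_univ_two]; rfl
    rw [e1]
    filter_upwards [Lp.coeFn_add (comp Ω 0 (z.snd 0)) (comp Ω 1 (z.snd 1)),
      coeFn_comp 0 (z.snd 0), coeFn_comp 1 (z.snd 1)] with x a1 a2 a3
    rw [a1, Pi.add_apply, a2, a3, Fin.sum_univ_two]
  have hD0 : ∀ k, D (z k) = 0 := fun k => by
    rw [Lp.eq_zero_iff_ae_eq_zero]
    filter_upwards [hD (z k), h2 k] with x a1 a2
    rw [a1, a2, Pi.zero_apply]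
  have hlim : D z' = 0 := by
    refine tendsto_nhds_unique ((D.continuous.tendsto _).comp hzz') ?_
    simp only [Function.comp_def, hD0]
    exact tendsto_const_nhds
  rw [Lp.eq_zero_iff_ae_eq_zero] at hlim
  filter_upwards [hD z', hlim] with x a1 a2
  rw [← a1, a2, Pi.zero_apply]

end Complete

/-! ### Gårding's inequality -/

section Garding

variable {Ω : Set Plane}

lemma enorm_comp_le (i : Fin 2) (w : L2 Ω Plane) : ‖comp Ω i w‖ₑ ≤ ‖w‖ₑ := by
  rw [enorm_eq_nnnorm, enorm_eq_nnnorm]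
  exact_mod_cast norm_comp_le i w

lemma enorm_fst_le (z : Jet Ω Plane) : ‖z.fst‖ₑ ≤ ‖z‖ₑ := by
  refine enn_sq_le_sq ?_
  rw [jet_enorm_sq z]
  exact le_self_add

lemma enorm_snd_le (z : Jet Ω Plane) (j : Fin 2) : ‖z.snd j‖ₑ ≤ ‖z‖ₑ := by
  refine enn_sq_le_sq ?_
  rw [jet_enorm_sq z]
  fin_cases j
  · exact le_self_add.trans le_add_self
  · exact le_add_self.trans le_add_self

lemma enorm_pow_four_le (v : Plane) : ‖v‖ₑ ^ 4 ≤ 16 * (‖v 0‖ₑ ^ 4 + ‖v 1‖ₑ ^ 4) := by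
  have h : ‖v‖ₑ ≤ ‖v 0‖ₑ + ‖v 1‖ₑ := by
    have h1 : ‖v‖₊ ≤ ‖v 0‖₊ + ‖v 1‖₊ := plane_norm_le v
    simp_rw [enorm_eq_nnnorm]
    exact_mod_cast h1
  have key : ∀ {m : ℝ≥0∞}, ‖v 0‖ₑ ≤ m → ‖v 1‖ₑ ≤ m → ‖v‖ₑ ^ 4 ≤ 16 * m ^ 4 := fun {m} h0 h1 => by
    calc ‖v‖ₑ ^ 4 ≤ (m + m) ^ 4 := by gcongr; exact h.trans (add_le_add h0 h1)
      _ = 16 * m ^ 4 := by ring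
  rcases le_total ‖v 0‖ₑ ‖v 1‖ₑ with h0 | h0
  · refine (key h0 le_rfl).trans ?_
    gcongr
    exact le_add_self
  · refine (key le_rfl h0).trans ?_
    gcongr
    exact le_self_add

/-- Ladyzhenskaya's inequality for fields. -/
lemma IsLipschitzDomain.exists_ladyzhenskaya_field (hΩ : IsLipschitzDomain Ω) :
    ∃ C : NNReal, ∀ z ∈ H1 Ω Plane, ∫⁻ x in Ω, ‖z.fst x‖ₑ ^ 4 ≤ (C * (‖z.fst‖ₑ * ‖z‖ₑ)) ^ 2 := by
  obtain ⟨C, hC⟩ := hΩ.exists_ladyzhenskaya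
  refine ⟨288 * C + 1, fun z hz => ?_⟩
  have hi : ∀ i, ∫⁻ x in Ω, ‖z.fst x i‖ₑ ^ 4 ≤ C * (‖z.fst‖ₑ * (3 * ‖z‖ₑ)) ^ 2 := fun i => by
    have h := hC (comp Ω i z.fst) (fun j => comp Ω i (z.snd j)) (hasWeakPartial_comp hz i)
    have e1 : ∫⁻ x in Ω, ‖z.fst x i‖ₑ ^ 4 = ∫⁻ x in Ω, ‖comp Ω i z.fst x‖ₑ ^ 4 := by
      refine lintegral_congr_ae ?_
      filter_upwards [coeFn_comp i z.fst] with x hx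
      rw [hx]
    rw [e1]
    refine h.trans ?_
    gcongr
    · exact enorm_comp_le i _
    · calc ‖comp Ω i z.fst‖ₑ + ‖comp Ω i (z.snd 0)‖ₑ + ‖comp Ω i (z.snd 1)‖ₑ
          ≤ ‖z‖ₑ + ‖z‖ₑ + ‖z‖ₑ := by
            gcongr
            · exact (enorm_comp_le i _).trans (enorm_fst_le z)
            · exact (enorm_comp_le i _).trans (enorm_snd_le z 0)
            · exact (enorm_comp_le i _).trans (enorm_snd_le z 1)
        _ = 3 * ‖z‖ₑ := by ring
  have hm : ∀ i, AEMeasurable (fun x => ‖z.fst x i‖ₑ ^ 4) ((volume : Measure Plane).restrict Ω) :=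
    fun i => (((EuclideanSpace.proj i : Plane →L[ℝ] ℝ).comp_memLp' (Lp.memLp z.fst)).1.enorm).pow_const 4
  calc ∫⁻ x in Ω, ‖z.fst x‖ₑ ^ 4
      ≤ ∫⁻ x in Ω, 16 * (‖z.fst x 0‖ₑ ^ 4 + ‖z.fst x 1‖ₑ ^ 4) :=
        lintegral_mono fun x => enorm_pow_four_le _
    _ = 16 * ((∫⁻ x in Ω, ‖z.fst x 0‖ₑ ^ 4) + ∫⁻ x in Ω, ‖z.fst x 1‖ₑ ^ 4) := by
        rw [lintegral_const_mul' _ _ (by norm_num), lintegral_add_left' (hm 0)]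
    _ ≤ 16 * (C * (‖z.fst‖ₑ * (3 * ‖z‖ₑ)) ^ 2 + C * (‖z.fst‖ₑ * (3 * ‖z‖ₑ)) ^ 2) := by
        gcongr
        · exact hi 0
        · exact hi 1
    _ = (288 * C) * (‖z.fst‖ₑ * ‖z‖ₑ) ^ 2 := by ring
    _ ≤ (((288 * C + 1 : NNReal) : ℝ≥0∞)) ^ 2 * (‖z.fst‖ₑ * ‖z‖ₑ) ^ 2 := by
        gcongr
        have : 288 * C ≤ (288 * C + 1) ^ 2 := by
          have hx : (0 : NNReal) ≤ 288 * C := zero_le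
          nlinarith [hx]
        exact_mod_cast this
    _ = _ := by ring

lemma enorm_inner_sum_smul_le (a w : Plane) (p : Fin 2 → Plane) :
    ‖inner ℝ (∑ j, a j • p j) w‖ₑ ≤ ‖a‖ₑ * ‖w‖ₑ * ‖p 0‖ₑ + ‖a‖ₑ * ‖w‖ₑ * ‖p 1‖ₑ := by
  have hj : ∀ j, ‖a j‖ₑ ≤ ‖a‖ₑ := fun j => by
    have : ‖a j‖₊ ≤ ‖a‖₊ := abs_coord_le a j
    rw [enorm_eq_nnnorm, enorm_eq_nnnorm]
    exact_mod_cast this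
  have hcs : ∀ u : Plane, ‖inner ℝ u w‖ₑ ≤ ‖u‖ₑ * ‖w‖ₑ := fun u => by
    have : ‖inner ℝ u w‖₊ ≤ ‖u‖₊ * ‖w‖₊ := norm_inner_le_norm u w
    simp_rw [enorm_eq_nnnorm]
    exact_mod_cast this
  refine (hcs _).trans ?_
  rw [Fin.sum_univ_two]
  calc ‖a 0 • p 0 + a 1 • p 1‖ₑ * ‖w‖ₑ ≤ (‖a‖ₑ * ‖p 0‖ₑ + ‖a‖ₑ * ‖p 1‖ₑ) * ‖w‖ₑ := by
        gcongr
        refine (enorm_add_le _ _).trans ?_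
        rw [enorm_smul, enorm_smul]
        exact add_le_add (mul_le_mul' (hj 0) le_rfl) (mul_le_mul' (hj 1) le_rfl)
    _ = _ := by ring

lemma IsLipschitzDomain.exists_abs_formB_le (hΩ : IsLipschitzDomain Ω) {vInf : Jet Ω Plane}
    (hv : vInf ∈ H1 Ω Plane) : ∃ D : NNReal, ∀ z ∈ H1 Ω Plane,
      |formB Ω vInf z z| ≤ D * (√(‖z.fst‖ * ‖z‖) * ‖z‖ + ‖z.fst‖ * ‖z‖) := by
  obtain ⟨C, hC⟩ := hΩ.exists_ladyzhenskaya_field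
  let N : NNReal := C * (‖vInf.fst‖₊ * ‖vInf‖₊)
  let D : NNReal := 2 * ((N + 1) * (C + 1)) + 2 * (C * ‖vInf‖₊)
  refine ⟨D, fun z hz => ?_⟩
  let p : NNReal := NNReal.sqrt (‖z.fst‖₊ * ‖z‖₊)
  have hp : p ^ 2 = ‖z.fst‖₊ * ‖z‖₊ := NNReal.sq_sqrt _
  have hpE : (p : ℝ≥0∞) ^ 2 = ‖z.fst‖ₑ * ‖z‖ₑ := by
    simp_rw [enorm_eq_nnnorm]; exact_mod_cast hp
  have hx1 : ∀ x : NNReal, x ≤ (x + 1) ^ 2 := fun x => by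
    have hx : (0 : NNReal) ≤ x := zero_le
    nlinarith [hx]
  have ma : AEMeasurable (fun x => ‖vInf.fst x‖ₑ) ((volume : Measure Plane).restrict Ω) :=
    (Lp.aestronglyMeasurable vInf.fst).enorm
  have mw : AEMeasurable (fun x => ‖z.fst x‖ₑ) ((volume : Measure Plane).restrict Ω) :=
    (Lp.aestronglyMeasurable z.fst).enorm
  have mz : ∀ j, AEMeasurable (fun x => ‖z.snd j x‖ₑ) ((volume : Measure Plane).restrict Ω) :=
    fun j => (Lp.aestronglyMeasurable (z.snd j)).enorm
  have mv : ∀ j, AEMeasurable (fun x => ‖vInf.snd j x‖ₑ) ((volume : Measure Plane).restrict Ω) :=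
    fun j => (Lp.aestronglyMeasurable (vInf.snd j)).enorm
  have h4a : ∫⁻ x in Ω, (‖vInf.fst x‖ₑ ^ 2) ^ 2 ≤ (N : ℝ≥0∞) ^ 2 := by
    simp_rw [← pow_mul]
    have := hC vInf hv
    simp_rw [enorm_eq_nnnorm] at this ⊢
    simpa [N] using this
  have h4w : ∫⁻ x in Ω, (‖z.fst x‖ₑ ^ 2) ^ 2 ≤ (C * (p : ℝ≥0∞) ^ 2) ^ 2 := by
    simp_rw [← pow_mul]
    rw [hpE]
    exact hC z hz
  have hprod : ∫⁻ x in Ω, (‖vInf.fst x‖ₑ * ‖z.fst x‖ₑ) ^ 2 ≤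
      (((N + 1) * (C + 1) * p : NNReal) : ℝ≥0∞) ^ 2 := by
    simp_rw [mul_pow]
    refine (lintegral_mul_le_of_sq (ma.pow_const 2) (mw.pow_const 2) h4a h4w).trans ?_
    have : N * (C * p ^ 2) ≤ ((N + 1) * (C + 1) * p) ^ 2 := by
      calc N * (C * p ^ 2) ≤ (N + 1) ^ 2 * ((C + 1) ^ 2 * p ^ 2) := by
            gcongr
            · exact hx1 N
            · exact hx1 C
        _ = _ := by ring
    exact_mod_cast this
  have hww : ∫⁻ x in Ω, (‖z.fst x‖ₑ * ‖z.fst x‖ₑ) ^ 2 ≤ (C * (p : ℝ≥0∞) ^ 2) ^ 2 := by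
    simpa only [← sq] using h4w
  have hsq : ∀ (w : L2 Ω Plane) {q : ℝ≥0∞}, ‖w‖ₑ ≤ q → ∫⁻ x in Ω, ‖w x‖ₑ ^ 2 ≤ q ^ 2 :=
    fun w q hq => by rw [← enorm_sq_L2]; gcongr
  have t1 : ∀ j, ∫⁻ x in Ω, ‖vInf.fst x‖ₑ * ‖z.fst x‖ₑ * ‖z.snd j x‖ₑ ≤
      ((N + 1) * (C + 1) * p : NNReal) * ‖z‖ₑ := fun j =>
    lintegral_mul_le_of_sq (ma.mul mw) (mz j) hprod (hsq _ (enorm_snd_le z j))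
  have t2 : ∀ j, ∫⁻ x in Ω, ‖z.fst x‖ₑ * ‖z.fst x‖ₑ * ‖vInf.snd j x‖ₑ ≤
      C * (p : ℝ≥0∞) ^ 2 * ‖vInf‖ₑ := fun j =>
    lintegral_mul_le_of_sq (mw.mul mw) (mv j) hww (hsq _ (enorm_snd_le vInf j))
  have m1 : ∀ j, AEMeasurable (fun x => ‖vInf.fst x‖ₑ * ‖z.fst x‖ₑ * ‖z.snd j x‖ₑ)
    ((volume : Measure Plane).restrict Ω) := fun j => (ma.mul mw).mul (mz j)
  have m2 : ∀ j, AEMeasurable (fun x => ‖z.fst x‖ₑ * ‖z.fst x‖ₑ * ‖vInf.snd j x‖ₑ)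
    ((volume : Measure Plane).restrict Ω) := fun j => (mw.mul mw).mul (mv j)
  have hB : ‖formB Ω vInf z z‖ₑ ≤ (D * (p * ‖z‖₊ + p ^ 2) : NNReal) := by
    unfold formB
    refine (enorm_integral_le_lintegral_enorm _).trans ?_
    calc _ ≤ ∫⁻ x in Ω, ((‖vInf.fst x‖ₑ * ‖z.fst x‖ₑ * ‖z.snd 0 x‖ₑ +
            ‖vInf.fst x‖ₑ * ‖z.fst x‖ₑ * ‖z.snd 1 x‖ₑ) +
          (‖z.fst x‖ₑ * ‖z.fst x‖ₑ * ‖vInf.snd 0 x‖ₑ +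
            ‖z.fst x‖ₑ * ‖z.fst x‖ₑ * ‖vInf.snd 1 x‖ₑ)) := by
          refine lintegral_mono fun x => (enorm_add_le _ _).trans (add_le_add ?_ ?_)
          · exact enorm_inner_sum_smul_le _ _ fun j => z.snd j x
          · exact enorm_inner_sum_smul_le _ _ fun j => vInf.snd j x
      _ = ((∫⁻ x in Ω, ‖vInf.fst x‖ₑ * ‖z.fst x‖ₑ * ‖z.snd 0 x‖ₑ) +
            ∫⁻ x in Ω, ‖vInf.fst x‖ₑ * ‖z.fst x‖ₑ * ‖z.snd 1 x‖ₑ) +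
          ((∫⁻ x in Ω, ‖z.fst x‖ₑ * ‖z.fst x‖ₑ * ‖vInf.snd 0 x‖ₑ) +
            ∫⁻ x in Ω, ‖z.fst x‖ₑ * ‖z.fst x‖ₑ * ‖vInf.snd 1 x‖ₑ) := by
          exact (lintegral_add_left' ((m1 0).add (m1 1)) _).trans (congrArg₂ (· + ·)
            (lintegral_add_left' (m1 0) _) (lintegral_add_left' (m2 0) _))
      _ ≤ _ := add_le_add (add_le_add (t1 0) (t1 1)) (add_le_add (t2 0) (t2 1))
      _ ≤ _ := by
          rw [enorm_eq_nnnorm, enorm_eq_nnnorm]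
          have : ((N + 1) * (C + 1) * p * ‖z‖₊ + (N + 1) * (C + 1) * p * ‖z‖₊) +
              (C * p ^ 2 * ‖vInf‖₊ + C * p ^ 2 * ‖vInf‖₊) ≤ D * (p * ‖z‖₊ + p ^ 2) := by
            have e1 : D * (p * ‖z‖₊ + p ^ 2) =
                ((N + 1) * (C + 1) * p * ‖z‖₊ + (N + 1) * (C + 1) * p * ‖z‖₊) +
                  (C * p ^ 2 * ‖vInf‖₊ + C * p ^ 2 * ‖vInf‖₊) +
                (2 * ((N + 1) * (C + 1)) * p ^ 2 + 2 * (C * ‖vInf‖₊) * (p * ‖z‖₊)) := by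
              simp only [D]; ring
            rw [e1]
            exact le_self_add
          exact_mod_cast this
  rw [enorm_eq_nnnorm] at hB
  have hB' : ‖formB Ω vInf z z‖₊ ≤ D * (p * ‖z‖₊ + p ^ 2) := by exact_mod_cast hB
  rw [hp] at hB'
  have h := NNReal.coe_le_coe.2 hB'
  simpa only [p, NNReal.coe_mul, NNReal.coe_add, Real.coe_sqrt, coe_nnnorm, Real.norm_eq_abs] using h

lemma formA_self_ge {Γc : Fin 2 → Set Plane} {ν γ : ℝ} (hγ : 0 < γ) (z : Jet Ω Plane) :
    ν * ∑ i, ∑ j, ‖comp Ω i (z.snd j) + comp Ω j (z.snd i)‖ ^ 2 ≤ formA Ω Γc ν γ z z := by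
  have hb : 0 ≤ 1 / γ * ∫ x in Γc 0 ∪ Γc 1, inner ℝ (trace Ω z x) (trace Ω z x) ∂(bdry Ω) :=
    mul_nonneg (by positivity) (integral_nonneg fun x => real_inner_self_nonneg)
  have hE : ∀ i j, (comp Ω i (z.snd j) + comp Ω j (z.snd i) : L2 Ω ℝ)
      =ᵐ[(volume : Measure Plane).restrict Ω] fun x => z.snd j x i + z.snd i x j := fun i j => by
    filter_upwards [Lp.coeFn_add (comp Ω i (z.snd j)) (comp Ω j (z.snd i)),
      coeFn_comp i (z.snd j), coeFn_comp j (z.snd i)] with x a1 a2 a3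
    rw [a1, Pi.add_apply, a2, a3]
  have hI : ∀ i j, ‖comp Ω i (z.snd j) + comp Ω j (z.snd i)‖ ^ 2 =
      ∫ x in Ω, (z.snd j x i + z.snd i x j) * (z.snd j x i + z.snd i x j) := fun i j => by
    rw [norm_sq_L2_eq]
    refine integral_congr_ae ?_
    filter_upwards [hE i j] with x hx
    rw [hx, sq]
  have hint : ∀ i j, Integrable (fun x => (z.snd j x i + z.snd i x j) * (z.snd j x i + z.snd i x j))
      ((volume : Measure Plane).restrict Ω) := fun i j => by
    have hm := (Lp.memLp (comp Ω i (z.snd j) + comp Ω j (z.snd i))).ae_eq (hE i j)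
    exact hm.integrable_mul hm
  have heq : ν * ∑ i, ∑ j, ‖comp Ω i (z.snd j) + comp Ω j (z.snd i)‖ ^ 2 =
      ∫ x in Ω, ν * ∑ i, ∑ j, (z.snd j x i + z.snd i x j) * (z.snd j x i + z.snd i x j) := by
    rw [integral_const_mul, integral_finsetSum _ fun i _ => integrable_finsetSum _ fun j _ => hint i j]
    congr 1
    refine Finset.sum_congr rfl fun i _ => ?_
    rw [integral_finsetSum _ fun j _ => hint i j]
    exact Finset.sum_congr rfl fun j _ => hI i j
  rw [heq, formA]
  linarith

lemma young_bound {κ D a b r : ℝ} (hκ : 0 < κ) (hr : r ^ 2 = a * b) :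
    D * (r * b + a * b) ≤ κ / 2 * b ^ 2 + (D ^ 2 / κ + D) ^ 2 / κ * a ^ 2 := by
  have h1 : D * r * b ≤ κ / 4 * b ^ 2 + D ^ 2 / κ * (a * b) := by
    rw [← hr]
    have : κ / 4 * b ^ 2 + D ^ 2 / κ * r ^ 2 - D * r * b = (κ / 2 * b - D * r) ^ 2 / κ := by
      field_simp; ring
    have h2 : 0 ≤ (κ / 2 * b - D * r) ^ 2 / κ := by positivity
    linarith
  have h3 : (D ^ 2 / κ + D) * (a * b) ≤ κ / 4 * b ^ 2 + (D ^ 2 / κ + D) ^ 2 / κ * a ^ 2 := by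
    set E := D ^ 2 / κ + D
    have : κ / 4 * b ^ 2 + E ^ 2 / κ * a ^ 2 - E * (a * b) = (κ / 2 * b - E * a) ^ 2 / κ := by
      field_simp; ring
    have h2 : 0 ≤ (κ / 2 * b - E * a) ^ 2 / κ := by positivity
    linarith
  nlinarith

/-- Gårding's inequality for the Oseen form. -/
theorem IsLipschitzDomain.exists_garding (hΩ : IsLipschitzDomain Ω) {vInf : Jet Ω Plane}
    (hv : vInf ∈ H1 Ω Plane) {ν γ : ℝ} (hν : 0 < ν) (hγ : 0 < γ) (Γc : Fin 2 → Set Plane) :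
    ∃ c Λ : ℝ, 0 < c ∧ 0 ≤ Λ ∧ ∀ (ΓD : Set Plane), ∀ z ∈ V1 Ω ΓD,
      c * ‖z‖ ^ 2 ≤ formA Ω Γc ν γ z z + formB Ω vInf z z + Λ * ‖z.fst‖ ^ 2 := by
  obtain ⟨C, hC0, hC⟩ := hΩ.exists_korn
  obtain ⟨D, hD⟩ := hΩ.exists_abs_formB_le hv
  set κ := ν / C with hκ
  have hκ0 : 0 < κ := by positivity
  refine ⟨κ / 2, ν + ((D : ℝ) ^ 2 / κ + D) ^ 2 / κ, by positivity, by positivity,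
    fun ΓD z hz => ?_⟩
  have h1 := hC ΓD z hz
  have h2 := (abs_le.1 (hD z hz.1)).1
  have h3 := formA_self_ge (Ω := Ω) (Γc := Γc) (ν := ν) hγ z
  have h4 := young_bound (D := D) (a := ‖z.fst‖) (b := ‖z‖) hκ0
    (Real.sq_sqrt (show 0 ≤ ‖z.fst‖ * ‖z‖ by positivity))
  set E := ∑ i, ∑ j, ‖comp Ω i (z.snd j) + comp Ω j (z.snd i)‖ ^ 2
  have h5 : κ * ‖z‖ ^ 2 ≤ ν * (E + ‖z.fst‖ ^ 2) := by
    calc κ * ‖z‖ ^ 2 ≤ κ * (C * (E + ‖z.fst‖ ^ 2)) := by gcongr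
      _ = ν * (E + ‖z.fst‖ ^ 2) := by rw [hκ]; field_simp
  linarith

end Garding

/-! ### The Oseen semigroup -/

section Generator

variable {Ω : Set Plane}

/-- The embedding of `V¹` into `L²`. -/
noncomputable def fieldMap (Ω ΓD : Set Plane) : V1 Ω ΓD →L[ℝ] L2 Ω Plane :=
  (WithLp.fstL 2 ℝ (L2 Ω Plane) _).comp (V1 Ω ΓD).subtypeL

lemma injective_fieldMap (hΩ : IsOpen Ω) (ΓD : Set Plane) :
    Function.Injective (fieldMap Ω ΓD) := by
  refine (injective_iff_map_eq_zero (fieldMap Ω ΓD)).2 fun z hz => ?_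
  exact Subtype.ext (H1.eq_zero_of_fst_eq_zero hΩ z.2.1 hz)

/-- A bounded perturbation of the Oseen operator is coercive with respect to the norm of `V¹`. -/
lemma IsLipschitzDomain.exists_isCoerciveGenerator (hΩ : IsLipschitzDomain Ω)
    {vInf : Jet Ω Plane} (hv : vInf ∈ H1 Ω Plane) {ν γ : ℝ} (hν : 0 < ν) (hγ : 0 < γ)
    (Γc : Fin 2 → Set Plane) (ΓD : Set Plane) (P : V0 Ω ΓD →L[ℝ] V0 Ω ΓD)
    {S : ℝ → V0 Ω ΓD →L[ℝ] V0 Ω ΓD}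
    (hgen : IsGenerator (fun x y => ∃ f, OseenGraph Ω ΓD Γc ν γ vInf x f ∧ y = f + P x) S) :
    ∃ c Λ : ℝ, 0 < c ∧ 0 ≤ Λ ∧
      IsCoerciveGenerator S (fieldMap Ω ΓD) (V0 Ω ΓD).subtypeₗᵢ c Λ := by
  obtain ⟨c, Λ, hc, hΛ, hg⟩ := hΩ.exists_garding hv hν hγ Γc
  refine ⟨c, Λ + ‖P‖, hc, by positivity, fun x y hxy => ?_⟩
  obtain ⟨f, ⟨z, hz, hzx, hform⟩, rfl⟩ := (hgen x y).2 hxy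
  refine ⟨⟨z, hz⟩, hzx, ?_⟩
  have h1 := hg ΓD z hz
  have h2 := hform z hz
  have h3 : inner ℝ (-(f : L2 Ω Plane)) z.fst = -inner ℝ f x := by
    rw [hzx, inner_neg_left, Submodule.coe_inner]
  have h4 : ‖z.fst‖ = ‖x‖ := by rw [hzx]; rfl
  have h5 : inner ℝ (P x) x ≤ ‖P‖ * ‖x‖ ^ 2 := by
    refine (real_inner_le_norm _ _).trans ?_
    rw [sq, ← mul_assoc]
    exact mul_le_mul_of_nonneg_right (P.le_opNorm x) (norm_nonneg _)
  have h6 : ‖(⟨z, hz⟩ : V1 Ω ΓD)‖ = ‖z‖ := rfl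
  rw [h3] at h2
  rw [h4, ← h2] at h1
  rw [h6, inner_add_left]
  linarith

end Generator

end Oseen

theorem mainTheorem5
    (Ω Γin Γw Γout : Set Oseen.Plane) (Γc : Fin 2 → Set Oseen.Plane)
    (hΩ : Oseen.IsLipschitzDomain Ω)
    (hΓ : Oseen.IsBoundaryDecomposition Ω Γin Γw Γout Γc)
    (ν γ ε₀ : ℝ) (hν : 0 < ν) (hγ : 0 < γ) (hε₀ : 0 < ε₀) (hε₀' : ε₀ < 1 / 2)
    (vInf : Oseen.Jet Ω Oseen.Plane) (hvInf : Oseen.MemHOneAdd Ω (1 / 2 + ε₀) vInf)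
    (g : Fin 2 → Oseen.Plane → ℝ) (hg : ∀ i, Oseen.MemHHalf Ω (Γc i) (g i)) :
    (∃! B : EuclideanSpace ℝ (Fin 2) →L[ℝ] Oseen.V0 Ω (Γw ∪ Γin),
      Oseen.IsInputOperator Ω (Γw ∪ Γin) Γc γ g B) ∧
    ∀ B : EuclideanSpace ℝ (Fin 2) →L[ℝ] Oseen.V0 Ω (Γw ∪ Γin),
      Oseen.IsInputOperator Ω (Γw ∪ Γin) Γc γ g B →
    ∀ (k : ℕ) (C : Oseen.V0 Ω (Γw ∪ Γin) →L[ℝ] EuclideanSpace ℝ (Fin k))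
      (L : EuclideanSpace ℝ (Fin k) →L[ℝ] Oseen.V0 Ω (Γw ∪ Γin))
      (S : ℝ → Oseen.V0 Ω (Γw ∪ Γin) →L[ℝ] Oseen.V0 Ω (Γw ∪ Γin)),
      Oseen.IsC0Semigroup S →
      Oseen.IsGenerator
        (fun x y => ∃ f, Oseen.OseenGraph Ω (Γw ∪ Γin) Γc ν γ vInf x f ∧ y = f + L (C x)) S →
      Oseen.IsExpStable S →
      ∃ c : ℝ, 0 < c ∧ ∀ u : ℝ → EuclideanSpace ℝ (Fin 2),
        MemLp u 2 (volume.restrict (Ioi 0)) →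
        ∀ v : ℝ → Oseen.V0 Ω (Γw ∪ Γin), Oseen.IsMildSolution S B u v →
          ∃ z : ℝ → Oseen.V1 Ω (Γw ∪ Γin),
            (∀ᵐ t ∂volume.restrict (Ioi (0 : ℝ)),
              (z t : Oseen.Jet Ω Oseen.Plane).fst = (v t : Oseen.L2 Ω Oseen.Plane)) ∧
            MemLp z 2 (volume.restrict (Ioi 0)) ∧
            eLpNorm z 2 (volume.restrict (Ioi 0)) ≤
              ENNReal.ofReal c * eLpNorm u 2 (volume.restrict (Ioi 0)) := by
  refine ⟨Oseen.existsUnique_inputOperator hΩ hΓ γ g hg, fun B _ k C L S hS hgen hst => ?_⟩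
  obtain ⟨M, α, -, hα, hst⟩ := hst
  have hcompl : CompleteSpace (Oseen.V1 Ω (Γw ∪ Γin)) :=
    (hΩ.isClosed_V1 (Γw ∪ Γin)).completeSpace_coe
  obtain ⟨c, Λ, hc, hΛ, hen⟩ :=
    hΩ.exists_isCoerciveGenerator hvInf.1 hν hγ Γc (Γw ∪ Γin) (L.comp C) hgen
  exact hen.mildSolution_memLp hS hst hα hΛ hc (Oseen.injective_fieldMap hΩ.isOpen _) B
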